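/- For $N\ge 1$ let $\mathcal H_N$ be the space of Hermitian $N\times N$ matrices with Lebesgue measure $dM=\prod_i dM_{ii}\prod_{i<j}d\,\mathrm{Re}M_{ij}\,d\,\mathrm{Im}M_{ij}$. For $M\in\mathcal H_N$ with eigenvalues $M_1,\dots,M_N$ (with multiplicity) let $\hat\mu_M=\frac1N\sum_i\delta_{M_i}\in\mathcal P(\mathbb R)$; write likewise $\hat\mu_x=\frac1N\sum_i\delta_{x_i}$ for $x\in\mathbb R^N$, and give $\mathcal P(\mathbb R)$ the weak topology and its Borel $\sigma$-field. Let $A_N,B_N$ be positive semidefinite Hermitian $N\times N$ matrices of operator norm at most $1$, and let $\Phi:\mathbb R\to[0,\infty)$ be continuous and bounded with $\|\Phi\|_\infty<1$. For measurable $X\subset\mathcal P(\mathbb R)$ put $$Z_N(\Phi)(X)=\int_{\{M\in\mathcal H_N:\ \hat\mu_M\in X\}}\exp\Big(-\tfrac N2\mathrm{tr}\,M^2-\mathrm{tr}\otimes\mathrm{tr}\,\log\big(I\otimes I-B_N\otimes\Phi(M)A_N\big)\Big)\,dM,$$ where $\Phi(M)$ is defined by functional calculus and $\log T=-\sum_{k\ge1}(I-T)^k/k$.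 A Young shape is a finite non-increasing sequence $\lambda=(\lambda_1\ge\lambda_2\ge\cdots)$ of non-negative integers (extended by zeros, trailing zeros being ignored), $|\lambda|=\sum_i\lambda_i$, and $l=(l_1,\dots,l_N)$ with $l_i=\lambda_i+N-i$. Let $s_\lambda(x_1,\dots,x_N)=\sum_T\prod_{c}x_{T(c)}$ be the Schur polynomial, the sum running over the semistandard Young tableaux $T$ of shape $\lambda$ with entries in $\{1,\dots,N\}$ and the product over the cells $c$ of $\lambda$ (so $s_\lambda=0$ if $\lambda$ has more than $N$ non-zero rows); for Hermitian $A$ let $s_\lambda(A)$ be its value at the eigenvalues of $A$. For $D,E\in\mathbb R^N$ let $I_N(D,E)=\int\exp\{N\,\mathrm{tr}(U\,\mathrm{diag}(D)\,U^*\mathrm{diag}(E))\}\,dm_N(U)$, with $m_N$ the Haar probability measure on the unitary group $\mathcal U_N$, and let $\Delta(a)=\prod_{i<j}|a_i-a_j|$. For $x\in(0,\infty)^N$ put $$K_\lambda(x)=I_N\Big(\log x,\frac lN\Big)\frac{\Delta(\log x)}{\Delta(x)},$$ where $\log x=(\log x_1,\dots,\log x_N)$ and $\Delta(\log x)/\Delta(x)$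 is extended continuously to vectors with coinciding entries, i.e. is $\prod_{i<j}s(x_i,x_j)$ with $s(u,v)=\frac{\log u-\log v}{u-v}$ for $u\ne v$ and $s(u,u)=u^{-1}$. Then $K_\lambda$ extends continuously to $[0,\infty)^N$; write $K_\lambda$ also for the extension. For continuous bounded $\Phi:\mathbb R\to[0,\infty)$ put $$Z_N(\Phi,\lambda)(X)=\int_{\{x\in\mathbb R^N:\ \hat\mu_x\in X\}}K_\lambda\big(\Phi(x_1),\dots,\Phi(x_N)\big)\,\Delta(x)^2\,e^{-\frac N2\sum_i x_i^2}\prod_{i=1}^N dx_i .$$ **Theorem.** There are constants $c_N>0$, $N\ge1$, with $c_N$ depending only on $N$, such that for all $N$, $A_N$, $B_N$, $\Phi$ and $X$ as above (with $\|\Phi\|_\infty<1$) the logarithm series in $Z_N(\Phi)(X)$ converges for every $M$, all the integrals below are absolutely convergent, and $$Z_N(\Phi)(X)=c_N\sum_\lambda s_\lambda(A_N)\,s_\lambda(B_N)\,Z_N(\Phi,\lambda)(X),$$ the sum over all Young shapes being absolutely convergent. If moreover $\Phi\not\equiv0$, then with $\rho_\Phi=-\log\|\Phi\|_\infty$ and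 $\Psi=\Phi/\|\Phi\|_\infty$, and the same $c_N$, $$Z_N(\Phi)(X)=c_N\sum_\lambda s_\lambda(A_N)\,s_\lambda(B_N)\,Z_N(\Psi,\lambda)(X)\,e^{-\rho_\Phi|\lambda|},$$ again with absolute convergence. -/

import Mathlib

open MeasureTheory Filter Topology
open scoped BoundedContinuousFunction ComplexOrder Matrix Kronecker

noncomputable section

namespace CharacterExpansion

variable {N : ℕ}

/-! ### Schur polynomials -/

/-- The Schur polynomial `s_μ(x_1, …, x_N)`: the sum, over all semistandard tableaux of shape `μ`
with entries in `{1, …, N}` (here `Fin N`), of the product of the `x`'s indexed by the entries.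
A filling of the cells by elements of `Fin N` is admissible when it is the restriction to the
cells of a semistandard Young tableau. -/
def schur (μ : YoungDiagram) (x : Fin N → ℝ) : ℝ :=
  open Classical in
  ∑ f : μ.cells → Fin N with
      ∃ T : SemistandardYoungTableau μ, ∀ c : μ.cells, T c.1.1 c.1.2 = (f c : ℕ),
    ∏ c : μ.cells, x (f c)

/-- The sequence `l_i = μ_i + N - i` (`i = 1, …, N`) associated with a shape and `N`. -/
def shiftedParts (μ : YoungDiagram) (i : Fin N) : ℕ := μ.rowLen i + (N - 1 - i)

/-- `s_μ(A)`, the Schur polynomial at the eigenvalues of the Hermitian matrix `A`. -/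
def schurMatrix (μ : YoungDiagram) {A : Matrix (Fin N) (Fin N) ℂ} (hA : A.IsHermitian) : ℝ :=
  schur μ hA.eigenvalues

/-! ### Hermitian matrices and their Lebesgue measure -/

/-- The space of Hermitian matrices of size `N`. -/
abbrev HermitianMatrix (N : ℕ) := {M : Matrix (Fin N) (Fin N) ℂ // M.IsHermitian}

instance : MeasurableSpace (HermitianMatrix N) := borel _

instance : BorelSpace (HermitianMatrix N) := ⟨rfl⟩

/-- The Hermitian matrix with real coordinates `R`: diagonal entries `R i i`, and, for `i < j`,
the `(i, j)` entry has real part `R i j` and imaginary part `R j i`. -/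
def hermitianOfCoords (R : Fin N → Fin N → ℝ) : HermitianMatrix N :=
  ⟨Matrix.of fun i j =>
      if i < j then (⟨R i j, R j i⟩ : ℂ) else if j < i then ⟨R j i, -R i j⟩ else (R i i : ℂ), by
    ext i j
    rcases lt_trichotomy i j with h | h | h
    · simp [h, h.not_gt, Complex.ext_iff]
    · subst h; simp
    · simp [h, h.not_gt, Complex.ext_iff]⟩

theorem continuous_hermitianOfCoords :
    Continuous (hermitianOfCoords : (Fin N → Fin N → ℝ) → HermitianMatrix N) := by
  refine Continuous.subtype_mk (continuous_matrix fun i j => ?_) _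
  have h : ∀ a b c d : Fin N, Continuous fun R : Fin N → Fin N → ℝ => (⟨R a b, R c d⟩ : ℂ) := by
    intro a b c d
    have : (fun R : Fin N → Fin N → ℝ => (⟨R a b, R c d⟩ : ℂ)) =
        fun R => (R a b : ℂ) + (R c d : ℂ) * Complex.I := by
      funext R; apply Complex.ext <;> simp
    rw [this]; fun_prop
  have h' : ∀ a b c d : Fin N, Continuous fun R : Fin N → Fin N → ℝ => (⟨R a b, -R c d⟩ : ℂ) := by
    intro a b c d
    have : (fun R : Fin N → Fin N → ℝ => (⟨R a b, -R c d⟩ : ℂ)) =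
        fun R => (R a b : ℂ) - (R c d : ℂ) * Complex.I := by
      funext R; apply Complex.ext <;> simp
    rw [this]; fun_prop
  simp only [Matrix.of_apply]
  split_ifs
  · exact h _ _ _ _
  · exact h' _ _ _ _
  · fun_prop

/-- Lebesgue measure `dM = ∏ᵢ dMᵢᵢ ∏_{i<j} d(Re Mᵢⱼ) d(Im Mᵢⱼ)` on Hermitian matrices. -/
def hermitianLebesgue (N : ℕ) : Measure (HermitianMatrix N) :=
  Measure.map hermitianOfCoords (volume : Measure (Fin N → Fin N → ℝ))

/-- The empirical measure `(1/N) ∑ᵢ δ_{xᵢ}`, a probability measure on `ℝ`. -/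
def empirical [NeZero N] (x : Fin N → ℝ) : ProbabilityMeasure ℝ :=
  ⟨(N : ENNReal)⁻¹ • ∑ i, Measure.dirac (x i), ⟨by
    simp [ENNReal.inv_mul_cancel, NeZero.ne N]⟩⟩

/-- The spectral measure of a Hermitian matrix. -/
def spectralMeasure [NeZero N] (M : HermitianMatrix N) : ProbabilityMeasure ℝ :=
  empirical M.2.eigenvalues

/-! ### The partition function -/

/-- The summands of the series `- ∑_{k ≥ 1} (1 - T)^k / k` for the logarithm of `T`. -/
def logTerm {n : Type*} [Fintype n] [DecidableEq n] (T : Matrix n n ℂ) (k : ℕ) : Matrix n n ℂ :=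
  -((k + 1 : ℂ)⁻¹ • (1 - T) ^ (k + 1))

/-- The logarithm `log T = - ∑_{k ≥ 1} (1 - T)^k / k` of a matrix with `‖1 - T‖ < 1`. -/
def matrixLog {n : Type*} [Fintype n] [DecidableEq n] (T : Matrix n n ℂ) : Matrix n n ℂ :=
  ∑' k : ℕ, logTerm T k

/-- The matrix `I ⊗ I - B ⊗ Φ(M) A`, where `Φ(M)` is given by the functional calculus. -/
def interactionMatrix (A B : Matrix (Fin N) (Fin N) ℂ) (Φ : ℝ → ℝ) (M : HermitianMatrix N) :
    Matrix (Fin N × Fin N) (Fin N × Fin N) ℂ :=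
  (1 : Matrix (Fin N) (Fin N) ℂ) ⊗ₖ (1 : Matrix (Fin N) (Fin N) ℂ) - B ⊗ₖ (M.2.cfc Φ * A)

/-- The integrand `exp(-(N/2) tr M² - tr ⊗ tr log (I ⊗ I - B ⊗ Φ(M) A))`. The functional
`tr ⊗ tr` is the trace on matrices indexed by pairs. -/
def weight (A B : Matrix (Fin N) (Fin N) ℂ) (Φ : ℝ → ℝ) (M : HermitianMatrix N) : ℂ :=
  Complex.exp (-((N : ℂ) / 2) * (M.1 * M.1).trace - (matrixLog (interactionMatrix A B Φ M)).trace)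

/-- The partition function `Z_N(Φ)(X)`, the integral over the matrices whose spectral measure
lies in `X`. -/
def partitionFunction [NeZero N] (A B : Matrix (Fin N) (Fin N) ℂ) (Φ : ℝ → ℝ)
    (X : Set (ProbabilityMeasure ℝ)) : ℂ :=
  ∫ M in {M : HermitianMatrix N | spectralMeasure M ∈ X}, weight A B Φ M ∂hermitianLebesgue N

/-! ### Spherical integrals -/

instance : MeasurableSpace (Matrix.unitaryGroup (Fin N) ℂ) := borel _

instance : BorelSpace (Matrix.unitaryGroup (Fin N) ℂ) := ⟨rfl⟩

instance : CompactSpace (Matrix.unitaryGroup (Fin N) ℂ) := by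
  have hK : IsCompact (Set.univ.pi fun _ : Fin N => Set.univ.pi fun _ : Fin N =>
      Metric.closedBall (0 : ℂ) 1) :=
    isCompact_univ_pi fun _ => isCompact_univ_pi fun _ => isCompact_closedBall _ _
  have h : IsCompact (Matrix.unitaryGroup (Fin N) ℂ : Set (Matrix (Fin N) (Fin N) ℂ)) := by
    refine IsCompact.of_isClosed_subset (X := Matrix (Fin N) (Fin N) ℂ) hK isClosed_unitary ?_
    intro U hU i _ j _
    simpa using entry_norm_bound_of_unitary hU i j
  exact isCompact_iff_compactSpace.1 h

/-- The Haar probability measure on the unitary group. -/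
def unitaryHaar (N : ℕ) : Measure (Matrix.unitaryGroup (Fin N) ℂ) :=
  Measure.haarMeasure ⊤

/-- The spherical integral `I_N(D, E) = ∫ exp(N tr(U D U* E)) dm_N(U)` of the real diagonal
matrices `D` and `E` (the trace is real, being that of a product of two Hermitian matrices). -/
def sphericalIntegral (D E : Fin N → ℝ) : ℝ :=
  ∫ U : Matrix.unitaryGroup (Fin N) ℂ,
    Real.exp (N * ((U : Matrix (Fin N) (Fin N) ℂ) * Matrix.diagonal (fun i => (D i : ℂ)) *
      star (U : Matrix (Fin N) (Fin N) ℂ) * Matrix.diagonal (fun i => (E i : ℂ))).trace.re)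
    ∂unitaryHaar N

/-- `Δ(a) = ∏_{i<j} |a_i - a_j|`. -/
def vandermonde (a : Fin N → ℝ) : ℝ := ∏ i, ∏ j ∈ Finset.Ioi i, |a i - a j|

/-- `∫₀¹ (t x + (1 - t) y)⁻¹ dt` for `x, y > 0`, which is `(log x - log y) / (x - y)` off the
diagonal and `x⁻¹` on it. -/
def logSlope (x y : ℝ) : ℝ := if x = y then x⁻¹ else (Real.log x - Real.log y) / (x - y)

/-- The quotient `Δ(log x) / Δ(x)` on positive vectors, extended continuously to vectors with
coinciding entries. -/
def vandermondeRatio (x : Fin N → ℝ) : ℝ := ∏ i, ∏ j ∈ Finset.Ioi i, logSlope (x i) (x j)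

theorem vandermondeRatio_eq {x : Fin N → ℝ} (hx : ∀ i, 0 < x i) (hinj : Function.Injective x) :
    vandermondeRatio x = vandermonde (fun i => Real.log (x i)) / vandermonde x := by
  simp only [vandermondeRatio, vandermonde, ← Finset.prod_div_distrib]
  refine Finset.prod_congr rfl fun i _ => Finset.prod_congr rfl fun j hj => ?_
  have hij : x i ≠ x j := hinj.ne (Finset.mem_Ioi.1 hj).ne
  rw [logSlope, if_neg hij, ← abs_div, abs_of_nonneg]
  rcases lt_or_gt_of_ne hij with h | h
  · exact div_nonneg_of_nonpos (sub_nonpos.2 (Real.log_le_log (hx i) h.le)) (sub_nonpos.2 h.le)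
  · exact div_nonneg (sub_nonneg.2 (Real.log_le_log (hx j) h.le)) (sub_nonneg.2 h.le)

/-- `I_N(log x, l/N) Δ(log x) / Δ(x)` for a vector `x` with positive entries. -/
def posKernel (μ : YoungDiagram) (x : Fin N → ℝ) : ℝ :=
  sphericalIntegral (fun i => Real.log (x i)) (fun i => (shiftedParts μ i : ℝ) / N) *
    vandermondeRatio x

/-- `I_N(log x, l/N) Δ(log x) / Δ(x)` for a vector `x` with nonnegative entries: if some entry
is zero (so that its logarithm is `-∞`), the product is extended by continuity, as its limit
along vectors with positive entries. -/
def kernel (μ : YoungDiagram) (x : Fin N → ℝ) : ℝ :=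
  open Classical in
  if ∀ i, 0 < x i then posKernel μ x
  else limUnder (𝓝[{y : Fin N → ℝ | ∀ i, 0 < y i}] x) (posKernel μ)

/-- The integrand of `Z_N(Φ, μ)`, a function of the eigenvalues `x = (M_1, …, M_N)`. -/
def shapeWeight (Φ : ℝ → ℝ) (μ : YoungDiagram) (x : Fin N → ℝ) : ℝ :=
  kernel μ (fun i => Φ (x i)) * vandermonde x ^ 2 * Real.exp (-((N : ℝ) / 2) * ∑ i, x i ^ 2)

/-- `Z_N(Φ, μ)(X)`, an integral over `(M_1, …, M_N) ∈ ℝ^N`. -/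
def shapeIntegral (N : ℕ) [NeZero N] (Φ : ℝ → ℝ) (μ : YoungDiagram)
    (X : Set (ProbabilityMeasure ℝ)) : ℝ :=
  ∫ x in {x : Fin N → ℝ | empirical x ∈ X}, shapeWeight Φ μ x

end CharacterExpansion

end

open MeasureTheory Filter Topology
open scoped BoundedContinuousFunction ComplexOrder Matrix Kronecker

noncomputable section

namespace CharacterExpansion

/-! ### Tableaux as functions and the branching rule -/

/-- `T` is a semistandard tableau of shape `μ` with entries smaller than `N`. -/
structure IsTableau (N : ℕ) (μ : YoungDiagram) (T : ℕ → ℕ → ℕ) : Prop where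
  row : ∀ {i j k : ℕ}, j < k → (i, k) ∈ μ → T i j ≤ T i k
  col : ∀ {i k j : ℕ}, i < k → (k, j) ∈ μ → T i j < T k j
  zero : ∀ {i j : ℕ}, (i, j) ∉ μ → T i j = 0
  lt : ∀ {i j : ℕ}, (i, j) ∈ μ → T i j < N

theorem IsTableau.le_entry {N : ℕ} {μ : YoungDiagram} {T : ℕ → ℕ → ℕ} (h : IsTableau N μ T)
    {i j : ℕ} (hc : (i, j) ∈ μ) : i ≤ T i j := by
  induction i with
  | zero => exact Nat.zero_le _
  | succ i ih =>
    have h1 := ih (μ.up_left_mem (Nat.le_succ i) le_rfl hc)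
    have h2 := h.col (Nat.lt_add_one i) hc
    omega

theorem isTableau_superstandard {N : ℕ} {μ : YoungDiagram} (hμ : μ.rowLen N = 0) :
    IsTableau N μ fun i j => if (i, j) ∈ μ then i else 0 where
  row hj hc := by rw [if_pos hc, if_pos (μ.up_left_mem le_rfl hj.le hc)]
  col hi hc := by rwa [if_pos hc, if_pos (μ.up_left_mem hi.le le_rfl hc)]
  zero h := if_neg h
  lt {i j} h := by
    rw [if_pos h]
    by_contra! hi
    have := YoungDiagram.mem_iff_lt_rowLen.1 (μ.up_left_mem hi le_rfl h)
    omega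

theorem finite_isTableau (N : ℕ) (μ : YoungDiagram) : {T | IsTableau N μ T}.Finite := by
  have : Finite {T | IsTableau N μ T} := by
    refine Finite.of_injective (β := μ.cells → Fin N)
      (fun T c => ⟨T.1 c.1.1 c.1.2, T.2.lt c.2⟩) fun S T h => ?_
    ext i j
    by_cases hc : (i, j) ∈ μ
    · simpa using congrFun h ⟨(i, j), hc⟩
    · rw [S.2.zero hc, T.2.zero hc]
  exact Set.toFinite _

/-- The finite set of semistandard tableaux of shape `μ` with entries smaller than `N`. -/
def tableaux (N : ℕ) (μ : YoungDiagram) : Finset (ℕ → ℕ → ℕ) := (finite_isTableau N μ).toFinset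

@[simp] theorem mem_tableaux {N : ℕ} {μ : YoungDiagram} {T : ℕ → ℕ → ℕ} :
    T ∈ tableaux N μ ↔ IsTableau N μ T := by simp [tableaux]

/-- The generating function of the tableaux with entries smaller than `N`. -/
def tableauSum (N : ℕ) (μ : YoungDiagram) (y : ℕ → ℝ) : ℝ :=
  ∑ T ∈ tableaux N μ, ∏ c ∈ μ.cells, y (T c.1 c.2)

theorem schur_eq_tableauSum {N : ℕ} (μ : YoungDiagram) (x : Fin N → ℝ) (y : ℕ → ℝ)
    (hy : ∀ i : Fin N, y i = x i) : schur μ x = tableauSum N μ y := by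
  classical
  rw [schur, tableauSum]
  symm
  refine Finset.sum_bij (fun T hT c => ⟨T c.1.1 c.1.2, (mem_tableaux.1 hT).lt c.2⟩) ?_ ?_ ?_ ?_
  · intro T hT
    have h := mem_tableaux.1 hT
    simp only [Finset.mem_filter, Finset.mem_univ, true_and]
    exact ⟨⟨T, h.row, h.col, h.zero⟩, fun c => rfl⟩
  · intro S hS T hT h
    ext i j
    by_cases hc : (i, j) ∈ μ
    · simpa using congrFun h ⟨(i, j), hc⟩
    · rw [(mem_tableaux.1 hS).zero hc, (mem_tableaux.1 hT).zero hc]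
  · intro f hf
    simp only [Finset.mem_filter, Finset.mem_univ, true_and] at hf
    obtain ⟨T, hT⟩ := hf
    refine ⟨T, mem_tableaux.2 ⟨T.row_weak, T.col_strict, T.zeros, fun {i j} h => ?_⟩, ?_⟩
    · rw [hT ⟨(i, j), h⟩]; exact Fin.is_lt _
    · ext c; exact hT c
  · intro T hT
    rw [← Finset.prod_attach]
    refine Finset.prod_congr rfl fun c _ => ?_
    rw [← hy]

/-- The Young diagram with rows `ν 0, …, ν (N - 1)` (for antitone `ν`). -/
def ofRows {N : ℕ} (ν : Fin N → ℕ) : YoungDiagram where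
  cells := ((Finset.range N) ×ˢ (Finset.range (∑ i, ν i))).filter
    fun c => ∀ k : Fin N, (k : ℕ) ≤ c.1 → c.2 < ν k
  isLowerSet := by
    rintro ⟨a, b⟩ ⟨c, d⟩ ⟨h1, h2⟩ h
    simp only [Finset.coe_filter, Finset.mem_product, Finset.mem_range, Set.mem_ofPred_eq] at h ⊢
    simp only at h1 h2
    exact ⟨⟨by omega, by omega⟩, fun k hk => lt_of_le_of_lt h2 (h.2 k (hk.trans h1))⟩

theorem mem_ofRows {N : ℕ} {ν : Fin N → ℕ} (hν : Antitone ν) {i j : ℕ} :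
    (i, j) ∈ ofRows ν ↔ ∃ h : i < N, j < ν ⟨i, h⟩ := by
  rw [← YoungDiagram.mem_cells]
  simp only [ofRows, Finset.mem_filter, Finset.mem_product, Finset.mem_range]
  constructor
  · rintro ⟨⟨h, -⟩, h'⟩
    exact ⟨h, h' ⟨i, h⟩ le_rfl⟩
  · rintro ⟨h, h'⟩
    refine ⟨⟨h, h'.trans_le ?_⟩, fun k hk => h'.trans_le (hν hk)⟩
    exact Finset.single_le_sum (f := ν) (fun _ _ => Nat.zero_le _) (Finset.mem_univ _)

theorem rowLen_ofRows {N : ℕ} {ν : Fin N → ℕ} (hν : Antitone ν) (i : Fin N) :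
    (ofRows ν).rowLen i = ν i := by
  refine le_antisymm ?_ ?_
  · by_contra! h
    obtain ⟨_, h'⟩ := (mem_ofRows hν).1 (YoungDiagram.mem_iff_lt_rowLen.2 h)
    exact lt_irrefl _ h'
  · by_contra! h
    exact lt_irrefl _ (YoungDiagram.mem_iff_lt_rowLen.1 ((mem_ofRows hν).2 ⟨i.2, h⟩))

theorem rowLen_ofRows_of_le {N : ℕ} {ν : Fin N → ℕ} (hν : Antitone ν) {i : ℕ} (hi : N ≤ i) :
    (ofRows ν).rowLen i = 0 := by
  by_contra h
  obtain ⟨h', _⟩ := (mem_ofRows hν).1 (YoungDiagram.mem_iff_lt_rowLen.2 (Nat.pos_of_ne_zero h))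
  omega

theorem rowLen_eq_zero_of_le {μ : YoungDiagram} {i k : ℕ} (h : μ.rowLen i = 0) (hik : i ≤ k) :
    μ.rowLen k = 0 :=
  Nat.le_zero.1 (h ▸ μ.rowLen_anti i k hik)

theorem eq_of_rowLen {μ ν : YoungDiagram} (h : ∀ i, μ.rowLen i = ν.rowLen i) : μ = ν := by
  refine SetLike.ext fun c => ?_
  obtain ⟨i, j⟩ := c
  rw [YoungDiagram.mem_iff_lt_rowLen, YoungDiagram.mem_iff_lt_rowLen, h]

theorem card_eq_sum_rowLen {N : ℕ} {μ : YoungDiagram} (hμ : μ.rowLen N = 0) :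
    μ.card = ∑ i : Fin N, μ.rowLen i := by
  have h : μ.cells = (Finset.range N).biUnion μ.row := by
    ext ⟨i, j⟩
    simp only [YoungDiagram.mem_cells, Finset.mem_biUnion, Finset.mem_range,
      YoungDiagram.mem_row_iff]
    constructor
    · intro hc
      refine ⟨i, ?_, hc, rfl⟩
      by_contra! hi
      have := YoungDiagram.mem_iff_lt_rowLen.1 hc
      rw [rowLen_eq_zero_of_le hμ hi] at this
      omega
    · rintro ⟨_, _, hc, _⟩; exact hc
  rw [YoungDiagram.card, h, Finset.card_biUnion, ← Fin.sum_univ_eq_sum_range]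
  · simp [YoungDiagram.rowLen_eq_card]
  · intro a _ b _ hab
    rw [Function.onFun, Finset.disjoint_left]
    intro c hc hc'
    rw [YoungDiagram.mem_row_iff] at hc hc'
    exact hab (hc.2.symm.trans hc'.2)

/-- The sequences interlacing with the rows of `μ`. -/
def interlacing (N : ℕ) (μ : YoungDiagram) : Finset (Fin N → ℕ) :=
  Fintype.piFinset fun i => Finset.Icc (μ.rowLen (i + 1)) (μ.rowLen i)

theorem mem_interlacing {N : ℕ} {μ : YoungDiagram} {ν : Fin N → ℕ} :
    ν ∈ interlacing N μ ↔ ∀ i : Fin N, μ.rowLen (i + 1) ≤ ν i ∧ ν i ≤ μ.rowLen i := by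
  simp [interlacing]

theorem antitone_of_mem_interlacing {N : ℕ} {μ : YoungDiagram} {ν : Fin N → ℕ}
    (h : ν ∈ interlacing N μ) : Antitone ν := by
  rw [mem_interlacing] at h
  intro i j hij
  rcases hij.eq_or_lt with rfl | hlt
  · exact le_rfl
  · exact (h j).2.trans ((μ.rowLen_anti _ _ (Nat.succ_le_of_lt hlt)).trans (h i).1)

theorem ofRows_le_of_mem_interlacing {N : ℕ} {μ : YoungDiagram} {ν : Fin N → ℕ}
    (h : ν ∈ interlacing N μ) {i j : ℕ} (hc : (i, j) ∈ ofRows ν) : (i, j) ∈ μ := by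
  obtain ⟨hi, hj⟩ := (mem_ofRows (antitone_of_mem_interlacing h)).1 hc
  exact YoungDiagram.mem_iff_lt_rowLen.2 (hj.trans_le (mem_interlacing.1 h ⟨i, hi⟩).2)

/-- The rows of the subtableau of the entries smaller than `N`. -/
def lowerRows (N : ℕ) (μ : YoungDiagram) (T : ℕ → ℕ → ℕ) (i : Fin N) : ℕ :=
  ((Finset.range (μ.rowLen i)).filter fun j => T i j < N).card

theorem lt_lowerRows {N : ℕ} {μ : YoungDiagram} {T : ℕ → ℕ → ℕ} (hT : IsTableau (N + 1) μ T)
    (i : Fin N) {j : ℕ} : j < lowerRows N μ T i ↔ ((i : ℕ), j) ∈ μ ∧ T i j < N := by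
  have h : ∀ k, ((i : ℕ), k) ∈ μ → T i k < N → ∀ j ≤ k, ((i : ℕ), j) ∈ μ ∧ T i j < N := by
    intro k hk hkN j hjk
    refine ⟨μ.up_left_mem le_rfl hjk hk, ?_⟩
    rcases hjk.eq_or_lt with rfl | hlt
    · exact hkN
    · exact (hT.row hlt hk).trans_lt hkN
  constructor
  · intro hj
    by_contra hcon
    have hsub : ((Finset.range (μ.rowLen i)).filter fun j => T i j < N) ⊆ Finset.range j := by
      intro k hk
      simp only [Finset.mem_filter, Finset.mem_range] at hk ⊢
      by_contra! hjk
      exact hcon (h k (YoungDiagram.mem_iff_lt_rowLen.2 hk.1) hk.2 j hjk)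
    have := Finset.card_le_card hsub
    rw [Finset.card_range] at this
    exact absurd hj (not_lt.2 this)
  · rintro ⟨hc, hjN⟩
    have hsub : Finset.range (j + 1) ⊆
        ((Finset.range (μ.rowLen i)).filter fun j => T i j < N) := by
      intro k hk
      simp only [Finset.mem_filter, Finset.mem_range] at hk ⊢
      obtain ⟨h1, h2⟩ := h j hc hjN k (by omega)
      exact ⟨YoungDiagram.mem_iff_lt_rowLen.1 h1, h2⟩
    have := Finset.card_le_card hsub
    rw [Finset.card_range] at this
    exact this

theorem lowerRows_mem_interlacing {N : ℕ} {μ : YoungDiagram} {T : ℕ → ℕ → ℕ}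
    (hT : IsTableau (N + 1) μ T) : lowerRows N μ T ∈ interlacing N μ := by
  refine mem_interlacing.2 fun i => ⟨?_, ?_⟩
  · by_contra! h
    have hc : ((i : ℕ) + 1, lowerRows N μ T i) ∈ μ := YoungDiagram.mem_iff_lt_rowLen.2 h
    have h1 := hT.col (Nat.lt_add_one (i : ℕ)) hc
    have h2 := hT.lt hc
    exact lt_irrefl _ ((lt_lowerRows hT i).2 ⟨μ.up_left_mem (Nat.le_succ _) le_rfl hc, by omega⟩)
  · by_contra! h
    exact lt_irrefl _ (YoungDiagram.mem_iff_lt_rowLen.1 ((lt_lowerRows hT i).1 h).1)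

theorem mem_ofRows_lowerRows {N : ℕ} {μ : YoungDiagram} {T : ℕ → ℕ → ℕ}
    (hT : IsTableau (N + 1) μ T) {i j : ℕ} :
    (i, j) ∈ ofRows (lowerRows N μ T) ↔ (i, j) ∈ μ ∧ T i j < N := by
  rw [mem_ofRows (antitone_of_mem_interlacing (lowerRows_mem_interlacing hT))]
  constructor
  · rintro ⟨hi, hj⟩; exact (lt_lowerRows hT ⟨i, hi⟩).1 hj
  · rintro ⟨hc, hlt⟩
    have hi : i < N := (hT.le_entry hc).trans_lt hlt
    exact ⟨hi, (lt_lowerRows hT ⟨i, hi⟩).2 ⟨hc, hlt⟩⟩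

theorem isTableau_restrict {N : ℕ} {μ : YoungDiagram} {T : ℕ → ℕ → ℕ}
    (hT : IsTableau (N + 1) μ T) : IsTableau N (ofRows (lowerRows N μ T))
      fun i j => if (i, j) ∈ ofRows (lowerRows N μ T) then T i j else 0 where
  row {i j k} hjk hc := by
    rw [if_pos hc, if_pos ((ofRows _).up_left_mem le_rfl hjk.le hc)]
    exact hT.row hjk ((mem_ofRows_lowerRows hT).1 hc).1
  col {i k j} hik hc := by
    rw [if_pos hc, if_pos ((ofRows _).up_left_mem hik.le le_rfl hc)]
    exact hT.col hik ((mem_ofRows_lowerRows hT).1 hc).1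
  zero h := if_neg h
  lt h := by rw [if_pos h]; exact ((mem_ofRows_lowerRows hT).1 h).2

/-- The extension of a tableau of shape `ofRows ν` by entries `N` to a tableau of shape `μ`. -/
def extendTableau (N : ℕ) (μ : YoungDiagram) (ν : Fin N → ℕ) (S : ℕ → ℕ → ℕ) (i j : ℕ) : ℕ :=
  if (i, j) ∈ ofRows ν then S i j else if (i, j) ∈ μ then N else 0

theorem isTableau_extendTableau {N : ℕ} {μ : YoungDiagram} (hμ : μ.rowLen (N + 1) = 0)
    {ν : Fin N → ℕ} (hν : ν ∈ interlacing N μ) {S : ℕ → ℕ → ℕ} (hS : IsTableau N (ofRows ν) S) :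
    IsTableau (N + 1) μ (extendTableau N μ ν S) where
  row {i j k} hjk hc := by
    have hc' := μ.up_left_mem le_rfl hjk.le hc
    unfold extendTableau
    by_cases h : (i, k) ∈ ofRows ν
    · rw [if_pos h, if_pos ((ofRows _).up_left_mem le_rfl hjk.le h)]
      exact hS.row hjk h
    · rw [if_neg h, if_pos hc]
      split_ifs with h'
      · exact (hS.lt h').le
      · exact le_rfl
  col {i k j} hik hc := by
    have hc' := μ.up_left_mem hik.le le_rfl hc
    have hk : k < N + 1 := by
      by_contra! hk
      have := YoungDiagram.mem_iff_lt_rowLen.1 hc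
      rw [rowLen_eq_zero_of_le hμ hk] at this
      omega
    have hi : (i, j) ∈ ofRows ν := by
      refine (mem_ofRows (antitone_of_mem_interlacing hν)).2 ⟨by omega, ?_⟩
      refine lt_of_lt_of_le ?_ (mem_interlacing.1 hν ⟨i, by omega⟩).1
      exact YoungDiagram.mem_iff_lt_rowLen.1 (μ.up_left_mem (Nat.succ_le_of_lt hik) le_rfl hc)
    unfold extendTableau
    rw [if_pos hi]
    split_ifs with h
    · exact hS.col hik h
    · exact hS.lt hi
  zero h := by
    unfold extendTableau
    rw [if_neg fun h' => h (ofRows_le_of_mem_interlacing hν h'), if_neg h]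
  lt h := by
    unfold extendTableau
    split_ifs with h'
    · exact (hS.lt h').trans (Nat.lt_add_one N)
    · exact Nat.lt_add_one N

theorem lowerRows_extendTableau {N : ℕ} {μ : YoungDiagram} (hμ : μ.rowLen (N + 1) = 0)
    {ν : Fin N → ℕ} (hν : ν ∈ interlacing N μ) {S : ℕ → ℕ → ℕ} (hS : IsTableau N (ofRows ν) S) :
    lowerRows N μ (extendTableau N μ ν S) = ν := by
  funext i
  have hE := isTableau_extendTableau hμ hν hS
  have key : ∀ j, j < lowerRows N μ (extendTableau N μ ν S) i ↔ j < ν i := by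
    intro j
    have h2 : j < ν i ↔ ((i : ℕ), j) ∈ ofRows ν := by
      rw [mem_ofRows (antitone_of_mem_interlacing hν)]
      exact ⟨fun h => ⟨i.2, h⟩, fun ⟨_, h⟩ => h⟩
    rw [lt_lowerRows hE, h2]
    unfold extendTableau
    constructor
    · rintro ⟨hc, hlt⟩
      by_contra h
      rw [if_neg h, if_pos hc] at hlt
      exact lt_irrefl _ hlt
    · intro h
      rw [if_pos h]
      exact ⟨ofRows_le_of_mem_interlacing hν h, hS.lt h⟩
  exact le_antisymm (not_lt.1 fun h => lt_irrefl _ ((key _).1 h))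
    (not_lt.1 fun h => lt_irrefl _ ((key _).2 h))

/-- The branching rule for Schur polynomials. -/
theorem tableauSum_succ {N : ℕ} {μ : YoungDiagram} (hμ : μ.rowLen (N + 1) = 0) (y : ℕ → ℝ) :
    tableauSum (N + 1) μ y =
      ∑ ν ∈ interlacing N μ, y N ^ (μ.card - (ofRows ν).card) * tableauSum N (ofRows ν) y := by
  simp only [tableauSum, Finset.mul_sum]
  rw [Finset.sum_sigma']
  refine Finset.sum_bij'
    (fun T _ => ⟨lowerRows N μ T,
      fun i j => if (i, j) ∈ ofRows (lowerRows N μ T) then T i j else 0⟩)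
    (fun p _ => extendTableau N μ p.1 p.2) ?_ ?_ ?_ ?_ ?_
  · intro T hT
    rw [mem_tableaux] at hT
    simp only [Finset.mem_sigma, mem_tableaux]
    exact ⟨lowerRows_mem_interlacing hT, isTableau_restrict hT⟩
  · rintro ⟨ν, S⟩ h
    simp only [Finset.mem_sigma, mem_tableaux] at h ⊢
    exact isTableau_extendTableau hμ h.1 h.2
  · intro T hT
    rw [mem_tableaux] at hT
    funext i j
    simp only [extendTableau]
    split_ifs with h h'
    · rfl
    · have h1 := hT.lt h'
      by_contra hne
      exact h ((mem_ofRows_lowerRows hT).2 ⟨h', by omega⟩)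
    · exact (hT.zero h').symm
  · rintro ⟨ν, S⟩ h
    simp only [Finset.mem_sigma, mem_tableaux] at h
    simp only [lowerRows_extendTableau hμ h.1 h.2]
    congr 1
    funext i j
    simp only [extendTableau]
    split_ifs with h'
    · rfl
    · exact (h.2.zero h').symm
  · intro T hT
    rw [mem_tableaux] at hT
    have hsub : (ofRows (lowerRows N μ T)).cells ⊆ μ.cells := by
      rintro ⟨i, j⟩ h
      exact ((mem_ofRows_lowerRows hT).1 h).1
    rw [← Finset.prod_sdiff hsub, YoungDiagram.card, YoungDiagram.card,
      ← Finset.card_sdiff_of_subset hsub, ← Finset.prod_const]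
    congr 1
    · refine Finset.prod_congr rfl fun c hc => ?_
      obtain ⟨i, j⟩ := c
      rw [Finset.mem_sdiff] at hc
      congr 1
      have h1 := hT.lt hc.1
      have h2 : ¬ T i j < N := fun h => hc.2 ((mem_ofRows_lowerRows hT).2 ⟨hc.1, h⟩)
      simp only
      omega
    · refine Finset.prod_congr rfl fun c hc => ?_
      obtain ⟨i, j⟩ := c
      simp only
      rw [if_pos (show (i, j) ∈ ofRows (lowerRows N μ T) from hc)]

theorem schur_eq_zero {N : ℕ} {μ : YoungDiagram} (hμ : μ.rowLen N ≠ 0) (x : Fin N → ℝ) :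
    schur μ x = 0 := by
  rw [schur_eq_tableauSum μ x (fun k => if h : k < N then x ⟨k, h⟩ else 0) (fun i => by simp),
    tableauSum]
  refine Finset.sum_eq_zero fun T hT => absurd ?_ (lt_irrefl N)
  rw [mem_tableaux] at hT
  have hc : (N, 0) ∈ μ := YoungDiagram.mem_iff_lt_rowLen.2 (Nat.pos_of_ne_zero hμ)
  exact (hT.le_entry hc).trans_lt (hT.lt hc)

/-! ### Alternants and the bialternant formula -/

/-- The alternant `det (x_i ^ l_j)`. -/
def alternant {N : ℕ} (l : Fin N → ℕ) (x : Fin N → ℝ) : ℝ :=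
  (Matrix.of fun i j => x i ^ l j).det

theorem det_of_sum {n κ R : Type*} [Fintype n] [DecidableEq n] [DecidableEq κ] [CommRing R]
    (S : n → Finset κ) (f : n → n → κ → R) :
    (Matrix.of fun i j => ∑ m ∈ S j, f i j m).det =
      ∑ m ∈ Fintype.piFinset S, (Matrix.of fun i j => f i j (m j)).det := by
  simp only [Matrix.det_apply, Matrix.of_apply]
  rw [Finset.sum_comm]
  refine Finset.sum_congr rfl fun σ _ => ?_
  rw [← Finset.smul_sum, Finset.prod_univ_sum]

theorem alternant_succ {N : ℕ} (l : Fin (N + 1) → ℕ) (hl : ∀ j : Fin N, l j.succ ≤ l j.castSucc)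
    (x : Fin (N + 1) → ℝ) :
    alternant l x = x (Fin.last N) ^ l (Fin.last N) *
      (∏ i : Fin N, (x i.castSucc - x (Fin.last N))) *
      ∑ m ∈ Fintype.piFinset fun j : Fin N => Finset.Ico (l j.succ) (l j.castSucc),
        (∏ j : Fin N, x (Fin.last N) ^ (l j.castSucc - 1 - m j)) *
          alternant m fun i => x i.castSucc := by
  set u := x (Fin.last N) with hu
  set A : Matrix (Fin (N + 1)) (Fin (N + 1)) ℝ := Matrix.of fun i j => x i ^ l j with hA
  set C : Matrix (Fin (N + 1)) (Fin (N + 1)) ℝ := Matrix.of fun k j =>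
    if k = j then 1 else
      if h : (j : ℕ) < N then
        if k = Fin.succ ⟨j, h⟩ then -u ^ (l j - l k) else 0 else 0 with hC
  have hCdet : C.det = 1 := by
    rw [Matrix.det_of_isLowerTriangular]
    · simp [hC]
    · intro i j hij
      have hij' : i < j := hij
      simp only [hC, Matrix.of_apply]
      rw [if_neg hij'.ne]
      split_ifs with h1 h2
      · rw [h2, Fin.lt_def] at hij'; simp at hij'
      · rfl
      · rfl
  have hcast : ∀ (i : Fin (N + 1)) (j : Fin N), (A * C) i j.castSucc =
      (x i - u) * ∑ m ∈ Finset.Ico (l j.succ) (l j.castSucc),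
        x i ^ m * u ^ (l j.castSucc - 1 - m) := by
    intro i j
    have hne : j.castSucc ≠ j.succ := (Fin.castSucc_lt_succ (i := j)).ne
    rw [Matrix.mul_apply, Finset.sum_eq_add_of_mem j.castSucc j.succ (Finset.mem_univ _)
      (Finset.mem_univ _) hne]
    · simp only [hA, hC, Matrix.of_apply, if_true, mul_one]
      rw [if_neg hne.symm, dif_pos (by simp), if_pos (by ext; simp)]
      have h1 := Commute.mul_geom_sum₂_Ico (Commute.all (x i) u) (hl j)
      rw [h1, mul_neg, ← sub_eq_add_neg]
    · intro k _ hk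
      simp only [hA, hC, Matrix.of_apply]
      rw [if_neg hk.1, dif_pos (by simp), if_neg, mul_zero]
      intro h
      exact hk.2 (by rw [h]; ext; simp)
  have hlast : ∀ i, (A * C) i (Fin.last N) = x i ^ l (Fin.last N) := by
    intro i
    rw [Matrix.mul_apply, Finset.sum_eq_single (Fin.last N)]
    · simp [hA, hC]
    · intro k _ hk
      simp [hC, hk]
    · simp
  have hdet : alternant l x = (A * C).det := by rw [Matrix.det_mul, hCdet, mul_one]; rfl
  rw [hdet, Matrix.det_succ_row _ (Fin.last N), Finset.sum_eq_single (Fin.last N)]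
  · rw [hlast, ← hu]
    have h1 : (-1 : ℝ) ^ ((Fin.last N : ℕ) + (Fin.last N : ℕ)) = 1 :=
      Even.neg_one_pow ⟨_, rfl⟩
    rw [h1, one_mul, mul_assoc]
    congr 1
    have h2 : (A * C).submatrix (Fin.last N).succAbove (Fin.last N).succAbove =
        Matrix.of fun i j : Fin N => (x i.castSucc - u) *
          (Matrix.of fun i j : Fin N => ∑ m ∈ Finset.Ico (l j.succ) (l j.castSucc),
            x i.castSucc ^ m * u ^ (l j.castSucc - 1 - m)) i j := by
      ext i j
      simp only [Matrix.submatrix_apply, Fin.succAbove_last, hcast, Matrix.of_apply]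
    rw [h2, Matrix.det_mul_column, det_of_sum]
    congr 1
    refine Finset.sum_congr rfl fun m _ => ?_
    rw [alternant, ← Matrix.det_mul_row]
    congr 1
    ext i j
    simp only [Matrix.of_apply]
    ring
  · intro j _ hj
    obtain ⟨j', rfl⟩ := Fin.exists_castSucc_eq.2 hj
    rw [hcast, ← hu, sub_self]
    simp
  · simp

theorem shiftedParts_apply {N : ℕ} (μ : YoungDiagram) (i : Fin N) :
    shiftedParts μ i = μ.rowLen i + (N - 1 - i) := rfl

theorem alternant_branching {N : ℕ} {μ : YoungDiagram} (hμ : μ.rowLen (N + 1) = 0) (y : ℕ → ℝ) :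
    alternant (shiftedParts μ) (fun i : Fin (N + 1) => y i) =
      (∏ i : Fin N, (y i - y N)) * ∑ ν ∈ interlacing N μ, y N ^ (μ.card - (ofRows ν).card) *
        alternant (shiftedParts (ofRows ν)) fun i : Fin N => y i := by
  have hl : ∀ j : Fin N, shiftedParts (N := N + 1) μ j.succ ≤ shiftedParts μ j.castSucc := by
    intro j
    have := μ.rowLen_anti j (j + 1) (Nat.le_succ _)
    simp only [shiftedParts_apply, Fin.val_succ, Fin.val_castSucc]
    omega
  rw [alternant_succ _ hl, mul_comm (_ ^ _), mul_assoc, Finset.mul_sum]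
  simp only [Fin.val_castSucc, Fin.val_last]
  congr 1
  symm
  refine Finset.sum_bij' (fun ν _ j => ν j + (N - 1 - j)) (fun m _ j => m j - (N - 1 - j))
    ?_ ?_ ?_ ?_ ?_
  · intro ν hν
    rw [mem_interlacing] at hν
    rw [Fintype.mem_piFinset]
    intro j
    have := hν j
    simp only [shiftedParts_apply, Fin.val_succ, Fin.val_castSucc, Finset.mem_Ico]
    omega
  · intro m hm
    rw [Fintype.mem_piFinset] at hm
    refine mem_interlacing.2 fun j => ?_
    have := hm j
    change _ ≤ m j - (N - 1 - j) ∧ m j - (N - 1 - j) ≤ _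
    simp only [shiftedParts_apply, Fin.val_succ, Fin.val_castSucc, Finset.mem_Ico] at this
    omega
  · intro ν _
    funext j
    simp
  · intro m hm
    rw [Fintype.mem_piFinset] at hm
    funext j
    have := hm j
    change m j - (N - 1 - j) + (N - 1 - j) = m j
    simp only [shiftedParts_apply, Fin.val_succ, Fin.val_castSucc, Finset.mem_Ico] at this
    omega
  · intro ν hν
    have hanti := antitone_of_mem_interlacing hν
    have hcard : (ofRows ν).card = ∑ j, ν j := by
      rw [card_eq_sum_rowLen (rowLen_ofRows_of_le hanti le_rfl)]
      exact Finset.sum_congr rfl fun j _ => rowLen_ofRows hanti j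
    have hsh : shiftedParts (ofRows ν) = fun j : Fin N => ν j + (N - 1 - j) := by
      funext j
      rw [shiftedParts_apply, rowLen_ofRows hanti]
    rw [hsh, ← mul_assoc, Finset.prod_pow_eq_pow_sum, ← pow_add, hcard, card_eq_sum_rowLen hμ,
      Fin.sum_univ_castSucc]
    congr 2
    rw [mem_interlacing] at hν
    have h1 : ∀ j : Fin N, shiftedParts (N := N + 1) μ j.castSucc - 1 - (ν j + (N - 1 - j)) =
        μ.rowLen j - ν j := by
      intro j
      have := hν j
      simp only [shiftedParts_apply, Fin.val_castSucc]
      omega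
    simp only [h1, Fin.val_castSucc, Fin.val_last]
    rw [Finset.sum_tsub_distrib _ fun j _ => (hν j).2]
    have h2 : ∑ j, ν j ≤ ∑ j : Fin N, μ.rowLen j := Finset.sum_le_sum fun j _ => (hν j).2
    rw [shiftedParts_apply]
    simp only [Fin.val_last]
    omega

theorem rowLen_bot (i : ℕ) : (⊥ : YoungDiagram).rowLen i = 0 := by
  by_contra h
  exact YoungDiagram.notMem_bot _ (YoungDiagram.mem_iff_lt_rowLen.2 (Nat.pos_of_ne_zero h))

theorem alternant_bot_succ {N : ℕ} (y : ℕ → ℝ) :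
    alternant (shiftedParts ⊥) (fun i : Fin (N + 1) => y i) =
      (∏ i : Fin N, (y i - y N)) * alternant (shiftedParts ⊥) fun i : Fin N => y i := by
  have h : interlacing N ⊥ = {0} := by
    ext ν
    rw [mem_interlacing, Finset.mem_singleton]
    simp only [rowLen_bot]
    exact ⟨fun h => funext fun i => Nat.le_zero.1 (h i).2, fun h => by simp [h]⟩
  have h0 : ofRows (0 : Fin N → ℕ) = ⊥ := by
    refine eq_of_rowLen fun i => ?_
    rw [rowLen_bot]
    rcases lt_or_ge i N with h | h
    · exact rowLen_ofRows (fun _ _ _ => le_rfl) ⟨i, h⟩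
    · exact rowLen_ofRows_of_le (fun _ _ _ => le_rfl) h
  rw [alternant_branching (rowLen_bot _), h, Finset.sum_singleton, h0]
  simp

theorem tableauSum_mul_alternant {N : ℕ} {μ : YoungDiagram} (hμ : μ.rowLen N = 0) (y : ℕ → ℝ) :
    tableauSum N μ y * alternant (shiftedParts ⊥) (fun i : Fin N => y i) =
      alternant (shiftedParts μ) fun i : Fin N => y i := by
  induction N generalizing μ with
  | zero =>
    have h : μ = ⊥ := eq_of_rowLen fun i => by
      rw [rowLen_bot, rowLen_eq_zero_of_le hμ (Nat.zero_le i)]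
    subst h
    rw [← schur_eq_tableauSum (N := 0) ⊥ (fun i => y i) y fun _ => rfl, schur,
      Finset.sum_eq_single_of_mem (fun c => (YoungDiagram.notMem_bot _ c.2).elim)]
    · simp
    · simp only [Finset.mem_filter, Finset.mem_univ, true_and]
      exact ⟨default, fun c => (YoungDiagram.notMem_bot _ c.2).elim⟩
    · intro f _ hf
      exact absurd (funext fun c => (YoungDiagram.notMem_bot _ c.2).elim) hf
  | succ N ih =>
    rw [tableauSum_succ hμ, alternant_bot_succ, alternant_branching hμ, Finset.sum_mul,
      Finset.mul_sum]
    refine Finset.sum_congr rfl fun ν hν => ?_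
    rw [← ih (rowLen_ofRows_of_le (antitone_of_mem_interlacing hν) le_rfl)]
    ring

/-- The bialternant formula for Schur polynomials. -/
theorem schur_mul_alternant {N : ℕ} {μ : YoungDiagram} (hμ : μ.rowLen N = 0) (x : Fin N → ℝ) :
    schur μ x * alternant (shiftedParts ⊥) x = alternant (shiftedParts μ) x := by
  set y : ℕ → ℝ := fun k => if h : k < N then x ⟨k, h⟩ else 0 with hy
  have hyx : (fun i : Fin N => y i) = x := by funext i; simp [hy]
  rw [schur_eq_tableauSum μ x y fun i => congrFun hyx i]
  simpa only [hyx] using tableauSum_mul_alternant hμ y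

/-! ### Basic properties of Schur polynomials -/

/-- A sequence indexed by `ℕ` which extends `x`. -/
def extendZero {N : ℕ} (x : Fin N → ℝ) (k : ℕ) : ℝ := if h : k < N then x ⟨k, h⟩ else 0

@[simp] theorem extendZero_val {N : ℕ} (x : Fin N → ℝ) (i : Fin N) : extendZero x i = x i := by
  simp [extendZero]

theorem schur_eq {N : ℕ} (μ : YoungDiagram) (x : Fin N → ℝ) :
    schur μ x = ∑ T ∈ tableaux N μ, ∏ c ∈ μ.cells, extendZero x (T c.1 c.2) :=
  schur_eq_tableauSum μ x _ fun i => extendZero_val x i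

theorem extendZero_nonneg {N : ℕ} {x : Fin N → ℝ} (hx : ∀ i, 0 ≤ x i) (k : ℕ) :
    0 ≤ extendZero x k := by
  unfold extendZero
  split_ifs with h
  exacts [hx _, le_rfl]

theorem schur_nonneg {N : ℕ} (μ : YoungDiagram) {x : Fin N → ℝ} (hx : ∀ i, 0 ≤ x i) :
    0 ≤ schur μ x := by
  rw [schur_eq]
  exact Finset.sum_nonneg fun T _ => Finset.prod_nonneg fun c _ => extendZero_nonneg hx _

theorem schur_mono {N : ℕ} (μ : YoungDiagram) {x y : Fin N → ℝ} (hx : ∀ i, 0 ≤ x i)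
    (hxy : ∀ i, x i ≤ y i) : schur μ x ≤ schur μ y := by
  rw [schur_eq, schur_eq]
  refine Finset.sum_le_sum fun T _ => Finset.prod_le_prod (fun c _ => extendZero_nonneg hx _)
    fun c _ => ?_
  unfold extendZero
  split_ifs with h
  exacts [hxy _, le_rfl]

theorem schur_smul {N : ℕ} (μ : YoungDiagram) (t : ℝ) (x : Fin N → ℝ) :
    schur μ (fun i => t * x i) = t ^ μ.card * schur μ x := by
  rw [schur_eq, schur_eq, Finset.mul_sum]
  refine Finset.sum_congr rfl fun T _ => ?_
  rw [YoungDiagram.card, ← Finset.prod_const, ← Finset.prod_mul_distrib]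
  refine Finset.prod_congr rfl fun c _ => ?_
  unfold extendZero
  split_ifs <;> simp

theorem continuous_schur {N : ℕ} (μ : YoungDiagram) :
    Continuous (schur μ : (Fin N → ℝ) → ℝ) := by
  have h : (schur μ : (Fin N → ℝ) → ℝ) =
      fun x => ∑ T ∈ tableaux N μ, ∏ c ∈ μ.cells, extendZero x (T c.1 c.2) :=
    funext fun x => schur_eq μ x
  rw [h]
  refine continuous_finsetSum _ fun T _ => continuous_finsetProd _ fun c _ => ?_
  unfold extendZero
  split_ifs <;> fun_prop

theorem le_schur {N : ℕ} {μ : YoungDiagram} (hμ : μ.rowLen N = 0) {x : Fin N → ℝ}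
    (hx : ∀ i, 0 ≤ x i) : ∏ c ∈ μ.cells, extendZero x c.1 ≤ schur μ x := by
  rw [schur_eq]
  refine le_trans (le_of_eq ?_) (Finset.single_le_sum
    (f := fun T : ℕ → ℕ → ℕ => ∏ c ∈ μ.cells, extendZero x (T c.1 c.2))
    (fun T _ => Finset.prod_nonneg fun c _ => extendZero_nonneg hx _)
    (mem_tableaux.2 (isTableau_superstandard hμ)))
  exact Finset.prod_congr rfl fun c hc => by
    rw [if_pos (show (c.1, c.2) ∈ μ from hc)]

theorem schur_le {N : ℕ} (μ : YoungDiagram) {x : Fin N → ℝ} (hx : ∀ i, 0 ≤ x i)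
    (hanti : Antitone x) :
    schur μ x ≤ (tableaux N μ).card * ∏ c ∈ μ.cells, extendZero x c.1 := by
  rw [schur_eq, ← nsmul_eq_mul]
  refine Finset.sum_le_card_nsmul _ _ _ fun T hT => ?_
  rw [mem_tableaux] at hT
  refine Finset.prod_le_prod (fun c _ => extendZero_nonneg hx _) fun c hc => ?_
  have h1 := hT.le_entry hc
  have h2 := hT.lt hc
  unfold extendZero
  rw [dif_pos h2, dif_pos (h1.trans_lt h2)]
  exact hanti h1

theorem schur_one_pos {N : ℕ} {μ : YoungDiagram} (hμ : μ.rowLen N = 0) :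
    0 < schur μ (fun _ : Fin N => 1) := by
  refine lt_of_lt_of_le ?_ (le_schur hμ fun _ => zero_le_one)
  refine Finset.prod_pos fun c hc => ?_
  have h : c.1 < N := by
    by_contra! hi
    have := YoungDiagram.mem_iff_lt_rowLen.1 (show (c.1, c.2) ∈ μ from hc)
    rw [rowLen_eq_zero_of_le hμ hi] at this
    omega
  simp [extendZero, h]

theorem eventually_injective_add {N : ℕ} (x : Fin N → ℝ) :
    ∀ᶠ t : ℝ in 𝓝[≠] 0, Function.Injective fun i => x i + t * ((i : ℕ) : ℝ) := by
  have h : ∀ i j : Fin N, ∀ᶠ t : ℝ in 𝓝[≠] 0,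
      i ≠ j → x i + t * ((i : ℕ) : ℝ) ≠ x j + t * ((j : ℕ) : ℝ) := by
    intro i j
    by_cases hij : i = j
    · exact Eventually.of_forall fun _ h => absurd hij h
    have hij' : ((i : ℕ) : ℝ) - ((j : ℕ) : ℝ) ≠ 0 := by
      rw [sub_ne_zero]; exact fun h => hij (Fin.ext (Nat.cast_injective h))
    by_cases hx : x i = x j
    · filter_upwards [self_mem_nhdsWithin] with t ht _ h
      have : t * (((i : ℕ) : ℝ) - ((j : ℕ) : ℝ)) = 0 := by linarith
      exact mul_ne_zero ht hij' this
    · have hc : Tendsto (fun t : ℝ => (x i + t * ((i : ℕ) : ℝ)) - (x j + t * ((j : ℕ) : ℝ)))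
          (𝓝 0) (𝓝 ((x i + 0 * ((i : ℕ) : ℝ)) - (x j + 0 * ((j : ℕ) : ℝ)))) :=
        Continuous.tendsto (by fun_prop) 0
      have hne : (x i + 0 * ((i : ℕ) : ℝ)) - (x j + 0 * ((j : ℕ) : ℝ)) ≠ 0 := by
        simpa [sub_ne_zero] using hx
      filter_upwards [(hc.eventually_ne hne).filter_mono nhdsWithin_le_nhds] with t ht _
      exact sub_ne_zero.1 ht
  filter_upwards [eventually_all.2 fun i => eventually_all.2 fun j => h i j] with t ht i j hij
  by_contra hne
  exact ht i j hne hij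

theorem dense_injective (N : ℕ) : Dense {x : Fin N → ℝ | Function.Injective x} := by
  intro x
  refine mem_closure_of_tendsto (f := fun (t : ℝ) i => x i + t * ((i : ℕ) : ℝ)) (b := 𝓝[≠] 0) ?_
    (eventually_injective_add x)
  have : Continuous fun (t : ℝ) (i : Fin N) => x i + t * ((i : ℕ) : ℝ) := by fun_prop
  simpa using (this.tendsto 0).mono_left nhdsWithin_le_nhds

/-- The sign of the order reversing permutation. -/
def revSign (N : ℕ) : ℝ := ((Equiv.Perm.sign (Fin.revPerm : Equiv.Perm (Fin N)) : ℤ) : ℝ)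

theorem revSign_mul_self (N : ℕ) : revSign N * revSign N = 1 := by
  unfold revSign
  rcases Int.units_eq_one_or (Equiv.Perm.sign (Fin.revPerm : Equiv.Perm (Fin N))) with h | h <;>
    simp [h]

theorem alternant_bot {N : ℕ} (x : Fin N → ℝ) :
    alternant (shiftedParts ⊥) x = revSign N * (Matrix.vandermonde x).det := by
  rw [revSign, ← Matrix.det_permute', alternant]
  congr 1
  ext i j
  simp only [Matrix.of_apply, Matrix.submatrix_apply, id, Matrix.vandermonde_apply,
    shiftedParts_apply, rowLen_bot, zero_add, Fin.revPerm_apply, Fin.val_rev]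
  congr 1
  omega

theorem alternant_bot_ne_zero {N : ℕ} {x : Fin N → ℝ} (hx : Function.Injective x) :
    alternant (shiftedParts ⊥) x ≠ 0 := by
  rw [alternant_bot]
  refine mul_ne_zero (fun h => ?_) (Matrix.det_vandermonde_ne_zero_iff.2 hx)
  have := revSign_mul_self N
  simp [h] at this

theorem alternant_comp_perm {N : ℕ} (l : Fin N → ℕ) (x : Fin N → ℝ) (σ : Equiv.Perm (Fin N)) :
    alternant l (x ∘ σ) = ((Equiv.Perm.sign σ : ℤ) : ℝ) * alternant l x := by
  rw [alternant, alternant, ← Matrix.det_permute]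
  rfl

theorem schur_comp_perm {N : ℕ} (μ : YoungDiagram) (x : Fin N → ℝ) (σ : Equiv.Perm (Fin N)) :
    schur μ (x ∘ σ) = schur μ x := by
  by_cases hμ : μ.rowLen N = 0
  swap
  · rw [schur_eq_zero hμ, schur_eq_zero hμ]
  have h : (fun x : Fin N → ℝ => schur μ (x ∘ σ)) = schur μ := by
    refine Continuous.ext_on (dense_injective N) ?_ (continuous_schur μ) fun x hx => ?_
    · exact (continuous_schur μ).comp (continuous_pi fun i => continuous_apply _)
    · have h1 := schur_mul_alternant hμ x
      have h2 := schur_mul_alternant hμ (x ∘ σ)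
      rw [alternant_comp_perm, alternant_comp_perm, ← h1] at h2
      have hs : ((Equiv.Perm.sign σ : ℤ) : ℝ) ≠ 0 := by
        rcases Int.units_eq_one_or (Equiv.Perm.sign σ) with h | h <;> simp [h]
      have h3 := alternant_bot_ne_zero hx
      refine mul_right_cancel₀ (mul_ne_zero hs h3) ?_
      linarith
  exact congrFun h x

theorem alternant_pow {N : ℕ} (l : Fin N → ℕ) (q : ℝ) :
    alternant l (fun i : Fin N => q ^ (i : ℕ)) = (Matrix.vandermonde fun i => q ^ l i).det := by
  rw [← Matrix.det_transpose, alternant]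
  congr 1
  ext i j
  simp only [Matrix.of_apply, Matrix.transpose_apply, Matrix.vandermonde_apply, ← pow_mul]
  rw [mul_comm]

theorem det_vandermonde_pow {N : ℕ} (l : Fin N → ℕ) (q : ℝ) :
    (Matrix.vandermonde fun i => q ^ l i).det =
      (∏ i : Fin N, ∏ _j ∈ Finset.Ioi i, (q - 1)) *
        (Matrix.vandermonde fun i => ∑ k ∈ Finset.range (l i), q ^ k).det := by
  simp only [Matrix.det_vandermonde, ← Finset.prod_mul_distrib]
  refine Finset.prod_congr rfl fun i _ => Finset.prod_congr rfl fun j _ => ?_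
  have h1 := geom_sum_mul q (l i)
  have h2 := geom_sum_mul q (l j)
  linear_combination h1 - h2

/-- Weyl's dimension formula. -/
theorem schur_one_mul {N : ℕ} {μ : YoungDiagram} (hμ : μ.rowLen N = 0) :
    schur μ (fun _ : Fin N => 1) *
      (Matrix.vandermonde fun i : Fin N => (shiftedParts ⊥ i : ℝ)).det =
      (Matrix.vandermonde fun i : Fin N => (shiftedParts μ i : ℝ)).det := by
  have hgeom : ∀ l : Fin N → ℕ, Continuous fun q : ℝ =>
      (Matrix.vandermonde fun i => ∑ k ∈ Finset.range (l i), q ^ k).det := by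
    intro l
    refine Continuous.matrix_det (continuous_matrix fun i j => ?_)
    simp only [Matrix.vandermonde_apply]
    fun_prop
  have h : (fun q : ℝ => schur μ (fun i : Fin N => q ^ (i : ℕ)) *
      (Matrix.vandermonde fun i : Fin N => ∑ k ∈ Finset.range (shiftedParts ⊥ i), q ^ k).det) =
      fun q => (Matrix.vandermonde fun i : Fin N =>
        ∑ k ∈ Finset.range (shiftedParts μ i), q ^ k).det := by
    refine Continuous.ext_on (dense_compl_singleton (1 : ℝ)) ?_ (hgeom _) fun q hq => ?_
    · exact ((continuous_schur μ).comp (by fun_prop)).mul (hgeom _)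
    · have h1 := schur_mul_alternant hμ fun i : Fin N => q ^ (i : ℕ)
      rw [alternant_pow, alternant_pow, det_vandermonde_pow, det_vandermonde_pow] at h1
      have hP : (∏ i : Fin N, ∏ _j ∈ Finset.Ioi i, (q - 1)) ≠ 0 :=
        Finset.prod_ne_zero_iff.2 fun i _ => Finset.prod_ne_zero_iff.2 fun j _ => sub_ne_zero.2 hq
      refine mul_left_cancel₀ hP ?_
      rw [← h1]
      ring
  have := congrFun h 1
  simpa using this

theorem strictAnti_shiftedParts {N : ℕ} (μ : YoungDiagram) :
    StrictAnti (shiftedParts μ : Fin N → ℕ) := by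
  intro i j hij
  have := μ.rowLen_anti i j hij.le
  have h : (i : ℕ) < j := hij
  simp only [shiftedParts_apply]
  omega

theorem exists_shiftedParts_eq {N : ℕ} {m : Fin N → ℕ} (hm : StrictAnti m) :
    ∃ μ : YoungDiagram, μ.rowLen N = 0 ∧ shiftedParts μ = m := by
  have hdiff : ∀ i j : Fin N, i ≤ j → (j : ℕ) - i ≤ m i - m j := by
    intro i j _
    have h := Finset.card_le_card_of_injOn (s := Finset.Ioc i j)
      (t := Finset.Ico (m j) (m i)) m (fun k hk => ?_) hm.injective.injOn
    · simpa using h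
    · simp only [Finset.coe_Ioc, Set.mem_Ioc, Finset.coe_Ico, Set.mem_Ico] at hk ⊢
      exact ⟨hm.antitone hk.2, hm hk.1⟩
  have hlow : ∀ i : Fin N, N - 1 - i ≤ m i := by
    intro i
    have h := Finset.card_le_card_of_injOn (s := Finset.Ioi i)
      (t := Finset.range (m i)) m (fun k hk => ?_) hm.injective.injOn
    · simpa using h
    · simp only [Finset.coe_Ioi, Set.mem_Ioi, Finset.coe_range, Set.mem_Iio] at hk ⊢
      exact hm hk
  have hanti : Antitone fun i : Fin N => m i - (N - 1 - i) := by
    intro i j hij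
    have h1 := hdiff i j hij
    have h2 := hm.antitone hij
    have h3 := hlow j
    have h4 : (i : ℕ) ≤ j := hij
    simp only
    omega
  refine ⟨ofRows fun i => m i - (N - 1 - i), rowLen_ofRows_of_le hanti le_rfl, ?_⟩
  funext i
  have h3 := hlow i
  rw [shiftedParts_apply, rowLen_ofRows hanti]
  omega

theorem eq_of_shiftedParts_eq {N : ℕ} {μ ν : YoungDiagram} (hμ : μ.rowLen N = 0)
    (hν : ν.rowLen N = 0) (h : (shiftedParts μ : Fin N → ℕ) = shiftedParts ν) : μ = ν := by
  refine eq_of_rowLen fun i => ?_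
  rcases lt_or_ge i N with hi | hi
  · have := congrFun h ⟨i, hi⟩
    simp only [shiftedParts_apply] at this
    omega
  · rw [rowLen_eq_zero_of_le hμ hi, rowLen_eq_zero_of_le hν hi]

/-! ### The Cauchy–Binet formula for series -/

theorem summable_hasSum_pi_prod {N : ℕ} (u : Fin N → ℕ → ℝ) (h : ∀ i, Summable fun m => ‖u i m‖) :
    (Summable fun l : Fin N → ℕ => ‖∏ i, u i (l i)‖) ∧
      HasSum (fun l : Fin N → ℕ => ∏ i, u i (l i)) (∏ i, ∑' m, u i m) := by
  induction N with
  | zero => exact ⟨(hasSum_unique _).summable, by simp⟩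
  | succ N ih =>
    obtain ⟨h1, h2⟩ := ih (fun i => u i.succ) fun i => h i.succ
    obtain ⟨g, hg⟩ : ∃ g : (Fin N → ℕ) → ℝ, g = fun l => ∏ i, u i.succ (l i) := ⟨_, rfl⟩
    obtain ⟨e, he⟩ : ∃ e : ℕ × (Fin N → ℕ) ≃ (Fin (N + 1) → ℕ), ∀ p : ℕ × (Fin N → ℕ),
        ∏ i, u i (e p i) = u 0 p.1 * g p.2 :=
      ⟨Fin.consEquiv fun _ => ℕ, fun p => by rw [Fin.prod_univ_succ, hg]; rfl⟩
    rw [← hg] at h2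
    replace h1 : Summable fun l => ‖g l‖ := by rw [hg]; exact h1
    constructor
    · rw [← e.summable_iff]
      simp only [Function.comp_def, he]
      exact Summable.mul_norm (h 0) h1
    · rw [← e.hasSum_iff]
      simp only [Function.comp_def, he]
      rw [Fin.prod_univ_succ]
      have h3 := summable_mul_of_summable_norm (h 0) h1
      rw [← h2.tsum_eq, tsum_mul_tsum_of_summable_norm (h 0) h1]
      exact h3.hasSum

theorem hasSum_det {N : ℕ} (f g : Fin N → ℕ → ℝ) (h : ∀ i j, Summable fun m => ‖f i m * g j m‖) :
    HasSum (fun l : Fin N → ℕ => (Matrix.of fun i j => f i (l j)).det * ∏ i, g i (l i))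
      (Matrix.of fun i j => ∑' m, f i m * g j m).det := by
  simp only [Matrix.det_apply', Matrix.of_apply, Finset.sum_mul]
  refine hasSum_sum fun σ _ => ?_
  simp only [mul_assoc, ← Finset.prod_mul_distrib]
  exact (summable_hasSum_pi_prod (fun i m => f (σ i) m * g i m) fun i => h _ _).2.mul_left _

theorem exists_shiftedParts_comp_eq {N : ℕ} {l : Fin N → ℕ} (hl : Function.Injective l) :
    ∃ (μ : YoungDiagram) (σ : Equiv.Perm (Fin N)), μ.rowLen N = 0 ∧ l = shiftedParts μ ∘ σ := by
  have hmono : StrictMono (l ∘ Tuple.sort l) :=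
    (Tuple.monotone_sort l).strictMono_of_injective (hl.comp (Tuple.sort l).injective)
  have hanti : StrictAnti (l ∘ Tuple.sort l ∘ Fin.revPerm) := fun i j hij =>
    hmono (Fin.rev_lt_rev.2 hij)
  obtain ⟨μ, hμ, h⟩ := exists_shiftedParts_eq hanti
  refine ⟨μ, (Tuple.sort l).symm.trans Fin.revPerm, hμ, ?_⟩
  rw [h]
  funext i
  simp [Function.comp]

theorem injective_shiftedParts_comp (N : ℕ) : Function.Injective
    fun p : {μ : YoungDiagram // μ.rowLen N = 0} × Equiv.Perm (Fin N) =>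
      (shiftedParts p.1.1 : Fin N → ℕ) ∘ p.2 := by
  rintro ⟨⟨μ, hμ⟩, σ⟩ ⟨⟨ν, hν⟩, τ⟩ h
  simp only at h
  have h1 : (shiftedParts μ : Fin N → ℕ) = shiftedParts ν ∘ (σ.symm.trans τ) := by
    funext i
    have := congrFun h (σ.symm i)
    simpa using this
  have hρ : StrictMono (σ.symm.trans τ) := by
    intro i j hij
    have h2 := strictAnti_shiftedParts μ hij
    rw [h1] at h2
    exact (strictAnti_shiftedParts ν).lt_iff_gt.1 h2
  have hid : (σ.symm.trans τ : Fin N → Fin N) = id :=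
    hρ.range_inj strictMono_id |>.1 (by rw [Equiv.range_eq_univ, Set.range_id])
  rw [hid, Function.comp_id] at h1
  have h2 := eq_of_shiftedParts_eq hμ hν h1
  subst h2
  congr 1
  ext i
  have := congrFun hid (σ i)
  simp at this
  rw [this]

theorem hasSum_cauchyBinet {N : ℕ} (f g : Fin N → ℕ → ℝ)
    (h : ∀ i j, Summable fun m => ‖f i m * g j m‖) :
    HasSum (fun μ : YoungDiagram => if μ.rowLen N = 0 then
        (Matrix.of fun i j => f i (shiftedParts μ j)).det *
          (Matrix.of fun i j => g i (shiftedParts μ j)).det else 0)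
      (Matrix.of fun i j => ∑' m, f i m * g j m).det := by
  have h1 := hasSum_det f g h
  rw [← (injective_shiftedParts_comp N).hasSum_iff] at h1
  swap
  · intro l hl
    by_cases hinj : Function.Injective l
    · obtain ⟨μ, σ, hμ, h⟩ := exists_shiftedParts_comp_eq hinj
      exact absurd ⟨(⟨μ, hμ⟩, σ), h.symm⟩ hl
    · simp only [Function.Injective, not_forall] at hinj
      obtain ⟨i, j, hij, hne⟩ := hinj
      rw [Matrix.det_zero_of_column_eq hne fun k => by simp [hij], zero_mul]
  have h2 := h1.prod_fiberwise fun μ => hasSum_fintype _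
  have hsub : Function.support (fun μ : YoungDiagram => if μ.rowLen N = 0 then
        (Matrix.of fun i j => f i (shiftedParts μ j)).det *
          (Matrix.of fun i j => g i (shiftedParts μ j)).det else 0) ⊆
      {μ | μ.rowLen N = 0} := by
    intro μ hμ
    by_contra hcon
    exact hμ (if_neg hcon)
  refine (hasSum_subtype_iff_of_support_subset hsub).1 ?_
  refine Eq.mpr ?_ h2
  congr 1
  funext μ
  obtain ⟨μ, hμ⟩ := μ
  have hμ' : μ.rowLen N = 0 := hμ
  symm
  simp only [Function.comp_apply, if_pos hμ']
  rw [← Matrix.det_transpose (Matrix.of fun i j => g i (shiftedParts μ j)),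
    Matrix.det_apply' (Matrix.of fun i j => g i (shiftedParts μ j))ᵀ, Finset.mul_sum]
  refine Finset.sum_congr rfl fun σ _ => ?_
  have h3 : (Matrix.of fun i j => f i (shiftedParts μ (σ j))).det =
      ((Equiv.Perm.sign σ : ℤ) : ℝ) * (Matrix.of fun i j => f i (shiftedParts μ j)).det := by
    rw [← Matrix.det_permute']
    rfl
  rw [h3]
  simp only [Matrix.transpose_apply, Matrix.of_apply]
  ring

/-! ### The Cauchy determinant -/

theorem det_cauchy {N : ℕ} {x b : Fin N → ℝ} (hb : ∀ i, b i ≠ 0) (hbinj : Function.Injective b)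
    (hxb : ∀ i j, 1 - x i * b j ≠ 0) :
    (Matrix.of fun i j => (1 - x i * b j)⁻¹).det * ∏ i, ∏ j, (1 - x i * b j) =
      (Matrix.vandermonde x).det * (Matrix.vandermonde b).det := by
  let p : Fin N → Polynomial ℝ := fun j =>
    ∏ k ∈ {j}ᶜ, (1 - Polynomial.C (b k) * Polynomial.X)
  have hdeg : ∀ j, (p j).natDegree < N := by
    intro j
    have h1 : (p j).natDegree ≤ ∑ k ∈ ({j}ᶜ : Finset (Fin N)), 1 := by
      refine (Polynomial.natDegree_prod_le _ _).trans (Finset.sum_le_sum fun k _ => ?_)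
      refine (Polynomial.natDegree_sub_le _ _).trans ?_
      rw [Polynomial.natDegree_one]
      exact max_le (Nat.zero_le _)
        ((Polynomial.natDegree_C_mul_le _ _).trans Polynomial.natDegree_X_le)
    have h2 : 0 < N := j.pos
    simp only [Finset.sum_const, Finset.card_compl, Fintype.card_fin, Finset.card_singleton,
      smul_eq_mul, mul_one] at h1
    omega
  let P : Matrix (Fin N) (Fin N) ℝ := Matrix.of fun m j => (p j).coeff m
  have hmul : ∀ v : Fin N → ℝ, Matrix.vandermonde v * P =
      Matrix.of fun i j => (p j).eval (v i) := by
    intro v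
    ext i j
    rw [Matrix.mul_apply, Matrix.of_apply, Polynomial.eval_eq_sum_range' (hdeg j),
      ← Fin.sum_univ_eq_sum_range (fun m => (p j).coeff m * v i ^ m)]
    refine Finset.sum_congr rfl fun m _ => ?_
    simp only [Matrix.vandermonde_apply, P, Matrix.of_apply]
    ring
  have heval : ∀ j t, (p j).eval t = ∏ k ∈ {j}ᶜ, (1 - b k * t) := by
    intro j t
    simp [p, Polynomial.eval_prod]
  have hP : P.det = (Matrix.vandermonde b).det := by
    have hc : Function.Injective fun i => (b i)⁻¹ := inv_injective.comp hbinj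
    refine mul_left_cancel₀ (Matrix.det_vandermonde_ne_zero_iff.2 hc) ?_
    rw [← Matrix.det_mul, hmul]
    have hdiag : (Matrix.of fun i j => (p j).eval (b i)⁻¹) =
        Matrix.diagonal fun j => ∏ k ∈ {j}ᶜ, (1 - b k * (b j)⁻¹) := by
      ext i j
      rw [Matrix.of_apply, heval]
      by_cases hij : i = j
      · subst hij; simp
      · rw [Matrix.diagonal_apply_ne _ hij]
        refine Finset.prod_eq_zero (i := i) (by simp [hij]) ?_
        rw [mul_inv_cancel₀ (hb i), sub_self]
    rw [hdiag, Matrix.det_diagonal,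
      ← Finset.prod_prod_Ioi_mul_eq_prod_prod_off_diag fun k j => 1 - b k * (b j)⁻¹,
      Matrix.det_vandermonde, Matrix.det_vandermonde, ← Finset.prod_mul_distrib]
    refine Finset.prod_congr rfl fun i _ => ?_
    rw [← Finset.prod_mul_distrib]
    refine Finset.prod_congr rfl fun j _ => ?_
    have h1 := hb i
    have h2 := hb j
    field_simp
  rw [← hP, ← Matrix.det_mul, hmul, mul_comm, ← Matrix.det_mul_column]
  congr 1
  ext i j
  simp only [Matrix.of_apply, heval]
  rw [← Finset.prod_compl_mul_prod {j}, Finset.prod_singleton, mul_assoc,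
    mul_inv_cancel₀ (hxb i j), mul_one]
  exact Finset.prod_congr rfl fun k _ => by ring

/-! ### Expansions in Schur polynomials -/

theorem revSign_mul_det_vandermonde {N : ℕ} (x : Fin N → ℝ) :
    revSign N * (Matrix.vandermonde x).det = (Matrix.vandermonde (x ∘ Fin.rev)).det := by
  rw [revSign, ← Matrix.det_permute]
  rfl

theorem revSign_mul_det_vandermonde_pos {N : ℕ} {x : Fin N → ℝ} (hx : StrictAnti x) :
    0 < revSign N * (Matrix.vandermonde x).det := by
  rw [revSign_mul_det_vandermonde, Matrix.det_vandermonde]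
  refine Finset.prod_pos fun i _ => Finset.prod_pos fun j hj => sub_pos.2 (hx ?_)
  exact Fin.rev_lt_rev.2 (Finset.mem_Ioi.1 hj)

theorem strictAnti_cast_shiftedParts {N : ℕ} (μ : YoungDiagram) :
    StrictAnti fun i : Fin N => (shiftedParts μ i : ℝ) :=
  fun _ _ h => Nat.cast_lt.2 (strictAnti_shiftedParts μ h)

/-- The Vandermonde product of the staircase, the reciprocal of the constant in Weyl's dimension
formula. -/
def weylConst (N : ℕ) : ℝ :=
  revSign N * (Matrix.vandermonde fun i : Fin N => (shiftedParts ⊥ i : ℝ)).det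

theorem weylConst_pos (N : ℕ) : 0 < weylConst N :=
  revSign_mul_det_vandermonde_pos (strictAnti_cast_shiftedParts ⊥)

theorem weylConst_mul_schur_one {N : ℕ} {μ : YoungDiagram} (hμ : μ.rowLen N = 0) :
    weylConst N * schur μ (fun _ : Fin N => 1) =
      revSign N * (Matrix.vandermonde fun i : Fin N => (shiftedParts μ i : ℝ)).det := by
  rw [← schur_one_mul hμ, weylConst]
  ring

theorem hasSum_congr_of_eq {ι : Type*} {f g : ι → ℝ} {a : ℝ} (h : HasSum f a)
    (hfg : ∀ i, f i = g i) : HasSum g a := funext hfg ▸ h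

theorem hasSum_schur_of_injective {N : ℕ} {c : YoungDiagram → ℝ} (hc : ∀ μ, 0 ≤ c μ)
    {U : Set (Fin N → ℝ)} (hU : IsOpen U) {G : (Fin N → ℝ) → ℝ} {x : Fin N → ℝ} (hxU : x ∈ U)
    (hx : ∀ i, 0 ≤ x i) (hG : ContinuousAt G x)
    (h : ∀ y ∈ U, (∀ i, 0 < y i) → Function.Injective y →
      HasSum (fun μ => c μ * schur μ y) (G y)) :
    HasSum (fun μ => c μ * schur μ x) (G x) := by
  set γ : ℝ → Fin N → ℝ := fun t i => x i + t * (((i : ℕ) : ℝ) + 1) with hγ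
  have hγ0 : γ 0 = x := by funext i; simp [hγ]
  have hcont : Continuous γ := by fun_prop
  have htend : Tendsto γ (𝓝[>] 0) (𝓝 x) := by
    have := hcont.tendsto 0
    rw [hγ0] at this
    exact this.mono_left nhdsWithin_le_nhds
  have hev : ∀ᶠ t in 𝓝[>] (0 : ℝ), HasSum (fun μ => c μ * schur μ (γ t)) (G (γ t)) := by
    have h1 := (eventually_injective_add x).filter_mono (nhdsGT_le_nhdsNE (0 : ℝ))
    filter_upwards [self_mem_nhdsWithin, h1, htend (hU.mem_nhds hxU)] with t ht hinj hmem
    have ht' : 0 < t := ht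
    refine h _ hmem (fun i => ?_) fun i j hij => hinj ?_
    · have := hx i
      simp only [hγ]
      positivity
    · simp only [hγ] at hij ⊢
      linarith
  obtain ⟨t₀, ht₀, ht₀'⟩ := (hev.and self_mem_nhdsWithin).exists
  have ht₀pos : (0 : ℝ) < t₀ := ht₀'
  have hle : ∀ t, 0 ≤ t → t ≤ t₀ → ∀ μ, ‖c μ * schur μ (γ t)‖ ≤ c μ * schur μ (γ t₀) := by
    intro t h0 ht μ
    have hγt : ∀ i, 0 ≤ γ t i := fun i => by have := hx i; simp only [hγ]; positivity
    rw [Real.norm_of_nonneg (mul_nonneg (hc μ) (schur_nonneg μ hγt))]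
    refine mul_le_mul_of_nonneg_left (schur_mono μ hγt fun i => ?_) (hc μ)
    simp only [hγ]
    gcongr
  have hsum : Summable fun μ => c μ * schur μ x := by
    refine Summable.of_norm_bounded ht₀.summable fun μ => ?_
    have := hle 0 le_rfl ht₀pos.le μ
    rwa [hγ0] at this
  have hlim : Tendsto (fun t => ∑' μ, c μ * schur μ (γ t)) (𝓝[>] 0)
      (𝓝 (∑' μ, c μ * schur μ x)) := by
    refine tendsto_tsum_of_dominated_convergence ht₀.summable
      (fun μ => (((continuous_schur μ).tendsto x).comp htend).const_mul _) ?_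
    filter_upwards [self_mem_nhdsWithin, Iic_mem_nhds ht₀pos |> mem_nhdsWithin_of_mem_nhds]
      with t h1 h2 μ
    exact hle t (le_of_lt h1) h2 μ
  have hlim' : Tendsto (fun t => ∑' μ, c μ * schur μ (γ t)) (𝓝[>] 0) (𝓝 (G x)) := by
    refine Tendsto.congr' ?_ (hG.tendsto.comp htend)
    filter_upwards [hev] with t ht
    exact ht.tsum_eq.symm
  rw [← tendsto_nhds_unique hlim hlim']
  exact hsum.hasSum

theorem cauchy_of_injective {N : ℕ} {x b : Fin N → ℝ} (hx : ∀ i, 0 < x i) (hb : ∀ i, 0 < b i)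
    (hxinj : Function.Injective x) (hbinj : Function.Injective b) (hxb : ∀ i j, x i * b j < 1) :
    HasSum (fun μ => schur μ b * schur μ x) (∏ i, ∏ j, (1 - x i * b j)⁻¹) := by
  have hg : ∀ i j, HasSum (fun m => x i ^ m * b j ^ m) (1 - x i * b j)⁻¹ := by
    intro i j
    simp only [← mul_pow]
    exact hasSum_geometric_of_lt_one (mul_pos (hx i) (hb j)).le (hxb i j)
  have h1 := hasSum_cauchyBinet (fun i m => x i ^ m) (fun j m => b j ^ m) fun i j => by
    refine (hg i j).summable.congr fun m => ?_
    rw [Real.norm_of_nonneg]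
    exact mul_nonneg (pow_nonneg (hx i).le _) (pow_nonneg (hb j).le _)
  simp only [(hg _ _).tsum_eq] at h1
  have hne : ∀ i j, 1 - x i * b j ≠ 0 := fun i j => (sub_pos.2 (hxb i j)).ne'
  have hc := det_cauchy (fun i => (hb i).ne') hbinj hne
  have hVx := Matrix.det_vandermonde_ne_zero_iff.2 hxinj
  have hVb := Matrix.det_vandermonde_ne_zero_iff.2 hbinj
  have h2 := h1.mul_right ((Matrix.vandermonde x).det * (Matrix.vandermonde b).det)⁻¹
  have hP : (∏ i, ∏ j, (1 - x i * b j)) ≠ 0 :=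
    Finset.prod_ne_zero_iff.2 fun i _ => Finset.prod_ne_zero_iff.2 fun j _ => hne i j
  have hval : (Matrix.of fun i j => (1 - x i * b j)⁻¹).det *
      ((Matrix.vandermonde x).det * (Matrix.vandermonde b).det)⁻¹ =
        ∏ i, ∏ j, (1 - x i * b j)⁻¹ := by
    simp only [Finset.prod_inv_distrib]
    rw [← hc, mul_inv, ← mul_assoc, mul_inv_cancel₀, one_mul]
    intro h0
    rw [h0, zero_mul] at hc
    exact mul_ne_zero hVx hVb hc.symm
  rw [hval] at h2
  refine (hasSum_congr_of_eq h2 fun μ => ?_)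
  split_ifs with hμ
  · have e1 := schur_mul_alternant hμ x
    have e2 := schur_mul_alternant hμ b
    rw [alternant_bot] at e1 e2
    change alternant (shiftedParts μ) x * alternant (shiftedParts μ) b * _ = _
    rw [← e1, ← e2]
    have := revSign_mul_self N
    field_simp
    linear_combination (schur μ x * schur μ b) * this
  · rw [schur_eq_zero hμ, zero_mul, zero_mul]

/-- The Cauchy identity. -/
theorem hasSum_cauchy {N : ℕ} {x b : Fin N → ℝ} (hx : ∀ i, 0 ≤ x i) (hb : ∀ i, 0 ≤ b i)
    (hxb : ∀ i j, x i * b j < 1) :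
    HasSum (fun μ => schur μ b * schur μ x) (∏ i, ∏ j, (1 - x i * b j)⁻¹) := by
  have hopen : ∀ c : Fin N → ℝ, IsOpen {y : Fin N → ℝ | ∀ i j, y i * c j < 1} := by
    intro c
    simp only [Set.ofPred_forall]
    exact isOpen_iInter_of_finite fun i => isOpen_iInter_of_finite fun j =>
      isOpen_lt (by fun_prop) continuous_const
  have hcont : ∀ c y : Fin N → ℝ, (∀ i j, y i * c j < 1) →
      ContinuousAt (fun y : Fin N → ℝ => ∏ i, ∏ j, (1 - y i * c j)⁻¹) y := by
    intro c y hy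
    refine tendsto_finsetProd _ fun i _ => tendsto_finsetProd _ fun j _ => ?_
    refine ContinuousAt.inv₀ (Continuous.continuousAt (by fun_prop)) (sub_pos.2 (hy i j)).ne'
  refine hasSum_schur_of_injective (c := fun μ => schur μ b) (fun μ => schur_nonneg μ hb)
    (hopen b) (G := fun y => ∏ i, ∏ j, (1 - y i * b j)⁻¹) hxb hx (hcont b x hxb)
    fun y hy hypos hyinj => ?_
  have hby : ∀ i j, b i * y j < 1 := fun i j => by rw [mul_comm]; exact hy j i
  have h := hasSum_schur_of_injective (c := fun μ => schur μ y)
    (fun μ => schur_nonneg μ fun i => (hypos i).le) (hopen y)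
    (G := fun z => ∏ i, ∏ j, (1 - z i * y j)⁻¹) hby hb (hcont y b hby)
    fun z hz hzpos hzinj => cauchy_of_injective hzpos hypos hzinj hyinj hz
  rw [Finset.prod_comm]
  simpa only [mul_comm] using h

/-- The coefficients of the expansion of `exp (∑ x_i)` in Schur polynomials. -/
def expCoeff (N : ℕ) (μ : YoungDiagram) : ℝ :=
  revSign N * (Matrix.vandermonde fun i : Fin N => (shiftedParts μ i : ℝ)).det *
    ∏ i : Fin N, ((shiftedParts μ i).factorial : ℝ)⁻¹

theorem expCoeff_nonneg (N : ℕ) (μ : YoungDiagram) : 0 ≤ expCoeff N μ :=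
  mul_nonneg (revSign_mul_det_vandermonde_pos (strictAnti_cast_shiftedParts μ)).le
    (Finset.prod_nonneg fun _ _ => inv_nonneg.2 (Nat.cast_nonneg _))

theorem hasSum_pow_mul_descFactorial (x : ℝ) (j : ℕ) :
    HasSum (fun m : ℕ => x ^ m * ((m.descFactorial j : ℝ) * (m.factorial : ℝ)⁻¹))
      (x ^ j * Real.exp x) := by
  rw [← hasSum_nat_add_iff' j]
  have h0 : ∑ m ∈ Finset.range j, x ^ m * ((m.descFactorial j : ℝ) * (m.factorial : ℝ)⁻¹) = 0 := by
    refine Finset.sum_eq_zero fun m hm => ?_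
    rw [Nat.descFactorial_eq_zero_iff_lt.2 (Finset.mem_range.1 hm)]
    simp
  rw [h0, sub_zero, Real.exp_eq_exp_ℝ]
  have h1 := (NormedSpace.expSeries_div_hasSum_exp x).mul_left (x ^ j)
  refine (hasSum_congr_of_eq h1 fun m => ?_)
  have h2 : ((m + j).factorial : ℝ) = m.factorial * ((m + j).descFactorial j : ℝ) := by
    rw [← Nat.cast_mul, ← Nat.factorial_mul_descFactorial (Nat.le_add_left j m),
      Nat.add_sub_cancel]
  have h3 : ((m + j).factorial : ℝ) ≠ 0 := Nat.cast_ne_zero.2 (Nat.factorial_ne_zero _)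
  have h4 : (m.factorial : ℝ) ≠ 0 := Nat.cast_ne_zero.2 (Nat.factorial_ne_zero _)
  rw [h2] at h3 ⊢
  have h5 := right_ne_zero_of_mul h3
  field_simp
  ring

theorem det_descFactorial {N : ℕ} (l : Fin N → ℕ) :
    (Matrix.of fun i j : Fin N => ((l i).descFactorial j : ℝ)).det =
      (Matrix.vandermonde fun i => (l i : ℝ)).det := by
  rw [Matrix.det_eval_matrixOfPolynomials_eq_det_vandermonde (fun i => (l i : ℝ))
    (fun j => descPochhammer ℝ j) (fun j => descPochhammer_natDegree ℝ j)
    (fun j => monic_descPochhammer ℝ j)]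
  congr 1
  ext i j
  simp only [Matrix.of_apply]
  exact (descPochhammer_eval_eq_descFactorial ℝ (l i) j).symm

theorem hasSum_exp {N : ℕ} {x : Fin N → ℝ} (hx : ∀ i, 0 ≤ x i) :
    HasSum (fun μ => expCoeff N μ * schur μ x) (Real.exp (∑ i, x i)) := by
  refine hasSum_schur_of_injective (expCoeff_nonneg N) isOpen_univ
    (G := fun x => Real.exp (∑ i, x i)) (Set.mem_univ x) hx (by fun_prop) fun y _ hy hyinj => ?_
  have hg := fun (i j : Fin N) => hasSum_pow_mul_descFactorial (y i) j
  have h1 := hasSum_cauchyBinet (fun i m => y i ^ m)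
    (fun (j : Fin N) m => (m.descFactorial j : ℝ) * (m.factorial : ℝ)⁻¹) fun i j => by
    refine (hg i j).summable.congr fun m => ?_
    rw [Real.norm_of_nonneg]
    have := hy i
    positivity
  simp only [(hg _ _).tsum_eq] at h1
  have hV := Matrix.det_vandermonde_ne_zero_iff.2 hyinj
  have hdet : (Matrix.of fun i j : Fin N => y i ^ (j : ℕ) * Real.exp (y i)).det =
      Real.exp (∑ i, y i) * (Matrix.vandermonde y).det := by
    rw [Real.exp_sum, ← Matrix.det_mul_column]
    congr 1
    ext i j
    simp [Matrix.vandermonde_apply, mul_comm]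
  rw [hdet] at h1
  have h2 := h1.mul_right (Matrix.vandermonde y).det⁻¹
  rw [mul_assoc, mul_inv_cancel₀ hV, mul_one] at h2
  refine (hasSum_congr_of_eq h2 fun μ => ?_)
  split_ifs with hμ
  · have e1 := schur_mul_alternant hμ y
    rw [alternant_bot] at e1
    have e2 : (Matrix.of fun i j : Fin N => ((shiftedParts μ j : ℕ).descFactorial i : ℝ) *
        ((shiftedParts μ j : ℕ).factorial : ℝ)⁻¹).det =
        (∏ i : Fin N, ((shiftedParts μ i).factorial : ℝ)⁻¹) *
          (Matrix.vandermonde fun i : Fin N => (shiftedParts μ i : ℝ)).det := by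
      rw [← det_descFactorial, ← Matrix.det_mul_column, ← Matrix.det_transpose]
      congr 1
      ext i j
      simp [mul_comm]
    change alternant (shiftedParts μ) y * _ * _ = _
    rw [e2, ← e1, expCoeff]
    field_simp
  · rw [schur_eq_zero hμ, mul_zero, zero_mul]

theorem hasSum_det_exp {N : ℕ} (x y : Fin N → ℝ) :
    HasSum (fun μ : YoungDiagram => (∏ i : Fin N, ((shiftedParts μ i).factorial : ℝ)⁻¹) *
        (schur μ x * schur μ y) *
        ((Matrix.vandermonde x).det * (Matrix.vandermonde y).det))
      (Matrix.of fun i j => Real.exp (x i * y j)).det := by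
  have hg : ∀ i j, HasSum (fun m : ℕ => x i ^ m * (m.factorial : ℝ)⁻¹ * y j ^ m)
      (Real.exp (x i * y j)) := by
    intro i j
    rw [Real.exp_eq_exp_ℝ]
    refine hasSum_congr_of_eq (NormedSpace.expSeries_div_hasSum_exp (x i * y j)) fun m => ?_
    rw [mul_pow]
    ring
  have h1 := hasSum_cauchyBinet (fun i m => x i ^ m * (m.factorial : ℝ)⁻¹) (fun j m => y j ^ m)
    fun i j => (hg i j).summable.norm
  simp only [(hg _ _).tsum_eq] at h1
  refine hasSum_congr_of_eq h1 fun μ => ?_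
  split_ifs with hμ
  · have e1 := schur_mul_alternant hμ x
    have e2 := schur_mul_alternant hμ y
    rw [alternant_bot] at e1 e2
    have e3 : (Matrix.of fun i j : Fin N => x i ^ (shiftedParts μ j : ℕ) *
        ((shiftedParts μ j : ℕ).factorial : ℝ)⁻¹).det =
        (∏ i : Fin N, ((shiftedParts μ i).factorial : ℝ)⁻¹) *
          alternant (shiftedParts μ) x := by
      rw [alternant, ← Matrix.det_mul_row]
      congr 1
      ext i j
      simp [mul_comm]
    change (Matrix.of fun i j : Fin N => x i ^ (shiftedParts μ j : ℕ) *
        ((shiftedParts μ j : ℕ).factorial : ℝ)⁻¹).det * alternant (shiftedParts μ) y = _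
    rw [e3, ← e1, ← e2]
    have := revSign_mul_self N
    linear_combination ((∏ i : Fin N, ((shiftedParts μ i).factorial : ℝ)⁻¹) *
        (schur μ x * schur μ y) *
        ((Matrix.vandermonde x).det * (Matrix.vandermonde y).det)) * this
  · rw [schur_eq_zero hμ]
    ring

/-! ### Eigenvalues of Hermitian matrices -/

theorem exists_perm_of_map_eq {α : Type*} [LinearOrder α] {N : ℕ} {a b : Fin N → α}
    (h : Multiset.map a Finset.univ.val = Multiset.map b Finset.univ.val) :
    ∃ σ : Equiv.Perm (Fin N), a = b ∘ σ := by
  have hp : (List.ofFn a).Perm (List.ofFn b) := by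
    rw [← Multiset.coe_eq_coe]
    simpa [Fin.univ_val_map] using h
  have ha := Equiv.Perm.ofFn_comp_perm (Tuple.sort a) a
  have hb := Equiv.Perm.ofFn_comp_perm (Tuple.sort b) b
  have h1 : List.ofFn (a ∘ Tuple.sort a) = List.ofFn (b ∘ Tuple.sort b) :=
    ((ha.trans hp).trans hb.symm).eq_of_sortedLE (Tuple.monotone_sort a).sortedLE_ofFn
      (Tuple.monotone_sort b).sortedLE_ofFn
  have h2 := List.ofFn_injective h1
  refine ⟨(Tuple.sort a).symm.trans (Tuple.sort b), ?_⟩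
  funext i
  have := congrFun h2 ((Tuple.sort a).symm i)
  simpa using this

theorem exists_perm_of_prod_eq {N : ℕ} {a b : Fin N → ℝ}
    (h : ∀ t : ℂ, ∏ i, (t - (a i : ℂ)) = ∏ i, (t - (b i : ℂ))) :
    ∃ σ : Equiv.Perm (Fin N), a = b ∘ σ := by
  refine exists_perm_of_map_eq ?_
  have h1 : ∏ i, (Polynomial.X - Polynomial.C (a i : ℂ)) =
      ∏ i, (Polynomial.X - Polynomial.C (b i : ℂ)) := by
    refine Polynomial.funext fun t => ?_
    simpa [Polynomial.eval_prod] using h t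
  have h2 := congrArg Polynomial.roots h1
  have hr : ∀ c : Fin N → ℝ, (∏ i, (Polynomial.X - Polynomial.C (c i : ℂ))).roots =
      Multiset.map (fun i => (c i : ℂ)) Finset.univ.val := by
    intro c
    rw [← Polynomial.roots_multiset_prod_X_sub_C
      (Multiset.map (fun i => (c i : ℂ)) Finset.univ.val),
      Multiset.map_map]
    rfl
  rw [hr, hr] at h2
  have h3 := congrArg (Multiset.map Complex.re) h2
  simpa [Multiset.map_map, Function.comp_def] using h3

/-- The diagonal complex matrix with real entries `x`. -/
def dg {N : ℕ} (x : Fin N → ℝ) : Matrix (Fin N) (Fin N) ℂ := Matrix.diagonal fun i => (x i : ℂ)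

theorem isHermitian_dg {N : ℕ} (x : Fin N → ℝ) : (dg x).IsHermitian := by
  refine Matrix.isHermitian_diagonal_of_self_adjoint _ ?_
  ext i
  simp

theorem dg_mul {N : ℕ} (x y : Fin N → ℝ) : dg x * dg y = dg fun i => x i * y i := by
  simp [dg, Matrix.diagonal_mul_diagonal]

theorem dg_smul {N : ℕ} (t : ℝ) (x : Fin N → ℝ) : dg (fun i => t * x i) = (t : ℂ) • dg x := by
  ext i j
  by_cases h : i = j
  · subst h; simp [dg]
  · simp [dg, h]

theorem continuous_dg {N : ℕ} : Continuous (dg : (Fin N → ℝ) → Matrix (Fin N) (Fin N) ℂ) := by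
  unfold dg
  exact Continuous.matrix_diagonal (by fun_prop)

theorem isHermitian_conj {N : ℕ} {M : Matrix (Fin N) (Fin N) ℂ} (hM : M.IsHermitian)
    (U : Matrix (Fin N) (Fin N) ℂ) : (U * M * star U).IsHermitian :=
  Matrix.isHermitian_mul_mul_conjTranspose U hM

/-- The Hermitian matrix `U diag(x) U*`. -/
def conjDiag {N : ℕ} (U : Matrix.unitaryGroup (Fin N) ℂ) (x : Fin N → ℝ) : HermitianMatrix N :=
  ⟨U.1 * dg x * star U.1, isHermitian_conj (isHermitian_dg x) U.1⟩

theorem unitary_star_mul {N : ℕ} (U : Matrix.unitaryGroup (Fin N) ℂ) : star U.1 * U.1 = 1 :=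
  Unitary.star_mul_self_of_mem U.2

theorem unitary_mul_star {N : ℕ} (U : Matrix.unitaryGroup (Fin N) ℂ) : U.1 * star U.1 = 1 :=
  Unitary.mul_star_self_of_mem U.2

theorem exists_conjDiag_eq {N : ℕ} (M : HermitianMatrix N) :
    ∃ U : Matrix.unitaryGroup (Fin N) ℂ, conjDiag U M.2.eigenvalues = M := by
  refine ⟨M.2.eigenvectorUnitary, Subtype.ext ?_⟩
  conv_rhs => rw [M.2.spectral_theorem, Unitary.conjStarAlgAut_apply]
  rfl

theorem prod_sub_eigenvalues {N : ℕ} {M : Matrix (Fin N) (Fin N) ℂ} (hM : M.IsHermitian) (t : ℂ) :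
    ∏ i, (t - (hM.eigenvalues i : ℂ)) = (Matrix.scalar (Fin N) t - M).det := by
  rw [← Matrix.eval_charpoly, hM.charpoly_eq, Polynomial.eval_prod]
  simp

theorem exists_perm_eigenvalues_conjDiag {N : ℕ} (U : Matrix.unitaryGroup (Fin N) ℂ)
    (x : Fin N → ℝ) : ∃ σ : Equiv.Perm (Fin N), (conjDiag U x).2.eigenvalues = x ∘ σ := by
  refine exists_perm_of_prod_eq fun t => ?_
  rw [prod_sub_eigenvalues]
  have h : Matrix.scalar (Fin N) t - (conjDiag U x).1 =
      U.1 * (Matrix.scalar (Fin N) t - dg x) * star U.1 := by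
    rw [mul_sub, sub_mul, (Matrix.scalar_commute t (fun _ => Commute.all _ _) U.1).symm.eq,
      mul_assoc (Matrix.scalar (Fin N) t), unitary_mul_star, mul_one]
    rfl
  rw [h, Matrix.det_mul, Matrix.det_mul, mul_right_comm, ← Matrix.det_mul, unitary_mul_star,
    Matrix.det_one, one_mul]
  have h2 : Matrix.scalar (Fin N) t - dg x = Matrix.diagonal fun i => t - (x i : ℂ) := by
    rw [Matrix.scalar_apply, dg, Matrix.diagonal_sub]
  rw [h2, Matrix.det_diagonal]

/-- A function of the entries of a vector which does not depend on their order. -/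
def IsSymm {N : ℕ} {α : Type*} (f : (Fin N → ℝ) → α) : Prop :=
  ∀ (x : Fin N → ℝ) (σ : Equiv.Perm (Fin N)), f (x ∘ σ) = f x

theorem IsSymm.eigenvalues_conjDiag {N : ℕ} {α : Type*} {f : (Fin N → ℝ) → α} (hf : IsSymm f)
    (U : Matrix.unitaryGroup (Fin N) ℂ) (x : Fin N → ℝ) :
    f (conjDiag U x).2.eigenvalues = f x := by
  obtain ⟨σ, h⟩ := exists_perm_eigenvalues_conjDiag U x
  rw [h, hf]

theorem trace_conjDiag_mul {N : ℕ} (U : Matrix.unitaryGroup (Fin N) ℂ) (x : Fin N → ℝ) :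
    ((conjDiag U x).1 * (conjDiag U x).1).trace = ((∑ i, x i ^ 2 : ℝ) : ℂ) := by
  have h : (conjDiag U x).1 * (conjDiag U x).1 = U.1 * (dg x * dg x) * star U.1 := by
    change U.1 * dg x * star U.1 * (U.1 * dg x * star U.1) = _
    rw [mul_assoc (U.1 * dg x), mul_assoc U.1 (dg x) (star U.1), ← mul_assoc (star U.1),
      unitary_star_mul, one_mul]
    simp only [mul_assoc]
  rw [h, Matrix.trace_mul_cycle, unitary_star_mul, one_mul, dg_mul, dg, Matrix.trace_diagonal]
  push_cast
  exact Finset.sum_congr rfl fun i _ => by ring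

theorem sum_sq_eigenvalues {N : ℕ} (M : HermitianMatrix N) :
    ∑ i, M.2.eigenvalues i ^ 2 = (M.1 * M.1).trace.re := by
  obtain ⟨U, h⟩ := exists_conjDiag_eq M
  conv_rhs => rw [← h, trace_conjDiag_mul, Complex.ofReal_re]

theorem continuous_conjDiag_uncurry {N : ℕ} :
    Continuous fun p : (Fin N → ℝ) × Matrix.unitaryGroup (Fin N) ℂ => conjDiag p.2 p.1 :=
  Continuous.subtype_mk (((continuous_subtype_val.comp continuous_snd).matrix_mul
    (continuous_dg.comp continuous_fst)).matrix_mul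
      (continuous_subtype_val.comp continuous_snd).star) _

theorem continuous_of_comp_conjDiag {N : ℕ} {α : Type*} [TopologicalSpace α]
    {f : HermitianMatrix N → α}
    (hf : Continuous fun p : (Fin N → ℝ) × Matrix.unitaryGroup (Fin N) ℂ =>
      f (conjDiag p.2 p.1)) : Continuous f := by
  refine continuous_iff_continuousAt.2 fun M => ?_
  rw [ContinuousAt, tendsto_iff_ultrafilter]
  intro g hg
  choose W hW using exists_conjDiag_eq (N := N)
  have hT : Continuous fun M : HermitianMatrix N => (M.1 * M.1).trace.re :=
    Complex.continuous_re.comp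
      (Continuous.matrix_trace (continuous_subtype_val.matrix_mul continuous_subtype_val))
  have hbound : ∀ᶠ M' in (g : Filter (HermitianMatrix N)), (M'.2.eigenvalues, W M') ∈
      (Set.univ.pi fun _ : Fin N => Metric.closedBall (0 : ℝ) ((M.1 * M.1).trace.re + 1 + 1)) ×ˢ
        (Set.univ : Set (Matrix.unitaryGroup (Fin N) ℂ)) := by
    have h1 : ∀ᶠ M' in 𝓝 M, (M'.1 * M'.1).trace.re < (M.1 * M.1).trace.re + 1 :=
      hT.continuousAt.eventually_lt continuousAt_const (lt_add_one _)
    filter_upwards [hg h1] with M' h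
    refine ⟨fun i _ => ?_, Set.mem_univ _⟩
    rw [mem_closedBall_zero_iff, Real.norm_eq_abs]
    have h2 : M'.2.eigenvalues i ^ 2 ≤ (M'.1 * M'.1).trace.re := by
      rw [← sum_sq_eigenvalues]
      exact Finset.single_le_sum (f := fun i => M'.2.eigenvalues i ^ 2)
        (fun _ _ => sq_nonneg _) (Finset.mem_univ i)
    have h3 : |M'.2.eigenvalues i| ≤ M'.2.eigenvalues i ^ 2 + 1 := by
      rw [← sq_abs]
      nlinarith [sq_nonneg (|M'.2.eigenvalues i| - 1), abs_nonneg (M'.2.eigenvalues i)]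
    linarith
  have hK : IsCompact ((Set.univ.pi fun _ : Fin N =>
      Metric.closedBall (0 : ℝ) ((M.1 * M.1).trace.re + 1 + 1)) ×ˢ
        (Set.univ : Set (Matrix.unitaryGroup (Fin N) ℂ))) :=
    (isCompact_univ_pi fun _ => isCompact_closedBall _ _).prod isCompact_univ
  obtain ⟨p, -, hp⟩ := hK.ultrafilter_le_nhds'
    (g.map fun M' : HermitianMatrix N => (M'.2.eigenvalues, W M')) hbound
  have hp' : Tendsto (fun M' : HermitianMatrix N => (M'.2.eigenvalues, W M')) g (𝓝 p) := hp
  have hM : conjDiag p.2 p.1 = M := by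
    refine tendsto_nhds_unique ((continuous_conjDiag_uncurry.tendsto p).comp hp') ?_
    refine Tendsto.congr (fun M' => (hW M').symm) ?_
    exact hg
  have h := (hf.tendsto p).comp hp'
  simp only [hM] at h
  exact h.congr fun M' => congrArg f (hW M')

theorem continuous_symm_eigenvalues {N : ℕ} {α : Type*} [TopologicalSpace α]
    {f : (Fin N → ℝ) → α} (hf : Continuous f) (hsymm : IsSymm f) :
    Continuous fun M : HermitianMatrix N => f M.2.eigenvalues := by
  refine continuous_of_comp_conjDiag ?_
  simp only [hsymm.eigenvalues_conjDiag]
  exact hf.comp continuous_fst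

theorem cfc_conjDiag {N : ℕ} (U : Matrix.unitaryGroup (Fin N) ℂ) (x : Fin N → ℝ) (φ : ℝ → ℝ) :
    (conjDiag U x).2.cfc φ = (conjDiag U fun i => φ (x i)).1 := by
  classical
  obtain ⟨p, hp⟩ : ∃ p : Polynomial ℝ, ∀ i, p.eval (x i) = φ (x i) := by
    refine ⟨Lagrange.interpolate (Finset.univ.image x) id φ, fun i => ?_⟩
    exact Lagrange.eval_interpolate_at_node φ Function.injective_id.injOn
      (Finset.mem_image_of_mem x (Finset.mem_univ i))
  have haeval : ∀ (V : Matrix.unitaryGroup (Fin N) ℂ) (y : Fin N → ℝ),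
      Polynomial.aeval (conjDiag V y).1 p = (conjDiag V fun i => p.eval (y i)).1 := by
    intro V y
    have h1 : ∀ y : Fin N → ℝ, (conjDiag V y).1 =
        Unitary.conjStarAlgAut ℝ (Matrix (Fin N) (Fin N) ℂ) V (Matrix.diagonalAlgHom ℝ
          fun i => (y i : ℂ)) := by
      intro y
      rw [Unitary.conjStarAlgAut_apply]
      rfl
    rw [h1, h1, Polynomial.aeval_algHom_apply, Polynomial.aeval_algHom_apply]
    congr 2
    funext i
    have h2 := Polynomial.aeval_algHom_apply (Pi.evalAlgHom ℝ (fun _ : Fin N => ℂ) i)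
      (fun i => (y i : ℂ)) p
    have h3 := Polynomial.aeval_algHom_apply (Algebra.ofId ℝ ℂ) (y i) p
    rw [Pi.evalAlgHom_apply, Pi.evalAlgHom_apply] at h2
    rw [← h2]
    exact h3
  have h1 : (conjDiag U x).2.cfc φ =
      (conjDiag (conjDiag U x).2.eigenvectorUnitary
        fun i => φ ((conjDiag U x).2.eigenvalues i)).1 := by
    rw [Matrix.IsHermitian.cfc, Unitary.conjStarAlgAut_apply]
    rfl
  obtain ⟨σ, hσ⟩ := exists_perm_eigenvalues_conjDiag U x
  have h2 : (fun i => φ ((conjDiag U x).2.eigenvalues i)) =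
      fun i => p.eval ((conjDiag U x).2.eigenvalues i) := by
    funext i
    rw [hσ, Function.comp_apply, hp]
  have h3 : conjDiag (conjDiag U x).2.eigenvectorUnitary (conjDiag U x).2.eigenvalues =
      conjDiag U x := by
    refine Subtype.ext ?_
    conv_rhs => rw [(conjDiag U x).2.spectral_theorem, Unitary.conjStarAlgAut_apply]
    rfl
  rw [h1, h2, ← haeval, h3, haeval]
  simp only [hp]

/-! ### Haar measure on the unitary group -/

instance {N : ℕ} : SecondCountableTopology (Matrix (Fin N) (Fin N) ℂ) :=
  inferInstanceAs (SecondCountableTopology (Fin N → Fin N → ℂ))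

instance {N : ℕ} : SecondCountableTopology (Matrix.unitaryGroup (Fin N) ℂ) :=
  TopologicalSpace.Subtype.secondCountableTopology _

instance {N : ℕ} : (unitaryHaar N).IsHaarMeasure := by
  unfold unitaryHaar; infer_instance

instance {N : ℕ} : IsProbabilityMeasure (unitaryHaar N) :=
  ⟨by
    have h := Measure.haarMeasure_self (K₀ := (⊤ : TopologicalSpace.PositiveCompacts
      (Matrix.unitaryGroup (Fin N) ℂ)))
    exact h⟩

/-! ### Polar decomposition -/

theorem exists_polar {N : ℕ} (g : Matrix (Fin N) (Fin N) ℂ) :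
    ∃ (V : Matrix.unitaryGroup (Fin N) ℂ) (p : Matrix (Fin N) (Fin N) ℂ),
      p.IsHermitian ∧ g = V.1 * p := by
  have hclosed : IsClosed {g : Matrix (Fin N) (Fin N) ℂ |
      ∃ V : Matrix.unitaryGroup (Fin N) ℂ, (star V.1 * g).IsHermitian} := by
    have h1 : IsClosed {q : Matrix.unitaryGroup (Fin N) ℂ × Matrix (Fin N) (Fin N) ℂ |
        (star q.1.1 * q.2).IsHermitian} := by
      have hc : Continuous fun q : Matrix.unitaryGroup (Fin N) ℂ × Matrix (Fin N) (Fin N) ℂ =>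
          star q.1.1 * q.2 :=
        (continuous_subtype_val.comp continuous_fst).star.mul continuous_snd
      exact isClosed_eq hc.star hc
    convert isClosedMap_snd_of_compactSpace _ h1 using 1
    ext g
    simp
  have hinv : ∀ g : Matrix (Fin N) (Fin N) ℂ, g.det ≠ 0 →
      ∃ V : Matrix.unitaryGroup (Fin N) ℂ, (star V.1 * g).IsHermitian := by
    intro g hg
    have hpd : (star g * g).PosDef := by
      have := Matrix.PosDef.conjTranspose_mul_self g
        (Matrix.mulVec_injective_of_isUnit
          ((Matrix.isUnit_iff_isUnit_det g).2 (isUnit_iff_ne_zero.2 hg)))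
      exact this
    obtain ⟨Q, hQ⟩ := exists_conjDiag_eq ⟨star g * g, hpd.1⟩
    set d := hpd.1.eigenvalues with hd
    have hdpos : ∀ i, 0 < d i := hpd.eigenvalues_pos
    have hQ' : Q.1 * dg d * star Q.1 = star g * g := congrArg Subtype.val hQ
    set s : Fin N → ℝ := fun i => (Real.sqrt (d i))⁻¹ with hs
    set R := (conjDiag Q s).1 with hR
    have hRR : star R = R := (conjDiag Q s).2
    have hmul : ∀ x y : Fin N → ℝ, (Q.1 * dg x * star Q.1) * (Q.1 * dg y * star Q.1) =
        Q.1 * dg (fun i => x i * y i) * star Q.1 := by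
      intro x y
      rw [← dg_mul, mul_assoc (Q.1 * dg x), mul_assoc Q.1 (dg y) (star Q.1), ← mul_assoc (star Q.1),
        unitary_star_mul, one_mul]
      simp only [mul_assoc]
    have hsd : ∀ i, s i * d i = Real.sqrt (d i) := by
      intro i
      have h1 := Real.sqrt_pos.2 (hdpos i)
      rw [hs]
      simp only
      nth_rewrite 2 [← Real.mul_self_sqrt (hdpos i).le]
      field_simp
    have hV : star (g * R) * (g * R) = 1 := by
      rw [star_mul, hRR, mul_assoc, ← mul_assoc (star g), ← hQ', ← mul_assoc, hR]
      change (Q.1 * dg s * star Q.1) * _ * (Q.1 * dg s * star Q.1) = 1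
      rw [hmul, hmul]
      have h1 : (fun i => s i * d i * s i) = fun _ => 1 := by
        funext i
        rw [hsd, hs]
        exact mul_inv_cancel₀ (Real.sqrt_pos.2 (hdpos i)).ne'
      have h2 : dg (fun _ : Fin N => (1 : ℝ)) = 1 := by simp [dg]
      rw [h1, h2, mul_one, unitary_mul_star]
    refine ⟨⟨g * R, Matrix.mem_unitaryGroup_iff'.2 hV⟩, ?_⟩
    change (star (g * R) * g).IsHermitian
    rw [star_mul, hRR, mul_assoc, ← hQ', hR]
    change ((Q.1 * dg s * star Q.1) * _).IsHermitian
    rw [hmul]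
    exact (conjDiag Q _).2
  have hall : ∃ V : Matrix.unitaryGroup (Fin N) ℂ, (star V.1 * g).IsHermitian := by
    have hev : ∀ᶠ t : ℝ in 𝓝[≠] 0, (g + Matrix.scalar (Fin N) (t : ℂ)).det ≠ 0 := by
      have hfin : {t : ℂ | (-g).charpoly.IsRoot t}.Finite :=
        Polynomial.finite_setOfPred_isRoot (Matrix.charpoly_monic _).ne_zero
      have hfin' : {t : ℝ | (-g).charpoly.IsRoot (t : ℂ)}.Finite :=
        hfin.preimage Complex.ofReal_injective.injOn
      have h1 : ∀ᶠ t : ℝ in 𝓝[≠] 0, t ∉ {t : ℝ | (-g).charpoly.IsRoot (t : ℂ)} := by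
        have h2 : ∀ᶠ t : ℝ in 𝓝[≠] 0, t ∉ {t : ℝ | (-g).charpoly.IsRoot (t : ℂ)} \ {0} :=
          nhdsWithin_le_nhds <|
            (hfin'.subset Set.sdiff_subset).isClosed.isOpen_compl.mem_nhds fun h => h.2 rfl
        filter_upwards [h2, self_mem_nhdsWithin] with t h3 h4 h5
        exact h3 ⟨h5, h4⟩
      filter_upwards [h1] with t ht h0
      refine ht ?_
      change Polynomial.eval _ _ = 0
      rw [Matrix.eval_charpoly, sub_neg_eq_add, add_comm, h0]
    have hlim : Tendsto (fun t : ℝ => g + Matrix.scalar (Fin N) (t : ℂ)) (𝓝[≠] 0) (𝓝 g) := by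
      have hc : Continuous fun t : ℝ => g + Matrix.scalar (Fin N) (t : ℂ) := by
        simp only [Matrix.scalar_apply]
        exact continuous_const.add (Continuous.matrix_diagonal (by fun_prop))
      have := hc.tendsto 0
      simp only [Complex.ofReal_zero, map_zero, add_zero] at this
      exact this.mono_left nhdsWithin_le_nhds
    exact hclosed.mem_of_tendsto hlim (hev.mono fun t ht => hinv _ ht)
  obtain ⟨V, hV⟩ := hall
  exact ⟨V, star V.1 * g, hV, by rw [← mul_assoc, unitary_mul_star, one_mul]⟩

/-! ### Invariance of Lebesgue measure under linear maps preserving a compact neighbourhood -/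

theorem measurePreserving_of_preimage_eq {E : Type*} [NormedAddCommGroup E] [NormedSpace ℝ E]
    [MeasurableSpace E] [BorelSpace E] [FiniteDimensional ℝ E] (μ : Measure E) [μ.IsAddHaarMeasure]
    (L L' : E →ₗ[ℝ] E) (hL : L.comp L' = LinearMap.id) {q : E → ℝ} (hq : Continuous q)
    (hq0 : q 0 = 0) (hbdd : ∃ C, ∀ z, q z ≤ 1 → ‖z‖ ≤ C) (hqL : ∀ z, q (L z) = q z) :
    MeasurePreserving L μ μ := by
  have hdet : LinearMap.det L ≠ 0 := by
    intro h
    have := congrArg LinearMap.det hL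
    rw [LinearMap.det_comp, h, zero_mul, LinearMap.det_id] at this
    exact zero_ne_one this
  have hmeas : Measurable L := L.continuous_of_finiteDimensional.measurable
  refine ⟨hmeas, ?_⟩
  have hmap := Measure.map_linearMap_addHaar_eq_smul_addHaar μ hdet
  set K := {z : E | q z ≤ 1} with hK
  have hKclosed : IsClosed K := isClosed_le hq continuous_const
  have hKfin : μ K ≠ ⊤ := by
    obtain ⟨C, hC⟩ := hbdd
    refine ((measure_mono fun z hz => ?_).trans_lt
      (measure_closedBall_lt_top (μ := μ) (x := (0 : E)) (r := C))).ne
    rw [mem_closedBall_zero_iff]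
    exact hC z hz
  have hKpos : μ K ≠ 0 := by
    have hopen : IsOpen {z : E | q z < 1} := isOpen_lt hq continuous_const
    have h1 := hopen.measure_pos μ ⟨0, by simp [hq0]⟩
    exact (h1.trans_le (measure_mono fun z (hz : q z < 1) => hz.le)).ne'
  have h1 : μ.map L K = μ K := by
    rw [Measure.map_apply hmeas hKclosed.measurableSet]
    congr 1
    ext z
    simp [hK, hqL]
  rw [hmap, Measure.smul_apply, smul_eq_mul] at h1
  have h2 : ENNReal.ofReal |(LinearMap.det L)⁻¹| = 1 := by
    refine (ENNReal.mul_left_inj hKpos hKfin).1 ?_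
    rw [h1, one_mul]
  rw [hmap, h2, one_smul]

/-! ### Gaussian matrices -/

/-- The complex matrix with entries `Z`. -/
def mat {N : ℕ} (Z : Fin N × Fin N → ℂ) : Matrix (Fin N) (Fin N) ℂ := Matrix.of fun i j => Z (i, j)

/-- The coordinates of a complex matrix. -/
def unmat {N : ℕ} (M : Matrix (Fin N) (Fin N) ℂ) (p : Fin N × Fin N) : ℂ := M p.1 p.2

@[simp] theorem mat_unmat {N : ℕ} (M : Matrix (Fin N) (Fin N) ℂ) : mat (unmat M) = M := rfl

@[simp] theorem unmat_mat {N : ℕ} (Z : Fin N × Fin N → ℂ) : unmat (mat Z) = Z := rfl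

theorem continuous_mat {N : ℕ} : Continuous (mat : (Fin N × Fin N → ℂ) → _) :=
  continuous_matrix fun _ _ => continuous_apply _

theorem trace_star_mat_mul {N : ℕ} (Z : Fin N × Fin N → ℂ) :
    (star (mat Z) * mat Z).trace.re = ∑ p, ‖Z p‖ ^ 2 := by
  simp only [Matrix.trace, Matrix.diag_apply, Matrix.mul_apply, Matrix.star_apply, mat,
    Matrix.of_apply, Complex.re_sum]
  rw [Finset.sum_comm, ← Finset.sum_product']
  refine Finset.sum_congr rfl fun p _ => ?_
  rw [Complex.star_def, Complex.conj_mul', ← Complex.ofReal_pow, Complex.ofReal_re]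

theorem measurePreserving_unmat {N : ℕ}
    (L L' : Matrix (Fin N) (Fin N) ℂ →ₗ[ℝ] Matrix (Fin N) (Fin N) ℂ)
    (h : ∀ M, L (L' M) = M) (hL : ∀ M, (star (L M) * L M).trace = (star M * M).trace) :
    MeasurePreserving (fun Z : Fin N × Fin N → ℂ => unmat (L (mat Z))) volume volume := by
  let e : (Fin N × Fin N → ℂ) →ₗ[ℝ] Matrix (Fin N) (Fin N) ℂ :=
    { toFun := mat, map_add' := fun _ _ => rfl, map_smul' := fun _ _ => rfl }
  let e' : Matrix (Fin N) (Fin N) ℂ →ₗ[ℝ] (Fin N × Fin N → ℂ) :=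
    { toFun := unmat, map_add' := fun _ _ => rfl, map_smul' := fun _ _ => rfl }
  refine measurePreserving_of_preimage_eq volume (e' ∘ₗ L ∘ₗ e) (e' ∘ₗ L' ∘ₗ e) ?_
    (q := fun Z => ∑ p, ‖Z p‖ ^ 2) (by fun_prop) (by simp) ⟨1, fun Z hZ => ?_⟩ fun Z => ?_
  · refine LinearMap.ext fun Z => ?_
    change unmat (L (L' (mat Z))) = Z
    rw [h, unmat_mat]
  · refine (pi_norm_le_iff_of_nonneg zero_le_one).2 fun p => ?_
    have h1 : ‖Z p‖ ^ 2 ≤ 1 := (Finset.single_le_sum (f := fun p => ‖Z p‖ ^ 2)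
      (fun _ _ => sq_nonneg _) (Finset.mem_univ p)).trans hZ
    exact (sq_le_one_iff₀ (norm_nonneg _)).1 h1
  · change ∑ p, ‖unmat (L (mat Z)) p‖ ^ 2 = ∑ p, ‖Z p‖ ^ 2
    rw [← trace_star_mat_mul, ← trace_star_mat_mul, mat_unmat, hL]

theorem measurePreserving_unitary_mul {N : ℕ} (V : Matrix.unitaryGroup (Fin N) ℂ) :
    MeasurePreserving (fun Z : Fin N × Fin N → ℂ => unmat (V.1 * mat Z)) volume volume := by
  refine measurePreserving_unmat (LinearMap.mulLeft ℝ V.1) (LinearMap.mulLeft ℝ (star V.1))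
    (fun M => ?_) fun M => ?_
  · simp only [LinearMap.mulLeft_apply]
    rw [← mul_assoc, unitary_mul_star, one_mul]
  · simp only [LinearMap.mulLeft_apply]
    rw [star_mul, mul_assoc, ← mul_assoc (star V.1), unitary_star_mul, one_mul]

theorem measurePreserving_mul_unitary {N : ℕ} (V : Matrix.unitaryGroup (Fin N) ℂ) :
    MeasurePreserving (fun Z : Fin N × Fin N → ℂ => unmat (mat Z * V.1)) volume volume := by
  refine measurePreserving_unmat (LinearMap.mulRight ℝ V.1) (LinearMap.mulRight ℝ (star V.1))
    (fun M => ?_) fun M => ?_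
  · simp only [LinearMap.mulRight_apply]
    rw [mul_assoc, unitary_star_mul, mul_one]
  · simp only [LinearMap.mulRight_apply]
    rw [star_mul, mul_assoc, ← mul_assoc (star M), Matrix.trace_mul_comm, mul_assoc,
      unitary_mul_star, mul_one]

/-- The Gaussian weight `exp (-tr Z* Z)`. -/
def gaussWeight {N : ℕ} (Z : Fin N × Fin N → ℂ) : ℝ := Real.exp (-(star (mat Z) * mat Z).trace.re)

theorem gaussWeight_unitary_mul {N : ℕ} (V : Matrix.unitaryGroup (Fin N) ℂ)
    (Z : Fin N × Fin N → ℂ) : gaussWeight (unmat (V.1 * mat Z)) = gaussWeight Z := by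
  rw [gaussWeight, mat_unmat, star_mul, mul_assoc, ← mul_assoc (star V.1), unitary_star_mul,
    one_mul, gaussWeight]

theorem gaussWeight_mul_unitary {N : ℕ} (V : Matrix.unitaryGroup (Fin N) ℂ)
    (Z : Fin N × Fin N → ℂ) : gaussWeight (unmat (mat Z * V.1)) = gaussWeight Z := by
  rw [gaussWeight, mat_unmat, star_mul, mul_assoc, ← mul_assoc (star (mat Z)),
    Matrix.trace_mul_comm, mul_assoc, unitary_mul_star, mul_one, gaussWeight]

theorem continuous_gaussWeight {N : ℕ} : Continuous (gaussWeight : (Fin N × Fin N → ℂ) → ℝ) :=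
  Real.continuous_exp.comp (Complex.continuous_re.comp
    (Continuous.matrix_trace (continuous_mat.star.matrix_mul continuous_mat))).neg

/-- The function `exp (Re tr (diag(x) g diag(b) g*))`. -/
def biKernel {N : ℕ} (x b : Fin N → ℝ) (g : Matrix (Fin N) (Fin N) ℂ) : ℝ :=
  Real.exp (dg x * g * dg b * star g).trace.re

theorem continuous_biKernel {N : ℕ} (x b : Fin N → ℝ) : Continuous (biKernel x b) :=
  Real.continuous_exp.comp (Complex.continuous_re.comp (Continuous.matrix_trace
    (((continuous_const.matrix_mul continuous_id).matrix_mul continuous_const).matrix_mul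
      continuous_id.star)))

theorem trace_dg_mul_mat {N : ℕ} (y b : Fin N → ℝ) (Z : Fin N × Fin N → ℂ) :
    (dg y * mat Z * dg b * star (mat Z)).trace.re =
      ∑ p : Fin N × Fin N, y p.1 * b p.2 * ‖Z p‖ ^ 2 := by
  have h : ∀ i j, (dg y * mat Z * dg b) i j = (y i : ℂ) * Z (i, j) * (b j : ℂ) := by
    intro i j
    simp [dg, Matrix.mul_diagonal, Matrix.diagonal_mul, mat]
  have h0 : ∀ i, (dg y * mat Z * dg b * star (mat Z)) i i =
      ∑ j, (y i : ℂ) * Z (i, j) * (b j : ℂ) * star (mat Z i j) := by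
    intro i
    rw [Matrix.mul_apply]
    exact Finset.sum_congr rfl fun j _ => by rw [h, Matrix.star_apply]
  simp only [Matrix.trace, Matrix.diag_apply, h0, Complex.re_sum]
  rw [← Finset.sum_product']
  refine Finset.sum_congr rfl fun p _ => ?_
  have h1 : (y p.1 : ℂ) * Z (p.1, p.2) * (b p.2 : ℂ) * star (mat Z p.1 p.2) =
      ((y p.1 * b p.2 * ‖Z p‖ ^ 2 : ℝ) : ℂ) := by
    have h2 := Complex.mul_conj' (Z p)
    push_cast
    rw [← h2]
    simp only [mat, Matrix.of_apply, Complex.star_def]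
    ring
  rw [h1, Complex.ofReal_re]

theorem lintegral_gauss_diag {N : ℕ} {y b : Fin N → ℝ} (h : ∀ i j, y i * b j < 1) :
    ∫⁻ Z : Fin N × Fin N → ℂ, ENNReal.ofReal (gaussWeight Z * biKernel y b (mat Z)) =
      ENNReal.ofReal (∏ _i : Fin N, ∏ _j : Fin N, Real.pi) *
        ENNReal.ofReal (∏ i, ∏ j, (1 - y i * b j)⁻¹) := by
  have hpos : ∀ p : Fin N × Fin N, 0 < 1 - y p.1 * b p.2 := fun p => sub_pos.2 (h p.1 p.2)
  have hfun : ∀ Z : Fin N × Fin N → ℂ, gaussWeight Z * biKernel y b (mat Z) =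
      ∏ p : Fin N × Fin N, Real.exp (-(1 - y p.1 * b p.2) * ‖Z p‖ ^ 2) := by
    intro Z
    rw [gaussWeight, biKernel, trace_star_mat_mul, trace_dg_mul_mat, ← Real.exp_add,
      ← Real.exp_sum, ← Finset.sum_neg_distrib, ← Finset.sum_add_distrib]
    congr 1
    exact Finset.sum_congr rfl fun p _ => by ring
  have hint1 : ∀ c : ℝ, 0 < c → Integrable (fun z : ℂ => Real.exp (-c * ‖z‖ ^ 2)) := by
    intro c hc
    have h1 := (GaussianFourier.integrable_cexp_neg_mul_sq_norm_add (V := ℂ) (b := (c : ℂ))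
      (by simpa using hc) 0 0).re
    refine h1.congr (Eventually.of_forall fun z => ?_)
    have h2 : (-(c : ℂ) * (‖z‖ : ℂ) ^ 2 + 0 * ((inner ℝ (0 : ℂ) z : ℝ) : ℂ)) =
        ((-c * ‖z‖ ^ 2 : ℝ) : ℂ) := by push_cast; ring
    simp only
    rw [h2, ← Complex.ofReal_exp]
    exact Complex.ofReal_re _
  have hval : ∀ c : ℝ, 0 < c → ∫ z : ℂ, Real.exp (-c * ‖z‖ ^ 2) = Real.pi * c⁻¹ := by
    intro c hc
    rw [GaussianFourier.integral_rexp_neg_mul_sq_norm hc, Complex.finrank_real_complex]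
    norm_num
    rw [div_eq_mul_inv]
  have hint : Integrable fun Z : Fin N × Fin N → ℂ =>
      ∏ p : Fin N × Fin N, Real.exp (-(1 - y p.1 * b p.2) * ‖Z p‖ ^ 2) :=
    Integrable.fintype_prod (f := fun (p : Fin N × Fin N) (z : ℂ) =>
      Real.exp (-(1 - y p.1 * b p.2) * ‖z‖ ^ 2)) fun p => hint1 _ (hpos p)
  simp only [hfun]
  rw [← ofReal_integral_eq_lintegral_ofReal hint
    (Eventually.of_forall fun Z => Finset.prod_nonneg fun p _ => (Real.exp_pos _).le),
    integral_fintype_prod_volume_eq_prod (fun (p : Fin N × Fin N) (z : ℂ) =>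
      Real.exp (-(1 - y p.1 * b p.2) * ‖z‖ ^ 2)), ← ENNReal.ofReal_mul
        (Finset.prod_nonneg fun _ _ => Finset.prod_nonneg fun _ _ => Real.pi_pos.le)]
  congr 1
  simp only [hval _ (hpos _), ← Finset.prod_mul_distrib, ← Finset.prod_product']
  rfl

/-! ### Symmetry of the Gaussian average of a compression -/

/-- The compression `diag(√a) U diag(x) U* diag(√a)`. -/
def compress {N : ℕ} (a : Fin N → ℝ) (U : Matrix.unitaryGroup (Fin N) ℂ) (x : Fin N → ℝ) :
    HermitianMatrix N :=
  ⟨dg (fun i => Real.sqrt (a i)) * (conjDiag U x).1 * star (dg fun i => Real.sqrt (a i)),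
    isHermitian_conj (conjDiag U x).2 _⟩

theorem lintegral_gauss_hermitian {N : ℕ} (Y : HermitianMatrix N) {b : Fin N → ℝ}
    (h : ∀ i j, Y.2.eigenvalues i * b j < 1) :
    ∫⁻ Z : Fin N × Fin N → ℂ, ENNReal.ofReal (gaussWeight Z *
        Real.exp (Y.1 * mat Z * dg b * star (mat Z)).trace.re) =
      ENNReal.ofReal (∏ _i : Fin N, ∏ _j : Fin N, Real.pi) *
        ENNReal.ofReal (∏ i, ∏ j, (1 - Y.2.eigenvalues i * b j)⁻¹) := by
  obtain ⟨V, hV⟩ := exists_conjDiag_eq Y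
  rw [← lintegral_gauss_diag h, ← (measurePreserving_unitary_mul V).lintegral_comp]
  · refine lintegral_congr fun Z => ?_
    rw [gaussWeight_unitary_mul, mat_unmat]
    congr 3
    have hY : Y.1 = V.1 * dg Y.2.eigenvalues * star V.1 := (congrArg Subtype.val hV).symm
    have h1 : (Y.1 * (V.1 * mat Z) * dg b * star (V.1 * mat Z)).trace =
        (dg Y.2.eigenvalues * mat Z * dg b * star (mat Z)).trace := by
      conv_lhs => rw [hY, star_mul]
      rw [← mul_assoc, Matrix.trace_mul_comm]
      simp only [← mul_assoc]
      rw [unitary_star_mul, one_mul, mul_assoc (dg Y.2.eigenvalues), unitary_star_mul, mul_one]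
    rw [h1]
  · have hc : Continuous fun M : Matrix (Fin N) (Fin N) ℂ => (Y.1 * M * dg b * star M).trace.re :=
      Complex.continuous_re.comp (Continuous.matrix_trace
        (((continuous_const.matrix_mul continuous_id).matrix_mul continuous_const).matrix_mul
          continuous_id.star))
    exact (ENNReal.continuous_ofReal.comp (continuous_gaussWeight.mul
      (Real.continuous_exp.comp (hc.comp continuous_mat)))).measurable

theorem lintegral_gauss_unitary {N : ℕ}
    {φ : Matrix.unitaryGroup (Fin N) ℂ → Matrix (Fin N) (Fin N) ℂ → ℝ}
    (hφ : Continuous (Function.uncurry φ)) :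
    ∫⁻ U, (∫⁻ Z : Fin N × Fin N → ℂ, ENNReal.ofReal (gaussWeight Z * φ U (mat Z)))
        ∂unitaryHaar N =
      ∫⁻ Z : Fin N × Fin N → ℂ, ENNReal.ofReal (gaussWeight Z) *
        ∫⁻ U, ∫⁻ W, ENNReal.ofReal (φ U (mat Z * W.1)) ∂unitaryHaar N ∂unitaryHaar N := by
  have hg0 : ∀ Z : Fin N × Fin N → ℂ, 0 ≤ gaussWeight Z := fun Z => (Real.exp_pos _).le
  have hmeasφ : ∀ U, Measurable fun Z : Fin N × Fin N → ℂ =>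
      ENNReal.ofReal (gaussWeight Z * φ U (mat Z)) := by
    intro U
    have : Continuous fun Z : Fin N × Fin N → ℂ => φ U (mat Z) :=
      hφ.comp (continuous_const.prodMk continuous_mat)
    exact (ENNReal.continuous_ofReal.comp (continuous_gaussWeight.mul this)).measurable
  have hmat : ∀ {α : Type} [TopologicalSpace α] {f : α → Matrix.unitaryGroup (Fin N) ℂ}
      {g : α → (Fin N × Fin N → ℂ)} {k : α → Matrix.unitaryGroup (Fin N) ℂ}, Continuous f →
      Continuous g → Continuous k → Continuous fun q => ENNReal.ofReal
        (gaussWeight (g q) * φ (f q) (mat (g q) * (k q).1)) := by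
    intro α _ f g k hf hg hk
    refine ENNReal.continuous_ofReal.comp ((continuous_gaussWeight.comp hg).mul
      (hφ.comp (hf.prodMk ?_)))
    exact (continuous_mat.comp hg).matrix_mul (continuous_subtype_val.comp hk)
  have step1 : ∀ U, ∫⁻ Z : Fin N × Fin N → ℂ, ENNReal.ofReal (gaussWeight Z * φ U (mat Z)) =
      ∫⁻ Z : Fin N × Fin N → ℂ, ∫⁻ W,
        ENNReal.ofReal (gaussWeight Z * φ U (mat Z * W.1)) ∂unitaryHaar N := by
    intro U
    have h1 : ∀ W : Matrix.unitaryGroup (Fin N) ℂ,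
        ∫⁻ Z : Fin N × Fin N → ℂ, ENNReal.ofReal (gaussWeight Z * φ U (mat Z * W.1)) =
          ∫⁻ Z : Fin N × Fin N → ℂ, ENNReal.ofReal (gaussWeight Z * φ U (mat Z)) := by
      intro W
      rw [← (measurePreserving_mul_unitary W).lintegral_comp (hmeasφ U)]
      refine lintegral_congr fun Z => ?_
      rw [gaussWeight_mul_unitary, mat_unmat]
    rw [lintegral_lintegral_swap]
    · simp only [h1, lintegral_const, measure_univ, mul_one]
    · exact (hmat (f := fun _ : (Fin N × Fin N → ℂ) × Matrix.unitaryGroup (Fin N) ℂ => U)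
        continuous_const continuous_fst continuous_snd).measurable.aemeasurable
  simp only [step1]
  rw [lintegral_lintegral_swap]
  · refine lintegral_congr fun Z => ?_
    simp only [ENNReal.ofReal_mul (hg0 Z)]
    have hm : ∀ U, Measurable fun W : Matrix.unitaryGroup (Fin N) ℂ =>
        ENNReal.ofReal (φ U (mat Z * W.1)) := by
      intro U
      exact (ENNReal.continuous_ofReal.comp (hφ.comp (continuous_const.prodMk
        (continuous_const.matrix_mul continuous_subtype_val)))).measurable
    simp only [lintegral_const_mul _ (hm _)]
    refine lintegral_const_mul _ ?_
    refine Measurable.lintegral_prod_right' (f := fun q : Matrix.unitaryGroup (Fin N) ℂ ×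
      Matrix.unitaryGroup (Fin N) ℂ => ENNReal.ofReal (φ q.1 (mat Z * q.2.1))) ?_
    exact (ENNReal.continuous_ofReal.comp (hφ.comp (continuous_fst.prodMk
      (continuous_const.matrix_mul (continuous_subtype_val.comp continuous_snd))))).measurable
  · refine Measurable.aemeasurable ?_
    exact Measurable.lintegral_prod_right' (hmat (continuous_fst.comp continuous_fst)
      (continuous_snd.comp continuous_fst) continuous_snd).measurable

theorem lintegral_biKernel_star {N : ℕ} (x b : Fin N → ℝ) (g : Matrix (Fin N) (Fin N) ℂ) :
    ∫⁻ U : Matrix.unitaryGroup (Fin N) ℂ, ∫⁻ W : Matrix.unitaryGroup (Fin N) ℂ,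
        ENNReal.ofReal (biKernel x b (star U.1 * star g * W.1)) ∂unitaryHaar N ∂unitaryHaar N =
      ∫⁻ U : Matrix.unitaryGroup (Fin N) ℂ, ∫⁻ W : Matrix.unitaryGroup (Fin N) ℂ,
        ENNReal.ofReal (biKernel x b (star U.1 * g * W.1)) ∂unitaryHaar N ∂unitaryHaar N := by
  obtain ⟨V, p, hp, rfl⟩ := exists_polar g
  have hp' : star p = p := hp
  have h1 : ∀ U : Matrix.unitaryGroup (Fin N) ℂ, ∫⁻ W : Matrix.unitaryGroup (Fin N) ℂ,
      ENNReal.ofReal (biKernel x b (star U.1 * star (V.1 * p) * W.1)) ∂unitaryHaar N =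
      ∫⁻ W : Matrix.unitaryGroup (Fin N) ℂ,
        ENNReal.ofReal (biKernel x b (star U.1 * p * W.1)) ∂unitaryHaar N := by
    intro U
    rw [← lintegral_mul_left_eq_self (fun W : Matrix.unitaryGroup (Fin N) ℂ =>
      ENNReal.ofReal (biKernel x b (star U.1 * p * W.1))) (V⁻¹)]
    refine lintegral_congr fun W => ?_
    rw [star_mul, hp']
    congr 2
    change _ = star U.1 * p * (star V.1 * W.1)
    simp only [mul_assoc]
  simp only [h1]
  rw [← lintegral_mul_left_eq_self (fun U : Matrix.unitaryGroup (Fin N) ℂ =>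
    ∫⁻ W : Matrix.unitaryGroup (Fin N) ℂ,
      ENNReal.ofReal (biKernel x b (star U.1 * p * W.1)) ∂unitaryHaar N) (V⁻¹)]
  refine lintegral_congr fun U => lintegral_congr fun W => ?_
  congr 2
  change star (star V.1 * U.1) * p * W.1 = _
  rw [star_mul, star_star]
  simp only [mul_assoc]

/-- The average over the unitary group of the Gaussian integral of a compression. -/
def gaussAverage {N : ℕ} (a x b : Fin N → ℝ) : ENNReal :=
  ∫⁻ U, (∫⁻ Z : Fin N × Fin N → ℂ, ENNReal.ofReal (gaussWeight Z *
    Real.exp ((compress a U x).1 * mat Z * dg b * star (mat Z)).trace.re)) ∂unitaryHaar N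

theorem trace_compress_mul {N : ℕ} (a x b : Fin N → ℝ) (U : Matrix.unitaryGroup (Fin N) ℂ)
    (Z : Matrix (Fin N) (Fin N) ℂ) :
    ((compress a U x).1 * Z * dg b * star Z).trace =
      (dg x * (star U.1 * dg (fun i => Real.sqrt (a i)) * Z) * dg b *
        star (star U.1 * dg (fun i => Real.sqrt (a i)) * Z)).trace := by
  have hGs : star (dg fun i => Real.sqrt (a i)) = dg fun i => Real.sqrt (a i) := isHermitian_dg _
  simp only [compress, conjDiag, star_mul, star_star, hGs]
  generalize (dg fun i => Real.sqrt (a i)) = G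
  have h2 := Matrix.trace_mul_comm (G * U.1) (dg x * star U.1 * G * Z * dg b * star Z)
  simp only [← mul_assoc] at h2 ⊢
  rw [h2]

theorem trace_compress_mul' {N : ℕ} (a x b : Fin N → ℝ) (U : Matrix.unitaryGroup (Fin N) ℂ)
    (Z : Matrix (Fin N) (Fin N) ℂ) :
    ((compress a U b).1 * Z * dg x * star Z).trace =
      (dg x * (star Z * dg (fun i => Real.sqrt (a i)) * U.1) * dg b *
        star (star Z * dg (fun i => Real.sqrt (a i)) * U.1)).trace := by
  have hGs : star (dg fun i => Real.sqrt (a i)) = dg fun i => Real.sqrt (a i) := isHermitian_dg _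
  simp only [compress, conjDiag, star_mul, star_star, hGs]
  generalize (dg fun i => Real.sqrt (a i)) = G
  have h2 := Matrix.trace_mul_comm (G * U.1 * dg b * star U.1 * G * Z) (dg x * star Z)
  simp only [← mul_assoc] at h2 ⊢
  rw [h2]

theorem gaussAverage_eq {N : ℕ} (a x b : Fin N → ℝ) :
    gaussAverage a x b = ∫⁻ Z : Fin N × Fin N → ℂ, ENNReal.ofReal (gaussWeight Z) *
      ∫⁻ U : Matrix.unitaryGroup (Fin N) ℂ, ∫⁻ W : Matrix.unitaryGroup (Fin N) ℂ,
        ENNReal.ofReal (biKernel x b (star U.1 * (dg (fun i => Real.sqrt (a i)) * mat Z) * W.1))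
          ∂unitaryHaar N ∂unitaryHaar N := by
  have h1 := lintegral_gauss_unitary (N := N)
    (φ := fun U M => biKernel x b (star U.1 * dg (fun i => Real.sqrt (a i)) * M))
    ((continuous_biKernel x b).comp
      (((continuous_subtype_val.comp continuous_fst).star.matrix_mul
        continuous_const).matrix_mul continuous_snd))
  simp only [← mul_assoc] at h1 ⊢
  rw [← h1, gaussAverage]
  refine lintegral_congr fun U => lintegral_congr fun Z => ?_
  rw [biKernel, trace_compress_mul]

theorem lintegral_gauss_star {N : ℕ} (G : Matrix (Fin N) (Fin N) ℂ) (x b : Fin N → ℝ)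
    (Z : Matrix (Fin N) (Fin N) ℂ) :
    ∫⁻ U : Matrix.unitaryGroup (Fin N) ℂ, ∫⁻ W : Matrix.unitaryGroup (Fin N) ℂ,
        ENNReal.ofReal (biKernel x b (star (Z * W.1) * G * U.1)) ∂unitaryHaar N ∂unitaryHaar N =
      ∫⁻ W : Matrix.unitaryGroup (Fin N) ℂ, ∫⁻ U : Matrix.unitaryGroup (Fin N) ℂ,
        ENNReal.ofReal (biKernel x b (star W.1 * (star Z * G) * U.1))
          ∂unitaryHaar N ∂unitaryHaar N := by
  have hc : Continuous fun q : Matrix.unitaryGroup (Fin N) ℂ × Matrix.unitaryGroup (Fin N) ℂ =>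
      star (Z * q.2.1) * G * q.1.1 :=
    (((continuous_const.matrix_mul (continuous_subtype_val.comp
      continuous_snd)).star).matrix_mul continuous_const).matrix_mul
        (continuous_subtype_val.comp continuous_fst)
  rw [lintegral_lintegral_swap (f := fun U W : Matrix.unitaryGroup (Fin N) ℂ =>
    ENNReal.ofReal (biKernel x b (star (Z * W.1) * G * U.1))) (ENNReal.continuous_ofReal.comp
    ((continuous_biKernel x b).comp hc)).measurable.aemeasurable]
  refine lintegral_congr fun W => lintegral_congr fun U => ?_
  rw [star_mul, mul_assoc (star W.1)]

theorem gaussAverage_eq_star {N : ℕ} (a x b : Fin N → ℝ) :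
    gaussAverage a b x = ∫⁻ Z : Fin N × Fin N → ℂ, ENNReal.ofReal (gaussWeight Z) *
      ∫⁻ W : Matrix.unitaryGroup (Fin N) ℂ, ∫⁻ U : Matrix.unitaryGroup (Fin N) ℂ,
        ENNReal.ofReal (biKernel x b
          (star W.1 * (star (mat Z) * dg (fun i => Real.sqrt (a i))) * U.1))
          ∂unitaryHaar N ∂unitaryHaar N := by
  have h1 := lintegral_gauss_unitary (N := N)
    (φ := fun U M => biKernel x b (star M * dg (fun i => Real.sqrt (a i)) * U.1))
    ((continuous_biKernel x b).comp
      ((continuous_snd.star.matrix_mul continuous_const).matrix_mul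
        (continuous_subtype_val.comp continuous_fst)))
  simp only [lintegral_gauss_star] at h1
  rw [← h1, gaussAverage]
  refine lintegral_congr fun U => lintegral_congr fun Z => ?_
  rw [biKernel, trace_compress_mul']

theorem gaussAverage_comm {N : ℕ} (a x b : Fin N → ℝ) :
    gaussAverage a x b = gaussAverage a b x := by
  have hGs : star (dg fun i => Real.sqrt (a i)) = dg fun i => Real.sqrt (a i) := isHermitian_dg _
  rw [gaussAverage_eq, gaussAverage_eq_star]
  refine lintegral_congr fun Z => ?_
  rw [← lintegral_biKernel_star, star_mul, hGs]

/-! ### Eigenvalues of a compression -/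

theorem star_dotProduct_dg_mulVec {N : ℕ} (x : Fin N → ℝ) (v : Fin N → ℂ) :
    star v ⬝ᵥ (dg x *ᵥ v) = ((∑ i, x i * ‖v i‖ ^ 2 : ℝ) : ℂ) := by
  simp only [dotProduct, dg, Matrix.mulVec_diagonal, Pi.star_apply, Complex.ofReal_sum]
  refine Finset.sum_congr rfl fun i _ => ?_
  have := Complex.conj_mul' (v i)
  push_cast
  rw [← this, Complex.star_def]
  ring

theorem star_dotProduct_conj_mulVec {N : ℕ} (Q M : Matrix (Fin N) (Fin N) ℂ) (v : Fin N → ℂ) :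
    star v ⬝ᵥ ((star Q * M * Q) *ᵥ v) = star (Q *ᵥ v) ⬝ᵥ (M *ᵥ (Q *ᵥ v)) := by
  rw [Matrix.star_mulVec, mul_assoc, ← Matrix.mulVec_mulVec, ← Matrix.mulVec_mulVec,
    Matrix.dotProduct_mulVec (star v)]
  rfl

theorem compress_spectral {N : ℕ} (a x : Fin N → ℝ) (U : Matrix.unitaryGroup (Fin N) ℂ)
    (ha : ∀ i, 0 ≤ a i) :
    ∃ Q W : Matrix (Fin N) (Fin N) ℂ, star W * W = 1 ∧ star Q * Q = star W * dg a * W ∧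
      dg (compress a U x).2.eigenvalues = star Q * dg x * Q := by
  obtain ⟨W, hW⟩ := exists_conjDiag_eq (compress a U x)
  have hGs : star (dg fun i => Real.sqrt (a i)) = dg fun i => Real.sqrt (a i) := isHermitian_dg _
  refine ⟨star U.1 * dg (fun i => Real.sqrt (a i)) * W.1, W.1, unitary_star_mul W, ?_, ?_⟩
  · have h1 : dg a = dg (fun i => Real.sqrt (a i)) * dg (fun i => Real.sqrt (a i)) := by
      rw [dg_mul]
      congr 1
      funext i
      exact (Real.mul_self_sqrt (ha i)).symm
    rw [star_mul, star_mul, star_star, hGs, h1]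
    simp only [mul_assoc]
    rw [← mul_assoc U.1, unitary_mul_star, one_mul]
  · have h2 : (compress a U x).1 = W.1 * dg (compress a U x).2.eigenvalues * star W.1 :=
      (congrArg Subtype.val hW).symm
    have h3 : dg (compress a U x).2.eigenvalues = star W.1 * (compress a U x).1 * W.1 := by
      conv_rhs => rw [h2]
      simp only [mul_assoc]
      rw [unitary_star_mul, mul_one, ← mul_assoc, unitary_star_mul, one_mul]
    rw [h3, star_mul, star_mul, star_star, hGs]
    simp only [compress, conjDiag, hGs, mul_assoc]

theorem card_lt_eigenvalues_compress_le {N : ℕ} {a x : Fin N → ℝ} {α c : ℝ}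
    (ha : ∀ i, 0 ≤ a i) (haα : ∀ i, a i ≤ α) (hc : 0 ≤ c) (U : Matrix.unitaryGroup (Fin N) ℂ) :
    Fintype.card {j // α * c < (compress a U x).2.eigenvalues j} ≤ Fintype.card {i // c < x i} := by
  obtain ⟨Q, W, hW, hQ, hy⟩ := compress_spectral a x U ha
  generalize (compress a U x).2.eigenvalues = y at hy ⊢
  by_contra! hlt
  let f : (Fin N → ℂ) →ₗ[ℂ] ({i // c < x i} → ℂ) × ({j // ¬ α * c < y j} → ℂ) :=
    ((LinearMap.funLeft ℂ ℂ Subtype.val) ∘ₗ Q.mulVecLin).prod (LinearMap.funLeft ℂ ℂ Subtype.val)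
  have hfin : Module.finrank ℂ (({i // c < x i} → ℂ) × ({j // ¬ α * c < y j} → ℂ)) <
      Module.finrank ℂ (Fin N → ℂ) := by
    rw [Module.finrank_prod, Module.finrank_fintype_fun_eq_card,
      Module.finrank_fintype_fun_eq_card, Module.finrank_fintype_fun_eq_card]
    have h1 := Fintype.card_subtype_compl fun j => α * c < y j
    have h2 := Fintype.card_subtype_le fun j => α * c < y j
    omega
  obtain ⟨w, hw, hw0⟩ := Submodule.exists_mem_ne_zero_of_ne_bot
    (LinearMap.ker_ne_bot_of_finrank_lt (f := f) hfin)
  have hw1 : ∀ i, c < x i → (Q *ᵥ w) i = 0 := fun i hi =>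
    congrFun (congrArg Prod.fst (LinearMap.mem_ker.1 hw)) ⟨i, hi⟩
  have hw2 : ∀ j, ¬ α * c < y j → w j = 0 := fun j hj =>
    congrFun (congrArg Prod.snd (LinearMap.mem_ker.1 hw)) ⟨j, hj⟩
  have e1 : ∑ j, y j * ‖w j‖ ^ 2 = ∑ i, x i * ‖(Q *ᵥ w) i‖ ^ 2 := by
    have := star_dotProduct_dg_mulVec y w
    rw [hy, star_dotProduct_conj_mulVec, star_dotProduct_dg_mulVec] at this
    exact (Complex.ofReal_injective this).symm
  have one_dg : (dg fun _ : Fin N => (1 : ℝ)) = 1 := by simp [dg]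
  have e2 : ∑ i, ‖(Q *ᵥ w) i‖ ^ 2 = ∑ i, a i * ‖(W *ᵥ w) i‖ ^ 2 := by
    have h1 := star_dotProduct_dg_mulVec (fun _ => 1) (Q *ᵥ w)
    rw [← star_dotProduct_conj_mulVec, one_dg, mul_one, hQ, star_dotProduct_conj_mulVec,
      star_dotProduct_dg_mulVec] at h1
    simpa using (Complex.ofReal_injective h1).symm
  have e3 : ∑ i, ‖(W *ᵥ w) i‖ ^ 2 = ∑ i, ‖w i‖ ^ 2 := by
    have h1 := star_dotProduct_dg_mulVec (fun _ => 1) (W *ᵥ w)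
    rw [← star_dotProduct_conj_mulVec, one_dg, mul_one, hW, ← one_dg,
      star_dotProduct_dg_mulVec] at h1
    simpa using (Complex.ofReal_injective h1).symm
  have h1 : ∑ i, x i * ‖(Q *ᵥ w) i‖ ^ 2 ≤ c * ∑ i, ‖(Q *ᵥ w) i‖ ^ 2 := by
    rw [Finset.mul_sum]
    refine Finset.sum_le_sum fun i _ => ?_
    by_cases hi : c < x i
    · rw [hw1 i hi]; simp
    · exact mul_le_mul_of_nonneg_right (not_lt.1 hi) (sq_nonneg _)
  have h2 : ∑ i, a i * ‖(W *ᵥ w) i‖ ^ 2 ≤ α * ∑ i, ‖w i‖ ^ 2 := by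
    rw [← e3, Finset.mul_sum]
    exact Finset.sum_le_sum fun i _ => mul_le_mul_of_nonneg_right (haα i) (sq_nonneg _)
  have h3 : α * c * ∑ j, ‖w j‖ ^ 2 < ∑ j, y j * ‖w j‖ ^ 2 := by
    obtain ⟨j, hj⟩ := Function.ne_iff.1 hw0
    rw [Finset.mul_sum]
    refine Finset.sum_lt_sum (fun i _ => ?_) ⟨j, Finset.mem_univ j, ?_⟩
    · by_cases hi : α * c < y i
      · exact mul_le_mul_of_nonneg_right hi.le (sq_nonneg _)
      · rw [hw2 i hi]; simp
    · refine mul_lt_mul_of_pos_right ?_ (pow_pos (norm_pos_iff.2 hj) 2)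
      by_contra hi
      exact hj (hw2 j hi)
  have h4 := mul_le_mul_of_nonneg_left h2 hc
  rw [← e2] at h4
  nlinarith

theorem eigenvalues_compress_nonneg {N : ℕ} (a : Fin N → ℝ) {x : Fin N → ℝ} (hx : ∀ i, 0 ≤ x i)
    (U : Matrix.unitaryGroup (Fin N) ℂ) (i : Fin N) : 0 ≤ (compress a U x).2.eigenvalues i := by
  refine Matrix.PosSemidef.eigenvalues_nonneg (A := (compress a U x).1) ?_ i
  have h : (dg x).PosSemidef := Matrix.PosSemidef.diagonal fun i => Complex.zero_le_real.2 (hx i)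
  exact (h.mul_mul_conjTranspose_same U.1).mul_mul_conjTranspose_same _

theorem eigenvalues_compress_le {N : ℕ} {a x : Fin N → ℝ} {α c : ℝ}
    (ha : ∀ i, 0 ≤ a i) (haα : ∀ i, a i ≤ α) (hc : 0 ≤ c) (hxc : ∀ i, x i ≤ c)
    (U : Matrix.unitaryGroup (Fin N) ℂ) (j : Fin N) :
    (compress a U x).2.eigenvalues j ≤ α * c := by
  by_contra! hj
  have h1 := card_lt_eigenvalues_compress_le (x := x) ha haα hc U
  have h2 : Fintype.card {i // c < x i} = 0 :=
    Fintype.card_eq_zero_iff.2 ⟨fun i => absurd i.2 (hxc i.1).not_gt⟩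
  have h3 : 0 < Fintype.card {j // α * c < (compress a U x).2.eigenvalues j} :=
    Fintype.card_pos_iff.2 ⟨⟨j, hj⟩⟩
  omega

theorem exists_perm_eigenvalues_compress_le {N : ℕ} {a x : Fin N → ℝ} {α : ℝ}
    (ha : ∀ i, 0 ≤ a i) (haα : ∀ i, a i ≤ α) (hx : ∀ i, 0 ≤ x i) (hanti : Antitone x)
    (U : Matrix.unitaryGroup (Fin N) ℂ) :
    ∃ σ : Equiv.Perm (Fin N), ∀ k, (compress a U x).2.eigenvalues (σ k) ≤ α * x k := by
  have hcard := fun c (hc : 0 ≤ c) => card_lt_eigenvalues_compress_le (x := x) ha haα hc U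
  generalize (compress a U x).2.eigenvalues = y at hcard ⊢
  have hsort : Antitone (y ∘ Fin.revPerm.trans (Tuple.sort y)) := fun i j hij =>
    Tuple.monotone_sort y (Fin.rev_le_rev.2 hij)
  refine ⟨Fin.revPerm.trans (Tuple.sort y), fun k => ?_⟩
  set σ := Fin.revPerm.trans (Tuple.sort y)
  by_contra! hk
  have h1 := hcard (x k) (hx k)
  have h2 : Fintype.card {i // x k < x i} ≤ k := by
    rw [Fintype.card_subtype]
    calc _ ≤ (Finset.Iio k).card := Finset.card_le_card fun i hi => by
            rw [Finset.mem_filter] at hi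
            rw [Finset.mem_Iio]
            by_contra! h
            exact absurd hi.2 (hanti h).not_gt
      _ = k := Fin.card_Iio k
  have h3 : (k : ℕ) + 1 ≤ Fintype.card {j // α * x k < y j} := by
    rw [Fintype.card_subtype, ← Fin.card_Iic k, ← Finset.card_map σ.toEmbedding]
    refine Finset.card_le_card fun j hj => ?_
    obtain ⟨i, hi, rfl⟩ := Finset.mem_map.1 hj
    rw [Finset.mem_filter]
    exact ⟨Finset.mem_univ _, hk.trans_le (hsort (Finset.mem_Iic.1 hi))⟩
  omega

theorem schur_compress_le {N : ℕ} (μ : YoungDiagram) {a x : Fin N → ℝ} {α : ℝ}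
    (ha : ∀ i, 0 ≤ a i) (haα : ∀ i, a i ≤ α) (hx : ∀ i, 0 ≤ x i) (hanti : Antitone x)
    (U : Matrix.unitaryGroup (Fin N) ℂ) :
    schur μ (compress a U x).2.eigenvalues ≤ α ^ μ.card * schur μ x := by
  obtain ⟨σ, hσ⟩ := exists_perm_eigenvalues_compress_le ha haα hx hanti U
  rw [← schur_comp_perm μ _ σ, ← schur_smul]
  exact schur_mono μ (fun i => eigenvalues_compress_nonneg a hx U _) hσ

/-! ### Comparison of coefficients -/

theorem abs_coeff_mul_le_of_hasSum_pow {d : ℕ → ℝ} {r t K : ℝ} {n : ℕ} (ht : 0 < t) (htr : t ≤ r)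
    (h : HasSum (fun k => d k * t ^ k) 0) (hd : ∀ k < n, d k = 0)
    (hK : HasSum (fun k => |d k * r ^ k|) K) : |d n| * r ^ (n + 1) ≤ t * K := by
  have hr : 0 < r := ht.trans_le htr
  have htr0 : 0 < t / r := div_pos ht hr
  have ht1 : t / r ≤ 1 := (div_le_one hr).2 htr
  have h1 : HasSum (Function.update (fun k => d k * t ^ k) n 0) (0 - d n * t ^ n) := by
    have := h.update n 0
    rwa [add_zero] at this
  have h2 : ∀ k, |Function.update (fun k => d k * t ^ k) n 0 k| ≤
      (t / r) ^ (n + 1) * |d k * r ^ k| := by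
    intro k
    rcases lt_trichotomy k n with hlt | rfl | hgt
    · rw [Function.update_of_ne hlt.ne, hd k hlt]; simp
    · rw [Function.update_self, abs_zero]
      exact mul_nonneg (pow_nonneg htr0.le _) (abs_nonneg _)
    · have h3 : d k * t ^ k = (t / r) ^ k * (d k * r ^ k) := by
        rw [div_pow, mul_left_comm, div_mul_cancel₀ _ (pow_ne_zero _ hr.ne')]
      rw [Function.update_of_ne hgt.ne', h3, abs_mul, abs_of_nonneg (pow_nonneg htr0.le k)]
      exact mul_le_mul_of_nonneg_right (pow_le_pow_of_le_one htr0.le ht1 hgt) (abs_nonneg _)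
  have h5 : |0 - d n * t ^ n| ≤ (t / r) ^ (n + 1) * K := by
    have h6 := hK.mul_left ((t / r) ^ (n + 1))
    generalize Function.update (fun k => d k * t ^ k) n 0 = u at h1 h2
    exact abs_le.2 ⟨hasSum_le (fun k => (abs_le.1 (h2 k)).1) h6.neg h1,
      hasSum_le (fun k => (abs_le.1 (h2 k)).2) h1 h6⟩
  rw [zero_sub, abs_neg, abs_mul, abs_of_pos (pow_pos ht n), div_pow, div_mul_eq_mul_div,
    le_div_iff₀ (pow_pos hr _), pow_succ t] at h5
  have h7 : t ^ n * (|d n| * r ^ (n + 1)) ≤ t ^ n * (t * K) := by linarith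
  exact le_of_mul_le_mul_left h7 (pow_pos ht n)

theorem eq_zero_of_hasSum_pow {d : ℕ → ℝ} {r : ℝ} (hr : 0 < r)
    (h : ∀ t, 0 < t → t ≤ r → HasSum (fun n => d n * t ^ n) 0) (n : ℕ) : d n = 0 := by
  induction n using Nat.strong_induction_on with
  | _ n ih =>
    have hs : Summable fun k => |d k * r ^ k| := (h r hr le_rfl).summable.abs
    obtain ⟨K, hK⟩ := hs
    have hlim : Tendsto (fun t : ℝ => t * K) (𝓝[>] 0) (𝓝 0) := by
      have : Tendsto (fun t : ℝ => t * K) (𝓝 0) (𝓝 (0 * K)) := tendsto_id.mul_const K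
      rw [zero_mul] at this
      exact this.mono_left nhdsWithin_le_nhds
    have hle : |d n| * r ^ (n + 1) ≤ 0 := by
      refine ge_of_tendsto hlim ?_
      filter_upwards [Ioc_mem_nhdsGT hr] with t ht using
        abs_coeff_mul_le_of_hasSum_pow ht.1 ht.2 (h t ht.1 ht.2) ih hK
    exact abs_nonpos_iff.1 (nonpos_of_mul_nonpos_left hle (pow_pos hr _))

theorem sum_eq_sum_of_tsum_pow_eq {ι : Type*} {deg : ι → ℕ} {f g : ι → ℝ} {r : ℝ} (hr : 0 < r)
    (hf : ∀ t, 0 < t → t ≤ r → Summable fun i => f i * t ^ deg i)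
    (hg : ∀ t, 0 < t → t ≤ r → Summable fun i => g i * t ^ deg i)
    (h : ∀ t, 0 < t → t ≤ r → ∑' i, f i * t ^ deg i = ∑' i, g i * t ^ deg i)
    {n : ℕ} {S : Finset ι} (hS : ∀ i, i ∈ S ↔ deg i = n) : ∑ i ∈ S, f i = ∑ i ∈ S, g i := by
  have key : ∀ t, 0 < t → t ≤ r →
      HasSum (fun n => (∑' i : deg ⁻¹' {n}, (f i - g i)) * t ^ n) 0 := by
    intro t ht htr
    have h1 : HasSum (fun i => (f i - g i) * t ^ deg i) 0 := by
      have := (hf t ht htr).hasSum.sub (hg t ht htr).hasSum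
      rw [h t ht htr, sub_self] at this
      simpa only [sub_mul] using this
    have h2 : (fun n => (∑' i : deg ⁻¹' {n}, (f i - g i)) * t ^ n) =
        fun n => ∑' i : deg ⁻¹' {n}, (f i - g i) * t ^ deg i := by
      funext k
      rw [← tsum_mul_right]
      exact tsum_congr fun i => by rw [show deg i = k from i.2]
    rw [h2]
    exact h1.tsum_fiberwise deg
  have h2 := eq_zero_of_hasSum_pow hr key n
  have h3 : deg ⁻¹' {n} = (S : Set ι) := by ext i; simp [hS]
  rw [h3, Finset.tsum_subtype' S fun i => f i - g i, Finset.sum_sub_distrib] at h2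
  exact sub_eq_zero.1 h2

/-- If two families of functions satisfy a Cauchy type symmetry, and the functions of the first
family are of different orders of growth along some curve, the second family being dominated by
the first, then the two families are proportional. -/
theorem mul_eq_mul_of_symm {ι X : Type*} {s R : ι → X → ℝ} {e : ι → ℕ} {γ : ℕ → X}
    (S : Finset ι) (hinj : Set.InjOn e S)
    (hs : ∀ i ∈ S, ∀ j ∈ S, e i < e j →
      (fun t => s i (γ t)) =o[atTop] fun t => s j (γ t))
    (hne : ∀ i ∈ S, ∃ᶠ t in atTop, s i (γ t) ≠ 0)
    (hR : ∀ i ∈ S, (fun t => R i (γ t)) =O[atTop] fun t => s i (γ t))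
    {x₀ : X} (hx₀ : ∀ i ∈ S, s i x₀ ≠ 0)
    (hsymm : ∀ x b, ∑ i ∈ S, s i b * R i x = ∑ i ∈ S, s i x * R i b) :
    ∀ i ∈ S, ∀ x, R i x * s i x₀ = s i x * R i x₀ := by
  classical
  induction S using Finset.induction_on_max_value e with
  | empty => simp
  | insert j S hj hmax ih =>
    have hlt : ∀ i ∈ S, e i < e j := fun i hi =>
      lt_of_le_of_ne (hmax i hi) fun h =>
        hj (hinj (Finset.mem_insert_self j S) (Finset.mem_insert_of_mem hi) h.symm ▸ hi)
    have hrest : ∀ x, (fun t => s j (γ t) * R j x - s j x * R j (γ t)) =o[atTop]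
        fun t => s j (γ t) := by
      intro x
      have h1 : (fun t => s j (γ t) * R j x - s j x * R j (γ t)) =
          fun t => ∑ i ∈ S, (s i x * R i (γ t) - s i (γ t) * R i x) := by
        funext t
        have := hsymm x (γ t)
        rw [Finset.sum_insert hj, Finset.sum_insert hj] at this
        rw [Finset.sum_sub_distrib]
        linarith
      rw [h1]
      refine Asymptotics.IsLittleO.fun_sum fun i hi => ?_
      have h2 := hs i (Finset.mem_insert_of_mem hi) j (Finset.mem_insert_self j S) (hlt i hi)
      refine Asymptotics.IsLittleO.sub ?_ ?_
      · exact ((hR i (Finset.mem_insert_of_mem hi)).trans_isLittleO h2).const_mul_left _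
      · simp only [mul_comm _ (R i x)]
        exact h2.const_mul_left _
    have hj0 : ∀ x, R j x * s j x₀ = s j x * R j x₀ := by
      intro x
      have h1 := ((hrest x).const_mul_left (s j x₀)).sub ((hrest x₀).const_mul_left (s j x))
      have h2 : (fun t => s j x₀ * (s j (γ t) * R j x - s j x * R j (γ t)) -
          s j x * (s j (γ t) * R j x₀ - s j x₀ * R j (γ t))) =
          fun t => (R j x * s j x₀ - s j x * R j x₀) * s j (γ t) := by
        funext t; ring
      rw [h2] at h1
      by_contra hD
      have h3 := (Asymptotics.isLittleO_const_mul_left_iff (sub_ne_zero.2 hD)).1 h1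
      exact Asymptotics.isLittleO_irrefl (hne j (Finset.mem_insert_self j S)) h3
    have hx0 := hx₀ j (Finset.mem_insert_self j S)
    intro i hi
    rcases Finset.mem_insert.1 hi with rfl | hi
    · exact hj0
    refine ih (hinj.mono (by simp)) (fun i hi k hk => hs i (Finset.mem_insert_of_mem hi) k
      (Finset.mem_insert_of_mem hk)) (fun i hi => hne i (Finset.mem_insert_of_mem hi))
      (fun i hi => hR i (Finset.mem_insert_of_mem hi))
      (fun i hi => hx₀ i (Finset.mem_insert_of_mem hi)) (fun x b => ?_) i hi
    have h1 := hsymm x b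
    rw [Finset.sum_insert hj, Finset.sum_insert hj] at h1
    have h2 : s j b * R j x = s j x * R j b := by
      have e1 := hj0 x
      have e2 := hj0 b
      refine mul_right_cancel₀ hx0 ?_
      linear_combination s j b * e1 - s j x * e2
    linarith

/-! ### Weights of shapes -/

theorem finite_card_eq (n : ℕ) : {μ : YoungDiagram | μ.card = n}.Finite := by
  refine Set.Finite.of_injOn (f := fun μ : YoungDiagram => μ.cells)
    (t := ((Finset.range n ×ˢ Finset.range n).powerset : Set (Finset (ℕ × ℕ)))) ?_ ?_
    (Finset.finite_toSet _)
  · intro μ hμ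
    have hμ' : μ.card = n := hμ
    simp only [Finset.coe_powerset, Set.mem_preimage, Set.mem_powerset_iff]
    intro c hc
    have hc' : (c.1, c.2) ∈ μ := hc
    have h1 : c.2 < n := by
      have h := YoungDiagram.mem_iff_lt_rowLen.1 hc'
      rw [YoungDiagram.rowLen_eq_card] at h
      exact h.trans_le (hμ' ▸ Finset.card_le_card (Finset.filter_subset _ _))
    have h2 : c.1 < n := by
      have h := YoungDiagram.mem_iff_lt_colLen.1 hc'
      rw [YoungDiagram.colLen_eq_card] at h
      exact h.trans_le (hμ' ▸ Finset.card_le_card (Finset.filter_subset _ _))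
    simp [h1, h2]
  · intro μ _ ν _ h
    exact YoungDiagram.ext h

theorem sum_cells_eq {N : ℕ} {μ : YoungDiagram} (hμ : μ.rowLen N = 0) (g : ℕ → ℕ) :
    ∑ c ∈ μ.cells, g c.1 = ∑ i : Fin N, μ.rowLen i * g i := by
  rw [Fin.sum_univ_eq_sum_range fun i => μ.rowLen i * g i,
    ← Finset.sum_fiberwise_of_maps_to (t := Finset.range N) (g := fun c : ℕ × ℕ => c.1)]
  · refine Finset.sum_congr rfl fun i _ => ?_
    rw [YoungDiagram.rowLen_eq_card, ← smul_eq_mul, YoungDiagram.row, ← Finset.sum_const]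
    exact Finset.sum_congr rfl fun c hc => by rw [(Finset.mem_filter.1 hc).2]
  · intro c hc
    have h := YoungDiagram.mem_iff_lt_rowLen.1 (show (c.1, c.2) ∈ μ from hc)
    rw [Finset.mem_range]
    by_contra! hN
    rw [rowLen_eq_zero_of_le hμ hN] at h
    omega

/-- The exponent of `t` in the leading term of `schur μ` along the curve `growthCurve`. -/
def growthExponent (N n : ℕ) (μ : YoungDiagram) : ℕ := ∑ c ∈ μ.cells, (n + 1) ^ (N - 1 - c.1)

theorem growthExponent_injOn (N n : ℕ) :
    Set.InjOn (growthExponent N n) {μ | μ.card = n ∧ μ.rowLen N = 0} := by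
  have hlt : ∀ μ : YoungDiagram, μ.card = n → ∀ i, μ.rowLen i < n + 1 := by
    rintro μ rfl i
    rw [YoungDiagram.rowLen_eq_card]
    exact Nat.lt_succ_of_le (Finset.card_le_card (Finset.filter_subset _ _))
  have hval : ∀ μ : YoungDiagram, ∀ h : μ.card = n ∧ μ.rowLen N = 0, growthExponent N n μ =
      (finFunctionFinEquiv
        fun i : Fin N => (⟨μ.rowLen i.rev, hlt μ h.1 i.rev⟩ : Fin (n + 1)) : ℕ) := by
    intro μ h
    rw [growthExponent, sum_cells_eq h.2 fun k => (n + 1) ^ (N - 1 - k), finFunctionFinEquiv_apply,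
      ← Equiv.sum_comp Fin.revPerm]
    refine Finset.sum_congr rfl fun i _ => ?_
    simp only [Fin.revPerm_apply, Fin.val_rev]
    congr 2
    omega
  intro μ hμ ν hν h
  rw [hval μ hμ, hval ν hν] at h
  have h1 := finFunctionFinEquiv.injective (Fin.ext h)
  refine eq_of_rowLen fun i => ?_
  rcases lt_or_ge i N with hi | hi
  · have := congrArg Fin.val (congrFun h1 (Fin.rev ⟨i, hi⟩))
    simpa using this
  · rw [rowLen_eq_zero_of_le hμ.2 hi, rowLen_eq_zero_of_le hν.2 hi]

/-- A curve of antitone vectors along which Schur polynomials grow at different rates. -/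
def growthCurve (N n : ℕ) (t : ℕ) (i : Fin N) : ℝ := (t : ℝ) ^ (n + 1) ^ (N - 1 - (i : ℕ))

theorem growthCurve_nonneg (N n t : ℕ) (i : Fin N) : 0 ≤ growthCurve N n t i := by
  unfold growthCurve; positivity

theorem antitone_growthCurve (N n : ℕ) {t : ℕ} (ht : 1 ≤ t) : Antitone (growthCurve N n t) := by
  intro i j hij
  refine pow_le_pow_right₀ (by exact_mod_cast ht) (Nat.pow_le_pow_right (by omega) ?_)
  have : (i : ℕ) ≤ j := hij
  omega

theorem prod_extendZero_growthCurve {N n t : ℕ} {μ : YoungDiagram} (hμ : μ.rowLen N = 0) :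
    ∏ c ∈ μ.cells, extendZero (growthCurve N n t) c.1 = (t : ℝ) ^ growthExponent N n μ := by
  rw [growthExponent, ← Finset.prod_pow_eq_pow_sum]
  refine Finset.prod_congr rfl fun c hc => ?_
  have h := YoungDiagram.mem_iff_lt_rowLen.1 (show (c.1, c.2) ∈ μ from hc)
  have hN : c.1 < N := by
    by_contra! hN
    rw [rowLen_eq_zero_of_le hμ hN] at h
    omega
  rw [extendZero, dif_pos hN, growthCurve]

theorem schur_growthCurve_isLittleO {N n : ℕ} {μ ν : YoungDiagram} (hμ : μ.rowLen N = 0)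
    (hν : ν.rowLen N = 0) (h : growthExponent N n μ < growthExponent N n ν) :
    (fun t => schur μ (growthCurve N n t)) =o[atTop] fun t => schur ν (growthCurve N n t) := by
  have h1 : (fun t => schur μ (growthCurve N n t)) =O[atTop]
      fun t : ℕ => (t : ℝ) ^ growthExponent N n μ := by
    refine Asymptotics.IsBigO.of_bound ((tableaux N μ).card : ℝ) ?_
    filter_upwards [eventually_ge_atTop 1] with t ht
    have := schur_le μ (growthCurve_nonneg N n t) (antitone_growthCurve N n ht)
    rw [prod_extendZero_growthCurve hμ] at this
    rw [Real.norm_of_nonneg (schur_nonneg μ (growthCurve_nonneg N n t)),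
      Real.norm_of_nonneg (by positivity)]
    exact this
  have h2 : (fun t : ℕ => (t : ℝ) ^ growthExponent N n ν) =O[atTop]
      fun t => schur ν (growthCurve N n t) := by
    refine Asymptotics.IsBigO.of_bound 1 (Eventually.of_forall fun t => ?_)
    have := le_schur hν (growthCurve_nonneg N n t)
    rw [prod_extendZero_growthCurve hν] at this
    rw [Real.norm_of_nonneg (schur_nonneg ν (growthCurve_nonneg N n t)),
      Real.norm_of_nonneg (by positivity), one_mul]
    exact this
  exact h1.trans_isLittleO (((Asymptotics.isLittleO_pow_pow_atTop_of_lt h).comp_tendsto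
    tendsto_natCast_atTop_atTop).trans_isBigO h2)

/-! ### Averages of Schur polynomials over the unitary group -/

theorem isSymm_schur {N : ℕ} (μ : YoungDiagram) : IsSymm (schur μ : (Fin N → ℝ) → ℝ) :=
  fun x σ => schur_comp_perm μ x σ

theorem continuous_conjDiag {N : ℕ} (x : Fin N → ℝ) :
    Continuous fun U : Matrix.unitaryGroup (Fin N) ℂ => conjDiag U x :=
  Continuous.subtype_mk ((continuous_subtype_val.matrix_mul continuous_const).matrix_mul
    continuous_subtype_val.star) _

theorem continuous_compress {N : ℕ} (a x : Fin N → ℝ) :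
    Continuous fun U : Matrix.unitaryGroup (Fin N) ℂ => compress a U x :=
  Continuous.subtype_mk ((continuous_const.matrix_mul (continuous_subtype_val.comp
    (continuous_conjDiag x))).matrix_mul continuous_const) _

theorem integrable_unitaryHaar {N : ℕ} {f : Matrix.unitaryGroup (Fin N) ℂ → ℝ}
    (hf : Continuous f) : Integrable f (unitaryHaar N) :=
  hf.integrable_of_hasCompactSupport (HasCompactSupport.of_compactSpace f)

/-- The average over the unitary group of `s_μ(diag(√a) U diag(x) U* diag(√a))`. -/
def sphericalMean {N : ℕ} (μ : YoungDiagram) (a x : Fin N → ℝ) : ℝ :=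
  ∫ U, schur μ (compress a U x).2.eigenvalues ∂unitaryHaar N

theorem continuous_schur_compress {N : ℕ} (μ : YoungDiagram) (a x : Fin N → ℝ) :
    Continuous fun U : Matrix.unitaryGroup (Fin N) ℂ => schur μ (compress a U x).2.eigenvalues :=
  (continuous_symm_eigenvalues (continuous_schur μ) (isSymm_schur μ)).comp (continuous_compress a x)

theorem sphericalMean_nonneg {N : ℕ} (μ : YoungDiagram) (a : Fin N → ℝ) {x : Fin N → ℝ}
    (hx : ∀ i, 0 ≤ x i) : 0 ≤ sphericalMean μ a x :=
  integral_nonneg fun U => schur_nonneg μ (eigenvalues_compress_nonneg a hx U)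

theorem sphericalMean_le {N : ℕ} {μ : YoungDiagram} {a x : Fin N → ℝ} {K : ℝ}
    (h : ∀ U, schur μ (compress a U x).2.eigenvalues ≤ K) : sphericalMean μ a x ≤ K := by
  refine (integral_mono (integrable_unitaryHaar (continuous_schur_compress μ a x))
    (integrable_const K) h).trans ?_
  simp

theorem ofReal_mul_sphericalMean {N : ℕ} (μ : YoungDiagram) (a : Fin N → ℝ) {x : Fin N → ℝ}
    {s : ℝ} (hs : 0 ≤ s) (hx : ∀ i, 0 ≤ x i) :
    ENNReal.ofReal (s * sphericalMean μ a x) =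
      ∫⁻ U, ENNReal.ofReal (s * schur μ (compress a U x).2.eigenvalues) ∂unitaryHaar N := by
  rw [sphericalMean, ← integral_const_mul, ofReal_integral_eq_lintegral_ofReal]
  · exact (integrable_unitaryHaar (continuous_schur_compress μ a x)).const_mul s
  · exact Eventually.of_forall fun U =>
      mul_nonneg hs (schur_nonneg μ (eigenvalues_compress_nonneg a hx U))

theorem gaussAverage_eq_tsum {N : ℕ} {a x b : Fin N → ℝ} (hx : ∀ i, 0 ≤ x i)
    (hb : ∀ i, 0 ≤ b i) (h : ∀ U i j, (compress a U x).2.eigenvalues i * b j < 1) :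
    gaussAverage a x b = ENNReal.ofReal (∏ _i : Fin N, ∏ _j : Fin N, Real.pi) *
      ∑' μ, ENNReal.ofReal (schur μ b * sphericalMean μ a x) := by
  have h1 : ∀ U : Matrix.unitaryGroup (Fin N) ℂ, ∫⁻ Z : Fin N × Fin N → ℂ,
      ENNReal.ofReal (gaussWeight Z *
        Real.exp ((compress a U x).1 * mat Z * dg b * star (mat Z)).trace.re) =
      ENNReal.ofReal (∏ _i : Fin N, ∏ _j : Fin N, Real.pi) *
        ∑' μ, ENNReal.ofReal (schur μ b * schur μ (compress a U x).2.eigenvalues) := by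
    intro U
    rw [lintegral_gauss_hermitian _ (h U)]
    have h2 := hasSum_cauchy (eigenvalues_compress_nonneg a hx U) hb (h U)
    rw [← h2.tsum_eq, ENNReal.ofReal_tsum_of_nonneg _ h2.summable]
    exact fun μ => mul_nonneg (schur_nonneg μ hb)
      (schur_nonneg μ (eigenvalues_compress_nonneg a hx U))
  have hm : ∀ μ : YoungDiagram, Measurable fun U : Matrix.unitaryGroup (Fin N) ℂ =>
      ENNReal.ofReal (schur μ b * schur μ (compress a U x).2.eigenvalues) := fun μ =>
    (ENNReal.continuous_ofReal.comp
      (continuous_const.mul (continuous_schur_compress μ a x))).measurable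
  have hcount : Countable YoungDiagram :=
    Function.Injective.countable (f := YoungDiagram.cells) fun μ ν h => YoungDiagram.ext h
  rw [gaussAverage]
  simp only [h1]
  rw [lintegral_const_mul _ (Measurable.tsum hm), lintegral_tsum fun μ =>
    (hm μ).aemeasurable]
  congr 1
  exact tsum_congr fun μ => (ofReal_mul_sphericalMean μ a (schur_nonneg μ hb) hx).symm

theorem gaussAverage_smul {N : ℕ} (a x b : Fin N → ℝ) (t : ℝ) :
    gaussAverage a (fun i => t * x i) b = gaussAverage a x fun i => t * b i := by
  refine lintegral_congr fun U => lintegral_congr fun Z => ?_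
  rw [trace_compress_mul, trace_compress_mul, dg_smul, dg_smul]
  simp only [Matrix.smul_mul, Matrix.mul_smul]

theorem summable_schur_mul_sphericalMean {N : ℕ} {a x b : Fin N → ℝ} {α c : ℝ}
    (ha : ∀ i, 0 ≤ a i) (haα : ∀ i, a i ≤ α) (hα : 0 ≤ α) (hx : ∀ i, 0 ≤ x i)
    (hxc : ∀ i, x i ≤ c) (hc : 0 ≤ c) (hb : ∀ i, 0 ≤ b i) (h : ∀ j, α * c * b j < 1) :
    Summable fun μ => schur μ b * sphericalMean μ a x := by
  refine Summable.of_nonneg_of_le (fun μ => mul_nonneg (schur_nonneg μ hb)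
    (sphericalMean_nonneg μ a hx)) (fun μ => ?_)
    (hasSum_cauchy (x := fun _ => α * c) (fun _ => mul_nonneg hα hc) hb fun _ => h).summable
  refine mul_le_mul_of_nonneg_left (sphericalMean_le fun U => ?_) (schur_nonneg μ hb)
  exact schur_mono μ (eigenvalues_compress_nonneg a hx U)
    (eigenvalues_compress_le ha haα hc hxc U)

theorem tsum_schur_mul_sphericalMean_comm {N : ℕ} {a x b : Fin N → ℝ} {α c t : ℝ}
    (ha : ∀ i, 0 ≤ a i) (haα : ∀ i, a i ≤ α) (hα : 0 ≤ α) (hx : ∀ i, 0 ≤ x i)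
    (hxc : ∀ i, x i ≤ c) (hc : 0 ≤ c) (hb : ∀ i, 0 ≤ b i) (hbc : ∀ i, b i ≤ c)
    (ht : 0 ≤ t) (h : α * c * (t * c) < 1) :
    ∑' μ, schur μ (fun i => t * b i) * sphericalMean μ a x =
      ∑' μ, schur μ (fun i => t * x i) * sphericalMean μ a b := by
  have key : ∀ x b : Fin N → ℝ, (∀ i, 0 ≤ x i) → (∀ i, x i ≤ c) → (∀ i, 0 ≤ b i) →
      (∀ i, b i ≤ c) → gaussAverage a x (fun i => t * b i) =
        ENNReal.ofReal (∏ _i : Fin N, ∏ _j : Fin N, Real.pi) *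
          ENNReal.ofReal (∑' μ, schur μ (fun i => t * b i) * sphericalMean μ a x) := by
    intro x b hx hxc hb hbc
    have htb : ∀ i, 0 ≤ t * b i := fun i => mul_nonneg ht (hb i)
    have hlt : ∀ j, α * c * (t * b j) < 1 := fun j => lt_of_le_of_lt
      (mul_le_mul_of_nonneg_left (mul_le_mul_of_nonneg_left (hbc j) ht) (mul_nonneg hα hc)) h
    rw [gaussAverage_eq_tsum hx htb fun U i j => lt_of_le_of_lt
      (mul_le_mul_of_nonneg_right (eigenvalues_compress_le ha haα hc hxc U i) (htb j)) (hlt j),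
      ENNReal.ofReal_tsum_of_nonneg (fun μ => mul_nonneg (schur_nonneg μ htb)
        (sphericalMean_nonneg μ a hx))
        (summable_schur_mul_sphericalMean ha haα hα hx hxc hc htb hlt)]
  have h1 : gaussAverage a x (fun i => t * b i) = gaussAverage a b fun i => t * x i := by
    rw [← gaussAverage_smul, gaussAverage_comm]
  rw [key x b hx hxc hb hbc, key b x hb hbc hx hxc] at h1
  have hpi : 0 < ∏ _i : Fin N, ∏ _j : Fin N, Real.pi :=
    Finset.prod_pos fun _ _ => Finset.prod_pos fun _ _ => Real.pi_pos
  have h2 := (ENNReal.mul_right_inj (ENNReal.ofReal_pos.2 hpi).ne' ENNReal.ofReal_ne_top).1 h1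
  refine (ENNReal.ofReal_eq_ofReal_iff ?_ ?_).1 h2
  · exact tsum_nonneg fun μ => mul_nonneg (schur_nonneg μ fun i => mul_nonneg ht (hb i))
      (sphericalMean_nonneg μ a hx)
  · exact tsum_nonneg fun μ => mul_nonneg (schur_nonneg μ fun i => mul_nonneg ht (hx i))
      (sphericalMean_nonneg μ a hb)

theorem exists_bound {N : ℕ} (x : Fin N → ℝ) : ∃ c, 0 < c ∧ ∀ i, x i ≤ c := by
  refine ⟨1 + ∑ i, |x i|, by positivity, fun i => ?_⟩
  have := Finset.single_le_sum (f := fun i => |x i|) (fun _ _ => abs_nonneg _) (Finset.mem_univ i)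
  have h2 := le_abs_self (x i)
  linarith

theorem sum_schur_mul_sphericalMean_comm {N : ℕ} {a x b : Fin N → ℝ}
    (ha : ∀ i, 0 ≤ a i) (hx : ∀ i, 0 ≤ x i) (hb : ∀ i, 0 ≤ b i) (n : ℕ) :
    ∑ μ ∈ (finite_card_eq n).toFinset, schur μ b * sphericalMean μ a x =
      ∑ μ ∈ (finite_card_eq n).toFinset, schur μ x * sphericalMean μ a b := by
  obtain ⟨α, hα, haα⟩ := exists_bound a
  obtain ⟨c₁, hc₁, hxc₁⟩ := exists_bound x
  obtain ⟨c₂, hc₂, hbc₂⟩ := exists_bound b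
  obtain ⟨c, hc, hxc, hbc⟩ : ∃ c, 0 < c ∧ (∀ i, x i ≤ c) ∧ ∀ i, b i ≤ c :=
    ⟨max c₁ c₂, lt_max_of_lt_left hc₁, fun i => (hxc₁ i).trans (le_max_left _ _),
      fun i => (hbc₂ i).trans (le_max_right _ _)⟩
  have hK : 0 < α * c * c := by positivity
  have hr : 0 < (2 * (α * c * c))⁻¹ := by positivity
  have hsmall : ∀ t, t ≤ (2 * (α * c * c))⁻¹ → α * c * (t * c) < 1 := by
    intro t ht
    have h1 : t * (2 * (α * c * c)) ≤ 1 := by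
      have := mul_le_mul_of_nonneg_right ht (by positivity : (0 : ℝ) ≤ 2 * (α * c * c))
      rwa [inv_mul_cancel₀ (by positivity)] at this
    nlinarith
  have hsum : ∀ x b : Fin N → ℝ, (∀ i, 0 ≤ x i) → (∀ i, x i ≤ c) → (∀ i, 0 ≤ b i) →
      (∀ i, b i ≤ c) → ∀ t, 0 < t → t ≤ (2 * (α * c * c))⁻¹ →
      Summable fun μ => schur μ b * sphericalMean μ a x * t ^ μ.card := by
    intro x b hx hxc hb hbc t ht htr
    have h1 := summable_schur_mul_sphericalMean (b := fun i => t * b i) ha haα hα.le hx hxc hc.le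
      (fun i => mul_nonneg ht.le (hb i)) fun j => lt_of_le_of_lt
      (mul_le_mul_of_nonneg_left (mul_le_mul_of_nonneg_left (hbc j) ht.le)
        (mul_nonneg hα.le hc.le)) (hsmall t htr)
    refine h1.congr fun μ => ?_
    rw [schur_smul]
    ring
  refine sum_eq_sum_of_tsum_pow_eq (deg := YoungDiagram.card) hr (hsum x b hx hxc hb hbc)
    (hsum b x hb hbc hx hxc) (fun t ht htr => ?_) (n := n) fun μ => by simp
  have h1 := tsum_schur_mul_sphericalMean_comm ha haα hα.le hx hxc hc.le hb hbc ht.le (hsmall t htr)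
  simp only [schur_smul] at h1
  simpa only [mul_comm, mul_left_comm, mul_assoc] using h1

theorem sphericalMean_mul_schur_one_eq {N : ℕ} {μ : YoungDiagram} (hμ : μ.rowLen N = 0)
    {a x : Fin N → ℝ} (ha : ∀ i, 0 ≤ a i) (hx : ∀ i, 0 ≤ x i) :
    sphericalMean μ a x * schur μ (fun _ : Fin N => 1) =
      schur μ x * sphericalMean μ a (fun _ => 1) := by
  classical
  obtain ⟨α, hα, haα⟩ := exists_bound a
  set n := μ.card with hn
  have hmem : ∀ ν, ν ∈ (finite_card_eq n).toFinset.filter (fun ν => ν.rowLen N = 0) ↔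
      ν.card = n ∧ ν.rowLen N = 0 := fun ν => by simp
  have key := mul_eq_mul_of_symm (X := {x : Fin N → ℝ // ∀ i, 0 ≤ x i})
    (s := fun ν x => schur ν x.1) (R := fun ν x => sphericalMean ν a x.1)
    (e := growthExponent N n) (γ := fun t => ⟨growthCurve N n t, growthCurve_nonneg N n t⟩)
    ((finite_card_eq n).toFinset.filter fun ν => ν.rowLen N = 0) ?_ ?_ ?_ ?_
    (x₀ := ⟨fun _ => 1, fun _ => zero_le_one⟩) ?_ ?_ μ ((hmem μ).2 ⟨hn.symm, hμ⟩) ⟨x, hx⟩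
  · exact key
  · exact (growthExponent_injOn N n).mono fun ν hν => (hmem ν).1 hν
  · exact fun ν hν ν' hν' h => schur_growthCurve_isLittleO ((hmem ν).1 hν).2 ((hmem ν').1 hν').2 h
  · intro ν hν
    refine Eventually.frequently ?_
    filter_upwards [eventually_ge_atTop 1] with t ht
    have h1 := le_schur ((hmem ν).1 hν).2 (growthCurve_nonneg N n t)
    rw [prod_extendZero_growthCurve ((hmem ν).1 hν).2] at h1
    have h2 : (0 : ℝ) < t := by exact_mod_cast ht
    exact (lt_of_lt_of_le (pow_pos h2 _) h1).ne'
  · intro ν hν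
    refine Asymptotics.IsBigO.of_bound (α ^ ν.card) ?_
    filter_upwards [eventually_ge_atTop 1] with t ht
    rw [Real.norm_of_nonneg (sphericalMean_nonneg ν a (growthCurve_nonneg N n t)),
      Real.norm_of_nonneg (schur_nonneg ν (growthCurve_nonneg N n t))]
    exact sphericalMean_le fun U => schur_compress_le ν ha haα (growthCurve_nonneg N n t)
      (antitone_growthCurve N n ht) U
  · exact fun ν hν => (schur_one_pos ((hmem ν).1 hν).2).ne'
  · intro y b
    have h1 := sum_schur_mul_sphericalMean_comm ha y.2 b.2 n
    rw [Finset.sum_filter_of_ne, Finset.sum_filter_of_ne]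
    · exact h1
    all_goals
      intro ν _ h2
      by_contra h3
      exact h2 (by simp only [schur_eq_zero h3, zero_mul])

theorem compress_one {N : ℕ} {a : Fin N → ℝ} (ha : ∀ i, 0 ≤ a i)
    (U : Matrix.unitaryGroup (Fin N) ℂ) : compress a U (fun _ => 1) = conjDiag 1 a := by
  refine Subtype.ext ?_
  have hGs : star (dg fun i => Real.sqrt (a i)) = dg fun i => Real.sqrt (a i) := isHermitian_dg _
  have h1 : (dg fun _ : Fin N => (1 : ℝ)) = 1 := by simp [dg]
  have h2 : dg (fun i => Real.sqrt (a i)) * dg (fun i => Real.sqrt (a i)) = dg a := by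
    rw [dg_mul]
    congr 1
    funext i
    exact Real.mul_self_sqrt (ha i)
  simp only [compress, conjDiag, h1, mul_one, unitary_mul_star, hGs, h2]
  simp

theorem sphericalMean_mul_schur_one {N : ℕ} (μ : YoungDiagram)
    {a x : Fin N → ℝ} (ha : ∀ i, 0 ≤ a i) (hx : ∀ i, 0 ≤ x i) :
    sphericalMean μ a x * schur μ (fun _ : Fin N => 1) = schur μ x * schur μ a := by
  by_cases hμ : μ.rowLen N = 0
  · rw [sphericalMean_mul_schur_one_eq hμ ha hx]
    have h : ∀ U, schur μ (compress a U fun _ => 1).2.eigenvalues = schur μ a := by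
      intro U
      rw [compress_one ha]
      exact (isSymm_schur μ).eigenvalues_conjDiag _ _
    simp [sphericalMean, h]
  · rw [schur_eq_zero hμ, schur_eq_zero hμ, mul_zero, zero_mul]

/-! ### The Harish-Chandra integral -/

/-- The integral `∫ exp (tr (U diag(x) U* diag(y))) dU`. -/
def unitaryIntegral {N : ℕ} (x y : Fin N → ℝ) : ℝ :=
  ∫ U, Real.exp ((conjDiag U x).1 * dg y).trace.re ∂unitaryHaar N

theorem trace_compress {N : ℕ} {x y : Fin N → ℝ} (hy : ∀ i, 0 ≤ y i)
    (U : Matrix.unitaryGroup (Fin N) ℂ) :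
    (compress y U x).1.trace = ((conjDiag U x).1 * dg y).trace := by
  have hGs : star (dg fun i => Real.sqrt (y i)) = dg fun i => Real.sqrt (y i) := isHermitian_dg _
  have h2 : dg (fun i => Real.sqrt (y i)) * dg (fun i => Real.sqrt (y i)) = dg y := by
    rw [dg_mul]
    congr 1
    funext i
    exact Real.mul_self_sqrt (hy i)
  change (dg (fun i => Real.sqrt (y i)) * (conjDiag U x).1 *
    star (dg fun i => Real.sqrt (y i))).trace = _
  rw [hGs, mul_assoc, Matrix.trace_mul_comm, mul_assoc, h2]

theorem hasSum_exp_trace {N : ℕ} {x y : Fin N → ℝ} (hx : ∀ i, 0 ≤ x i) (hy : ∀ i, 0 ≤ y i)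
    (U : Matrix.unitaryGroup (Fin N) ℂ) :
    HasSum (fun μ => expCoeff N μ * schur μ (compress y U x).2.eigenvalues)
      (Real.exp ((conjDiag U x).1 * dg y).trace.re) := by
  have h := hasSum_exp (eigenvalues_compress_nonneg y hx U)
  have h1 : ((conjDiag U x).1 * dg y).trace.re = ∑ i, (compress y U x).2.eigenvalues i := by
    rw [← trace_compress hy, (compress y U x).2.trace_eq_sum_eigenvalues]
    simp
  rwa [h1]

theorem hasSum_unitaryIntegral {N : ℕ} {x y : Fin N → ℝ} (hx : ∀ i, 0 ≤ x i)
    (hy : ∀ i, 0 ≤ y i) :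
    HasSum (fun μ => expCoeff N μ * sphericalMean μ y x) (unitaryIntegral x y) := by
  obtain ⟨α, hα, hyα⟩ := exists_bound y
  obtain ⟨c, hc, hxc⟩ := exists_bound x
  have hcount : Countable YoungDiagram :=
    Function.Injective.countable (f := YoungDiagram.cells) fun μ ν h => YoungDiagram.ext h
  have h0 : ∀ μ U, 0 ≤ expCoeff N μ * schur μ (compress y U x).2.eigenvalues := fun μ U =>
    mul_nonneg (expCoeff_nonneg N μ) (schur_nonneg μ (eigenvalues_compress_nonneg y hx U))
  have hint : ∀ μ, Integrable (fun U => expCoeff N μ * schur μ (compress y U x).2.eigenvalues)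
      (unitaryHaar N) := fun μ =>
    (integrable_unitaryHaar (continuous_schur_compress μ y x)).const_mul _
  have hval : ∀ μ, ∫ U, expCoeff N μ * schur μ (compress y U x).2.eigenvalues ∂unitaryHaar N =
      expCoeff N μ * sphericalMean μ y x := fun μ => integral_const_mul _ _
  have hs : Summable fun μ => expCoeff N μ * sphericalMean μ y x := by
    refine Summable.of_nonneg_of_le (fun μ => mul_nonneg (expCoeff_nonneg N μ)
      (sphericalMean_nonneg μ y hx)) (fun μ => ?_)
      (hasSum_exp (N := N) (x := fun _ => α * c) fun _ => (mul_pos hα hc).le).summable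
    refine mul_le_mul_of_nonneg_left (sphericalMean_le fun U => ?_) (expCoeff_nonneg N μ)
    exact schur_mono μ (eigenvalues_compress_nonneg y hx U)
      (eigenvalues_compress_le hy hyα hc.le hxc U)
  have h1 := hasSum_integral_of_summable_integral_norm hint (by
    refine hs.congr fun μ => ?_
    rw [← hval]
    exact integral_congr_ae (Eventually.of_forall fun U => (Real.norm_of_nonneg (h0 μ U)).symm))
  simp only [hval, (hasSum_exp_trace hx hy _).tsum_eq] at h1
  exact h1

theorem unitaryIntegral_mul_of_nonneg {N : ℕ} {x y : Fin N → ℝ} (hx : ∀ i, 0 ≤ x i)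
    (hy : ∀ i, 0 ≤ y i) :
    unitaryIntegral x y * ((Matrix.vandermonde x).det * (Matrix.vandermonde y).det) =
      weylConst N * (Matrix.of fun i j => Real.exp (x i * y j)).det := by
  refine ((hasSum_unitaryIntegral hx hy).mul_right _).unique ?_
  refine hasSum_congr_of_eq ((hasSum_det_exp x y).mul_left (weylConst N)) fun μ => ?_
  by_cases hμ : μ.rowLen N = 0
  · rw [← sphericalMean_mul_schur_one μ hy hx, expCoeff, ← weylConst_mul_schur_one hμ]
    ring
  · rw [schur_eq_zero hμ]
    simp [sphericalMean, schur_eq_zero hμ]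

theorem unitaryIntegral_add_right {N : ℕ} (x y : Fin N → ℝ) (t : ℝ) :
    unitaryIntegral x (fun i => y i + t) = Real.exp (t * ∑ i, x i) * unitaryIntegral x y := by
  rw [unitaryIntegral, unitaryIntegral, ← integral_const_mul]
  congr 1
  funext U
  rw [← Real.exp_add]
  congr 1
  have h1 : dg (fun i => y i + t) = dg y + (t : ℂ) • (1 : Matrix (Fin N) (Fin N) ℂ) := by
    ext i j
    by_cases h : i = j
    · subst h; simp [dg]
    · simp [dg, h]
  have h2 : (conjDiag U x).1.trace = ((∑ i, x i : ℝ) : ℂ) := by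
    change (U.1 * dg x * star U.1).trace = _
    rw [mul_assoc, Matrix.trace_mul_comm, mul_assoc, unitary_star_mul, mul_one]
    simp [dg, Matrix.trace_diagonal]
  rw [h1, mul_add, Matrix.trace_add, Matrix.mul_smul, mul_one, Matrix.trace_smul, h2]
  simp only [Complex.add_re, smul_eq_mul, ← Complex.ofReal_mul, Complex.ofReal_re]
  ring

theorem unitaryIntegral_add_left {N : ℕ} (x y : Fin N → ℝ) (t : ℝ) :
    unitaryIntegral (fun i => x i + t) y = Real.exp (t * ∑ i, y i) * unitaryIntegral x y := by
  rw [unitaryIntegral, unitaryIntegral, ← integral_const_mul]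
  congr 1
  funext U
  rw [← Real.exp_add]
  congr 1
  have h1 : (conjDiag U fun i => x i + t).1 = (conjDiag U x).1 +
      (t : ℂ) • (1 : Matrix (Fin N) (Fin N) ℂ) := by
    have h2 : dg (fun i => x i + t) = dg x + (t : ℂ) • (1 : Matrix (Fin N) (Fin N) ℂ) := by
      ext i j
      by_cases h : i = j
      · subst h; simp [dg]
      · simp [dg, h]
    simp only [conjDiag, h2, mul_add, add_mul, Matrix.mul_smul, Matrix.smul_mul, mul_one,
      unitary_mul_star]
  have h3 : (dg y).trace = ((∑ i, y i : ℝ) : ℂ) := by simp [dg, Matrix.trace_diagonal]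
  rw [h1, add_mul, Matrix.trace_add, Matrix.smul_mul, one_mul, Matrix.trace_smul, h3]
  simp only [Complex.add_re, smul_eq_mul, ← Complex.ofReal_mul, Complex.ofReal_re]
  ring

theorem det_exp_add_right {N : ℕ} (x y : Fin N → ℝ) (t : ℝ) :
    (Matrix.of fun i j => Real.exp (x i * (y j + t))).det =
      Real.exp (t * ∑ i, x i) * (Matrix.of fun i j => Real.exp (x i * y j)).det := by
  rw [Finset.mul_sum, Real.exp_sum, ← Matrix.det_mul_column]
  congr 1
  ext i j
  simp only [Matrix.of_apply]
  rw [← Real.exp_add]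
  congr 1
  ring

theorem det_exp_add_left {N : ℕ} (x y : Fin N → ℝ) (t : ℝ) :
    (Matrix.of fun i j => Real.exp ((x i + t) * y j)).det =
      Real.exp (t * ∑ i, y i) * (Matrix.of fun i j => Real.exp (x i * y j)).det := by
  rw [Finset.mul_sum, Real.exp_sum, ← Matrix.det_mul_row]
  congr 1
  ext i j
  simp only [Matrix.of_apply]
  rw [← Real.exp_add]
  congr 1
  ring

/-- The Harish-Chandra–Itzykson–Zuber formula. -/
theorem unitaryIntegral_mul {N : ℕ} (x y : Fin N → ℝ) :
    unitaryIntegral x y * ((Matrix.vandermonde x).det * (Matrix.vandermonde y).det) =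
      weylConst N * (Matrix.of fun i j => Real.exp (x i * y j)).det := by
  have hV : ∀ (z : Fin N → ℝ) (t : ℝ), (Matrix.vandermonde fun i => z i + t).det =
      (Matrix.vandermonde z).det := fun z t => by
    simp [Matrix.det_vandermonde]
  obtain ⟨s, _, hs⟩ := exists_bound fun i => -x i
  obtain ⟨t, _, ht⟩ := exists_bound fun i => -y i
  have h := unitaryIntegral_mul_of_nonneg (x := fun i => x i + s) (y := fun i => y i + t)
    (fun i => by linarith [hs i]) fun i => by linarith [ht i]
  rw [unitaryIntegral_add_right, unitaryIntegral_add_left, hV, hV,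
    det_exp_add_right (fun i => x i + s), det_exp_add_left] at h
  refine mul_left_cancel₀ (mul_ne_zero (Real.exp_pos (t * ∑ i, (x i + s))).ne'
    (Real.exp_pos (s * ∑ i, y i)).ne') ?_
  linear_combination h

theorem continuous_unitaryIntegral {N : ℕ} (y : Fin N → ℝ) :
    Continuous fun x : Fin N → ℝ => unitaryIntegral x y := by
  have hc : Continuous fun p : (Fin N → ℝ) × Matrix.unitaryGroup (Fin N) ℂ =>
      ((conjDiag p.2 p.1).1 * dg y).trace.re :=
    Complex.continuous_re.comp (Continuous.matrix_trace
      (((((continuous_subtype_val.comp continuous_snd).matrix_mul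
        (continuous_dg.comp continuous_fst)).matrix_mul
          (continuous_subtype_val.comp continuous_snd).star)).matrix_mul continuous_const))
  have h := continuous_parametric_integral_of_continuous (μ := unitaryHaar N)
    (f := fun (x : Fin N → ℝ) U => Real.exp ((conjDiag U x).1 * dg y).trace.re)
    (Real.continuous_exp.comp hc) isCompact_univ
  simp only [Measure.restrict_univ] at h
  exact h

/-! ### The kernel as a normalised Schur polynomial -/

theorem sphericalIntegral_eq {N : ℕ} [NeZero N] (μ : YoungDiagram) (x : Fin N → ℝ) :
    sphericalIntegral x (fun i => (shiftedParts μ i : ℝ) / N) =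
      unitaryIntegral x fun i => (shiftedParts μ i : ℝ) := by
  have h1 : (Matrix.diagonal fun i : Fin N => (((shiftedParts μ i : ℝ) / N : ℝ) : ℂ)) =
      ((N : ℝ)⁻¹ : ℂ) • dg fun i => (shiftedParts μ i : ℝ) := by
    rw [← Complex.ofReal_inv, ← dg_smul]
    simp only [dg, div_eq_inv_mul]
  rw [sphericalIntegral, unitaryIntegral]
  congr 1
  funext U
  congr 1
  rw [h1, Matrix.mul_smul, Matrix.trace_smul, ← Complex.ofReal_inv, smul_eq_mul,
    Complex.re_ofReal_mul, ← mul_assoc, mul_inv_cancel₀ (NeZero.ne (N : ℝ)), one_mul]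
  rfl

theorem posKernel_congr {N : ℕ} {μ ν : YoungDiagram}
    (h : (shiftedParts μ : Fin N → ℕ) = shiftedParts ν) :
    (posKernel μ : (Fin N → ℝ) → ℝ) = posKernel ν := by
  funext x
  simp only [posKernel, h]

theorem logSlope_mul_sub (x y : ℝ) : logSlope x y * (y - x) = Real.log y - Real.log x := by
  rw [logSlope]
  split_ifs with h
  · rw [h]; simp
  · rw [← neg_sub x y, mul_neg, div_mul_cancel₀ _ (sub_ne_zero.2 h), neg_sub]

theorem vandermondeRatio_mul_det {N : ℕ} (x : Fin N → ℝ) :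
    vandermondeRatio x * (Matrix.vandermonde x).det =
      (Matrix.vandermonde fun i => Real.log (x i)).det := by
  rw [Matrix.det_vandermonde, Matrix.det_vandermonde, vandermondeRatio, ← Finset.prod_mul_distrib]
  refine Finset.prod_congr rfl fun i _ => ?_
  rw [← Finset.prod_mul_distrib]
  exact Finset.prod_congr rfl fun j _ => logSlope_mul_sub _ _

theorem posKernel_eq_of_injective {N : ℕ} [NeZero N] {μ : YoungDiagram} (hμ : μ.rowLen N = 0)
    {x : Fin N → ℝ} (hx : ∀ i, 0 < x i) (hinj : Function.Injective x) :
    posKernel μ x = schur μ x / schur μ (fun _ : Fin N => 1) := by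
  have h1 := unitaryIntegral_mul (fun i => Real.log (x i)) fun i => (shiftedParts μ i : ℝ)
  have h2 : (Matrix.of fun i j => Real.exp (Real.log (x i) * (shiftedParts μ j : ℝ))).det =
      schur μ x * (revSign N * (Matrix.vandermonde x).det) := by
    rw [← alternant_bot, schur_mul_alternant hμ, alternant]
    congr 1
    ext i j
    simp only [Matrix.of_apply]
    rw [mul_comm, Real.exp_nat_mul, Real.exp_log (hx i)]
  have hV : (Matrix.vandermonde x).det ≠ 0 := Matrix.det_vandermonde_ne_zero_iff.2 hinj
  have h3 := weylConst_mul_schur_one hμ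
  have h4 : (Matrix.vandermonde fun i : Fin N => (shiftedParts μ i : ℝ)).det =
      revSign N * (weylConst N * schur μ fun _ : Fin N => 1) := by
    rw [h3, ← mul_assoc, revSign_mul_self, one_mul]
  have hs := schur_one_pos hμ
  have hc := weylConst_pos N
  have hr : revSign N ≠ 0 := fun h => by simpa [h] using revSign_mul_self N
  rw [h2, h4, ← vandermondeRatio_mul_det] at h1
  rw [posKernel, sphericalIntegral_eq, eq_div_iff hs.ne']
  refine mul_right_cancel₀ (mul_ne_zero (mul_ne_zero hV hr) hc.ne') ?_
  linear_combination h1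

theorem logSlope_mem_Icc {x y : ℝ} (hx : 0 < x) (hy : 0 < y) :
    logSlope x y ∈ Set.Icc (min x⁻¹ y⁻¹) (max x⁻¹ y⁻¹) := by
  have key : ∀ {x y : ℝ}, 0 < x → 0 < y → x < y →
      (Real.log x - Real.log y) / (x - y) ∈ Set.Icc y⁻¹ x⁻¹ := by
    intro x y hx hy h
    have h0 : 0 < y - x := sub_pos.2 h
    have h1 : (Real.log x - Real.log y) / (x - y) = (Real.log y - Real.log x) / (y - x) := by
      rw [← neg_sub (Real.log y), ← neg_sub y, neg_div_neg_eq]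
    have h2 : Real.log y - Real.log x ≤ x⁻¹ * (y - x) := by
      rw [← Real.log_div hy.ne' hx.ne']
      refine (Real.log_le_sub_one_of_pos (div_pos hy hx)).trans (le_of_eq ?_)
      field_simp
    have h3 : Real.log x - Real.log y ≤ -(y⁻¹ * (y - x)) := by
      rw [← Real.log_div hx.ne' hy.ne']
      refine (Real.log_le_sub_one_of_pos (div_pos hx hy)).trans (le_of_eq ?_)
      field_simp
      ring
    rw [h1]
    exact ⟨(le_div_iff₀ h0).2 (by linarith), (div_le_iff₀ h0).2 h2⟩
  rw [logSlope]
  split_ifs with h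
  · subst h; simp
  · rcases lt_or_gt_of_ne h with h | h
    · have h1 := key hx hy h
      exact ⟨(min_le_right _ _).trans h1.1, h1.2.trans (le_max_left _ _)⟩
    · have h1 := key hy hx h
      rw [← neg_sub (Real.log x), ← neg_sub x, neg_div_neg_eq] at h1
      exact ⟨(min_le_left _ _).trans h1.1, h1.2.trans (le_max_right _ _)⟩

theorem continuousAt_logSlope {p : ℝ × ℝ} (h1 : 0 < p.1) (h2 : 0 < p.2) :
    ContinuousAt (fun q : ℝ × ℝ => logSlope q.1 q.2) p := by
  have hi1 : ContinuousAt (fun q : ℝ × ℝ => q.1⁻¹) p := continuousAt_fst.inv₀ h1.ne'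
  have hi2 : ContinuousAt (fun q : ℝ × ℝ => q.2⁻¹) p := continuousAt_snd.inv₀ h2.ne'
  by_cases h : p.1 = p.2
  · have hmin : Tendsto (fun q : ℝ × ℝ => min q.1⁻¹ q.2⁻¹) (𝓝 p) (𝓝 p.1⁻¹) := by
      have := Filter.Tendsto.min hi1 hi2
      simp only at this
      rwa [← h, min_self] at this
    have hmax : Tendsto (fun q : ℝ × ℝ => max q.1⁻¹ q.2⁻¹) (𝓝 p) (𝓝 p.1⁻¹) := by
      have := Filter.Tendsto.max hi1 hi2
      simp only at this
      rwa [← h, max_self] at this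
    have hpos : ∀ᶠ q : ℝ × ℝ in 𝓝 p, 0 < q.1 ∧ 0 < q.2 :=
      (continuousAt_fst.eventually (lt_mem_nhds h1)).and
        (continuousAt_snd.eventually (lt_mem_nhds h2))
    rw [ContinuousAt, logSlope, if_pos h]
    exact tendsto_of_tendsto_of_tendsto_of_le_of_le' hmin hmax
      (hpos.mono fun q hq => (logSlope_mem_Icc hq.1 hq.2).1)
      (hpos.mono fun q hq => (logSlope_mem_Icc hq.1 hq.2).2)
  · have hne : ∀ᶠ q : ℝ × ℝ in 𝓝 p, q.1 ≠ q.2 :=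
      (isOpen_ne_fun continuous_fst continuous_snd).mem_nhds h
    have hc : ContinuousAt (fun q : ℝ × ℝ => (Real.log q.1 - Real.log q.2) / (q.1 - q.2)) p :=
      ((continuousAt_fst.log h1.ne').sub (continuousAt_snd.log h2.ne')).div
        (continuousAt_fst.sub continuousAt_snd) (sub_ne_zero.2 h)
    exact hc.congr (hne.mono fun q hq => by simp only [logSlope, if_neg hq])

theorem continuousOn_posKernel {N : ℕ} [NeZero N] (μ : YoungDiagram) :
    ContinuousOn (posKernel μ : (Fin N → ℝ) → ℝ) {x | ∀ i, 0 < x i} := by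
  intro x hx
  refine ContinuousAt.continuousWithinAt ?_
  have h1 : ContinuousAt (fun x : Fin N → ℝ => fun i => Real.log (x i)) x :=
    continuousAt_pi.2 fun i => (continuousAt_apply i x).log (hx i).ne'
  have h2 : ContinuousAt (vandermondeRatio : (Fin N → ℝ) → ℝ) x := by
    refine tendsto_finsetProd _ fun i _ => tendsto_finsetProd _ fun j _ => ?_
    exact ContinuousAt.comp (f := fun x : Fin N → ℝ => (x i, x j))
      (continuousAt_logSlope (p := (x i, x j)) (hx i) (hx j))
      ((continuousAt_apply i x).prodMk (continuousAt_apply j x))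
  refine ContinuousAt.mul ?_ h2
  simp only [sphericalIntegral_eq]
  exact ContinuousAt.comp (f := fun x : Fin N → ℝ => fun i => Real.log (x i))
    (continuous_unitaryIntegral _).continuousAt h1

theorem isOpen_pos (N : ℕ) : IsOpen {x : Fin N → ℝ | ∀ i, 0 < x i} := by
  simp only [Set.ofPred_forall]
  exact isOpen_iInter_of_finite fun i => isOpen_lt continuous_const (continuous_apply i)

theorem posKernel_eq {N : ℕ} [NeZero N] {μ : YoungDiagram} (hμ : μ.rowLen N = 0)
    {x : Fin N → ℝ} (hx : ∀ i, 0 < x i) :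
    posKernel μ x = schur μ x / schur μ (fun _ : Fin N => 1) := by
  have hmem : x ∈ closure ({x : Fin N → ℝ | ∀ i, 0 < x i} ∩ {x | Function.Injective x}) :=
    (dense_injective N).open_subset_closure_inter (isOpen_pos N) hx
  have hne : (𝓝[{x : Fin N → ℝ | ∀ i, 0 < x i} ∩ {x | Function.Injective x}] x).NeBot :=
    mem_closure_iff_nhdsWithin_neBot.1 hmem
  have h1 := ((continuousOn_posKernel μ).continuousWithinAt hx).mono
    (Set.inter_subset_left (t := {x | Function.Injective x}))
  have h2 : ContinuousWithinAt (fun x => schur μ x / schur μ (fun _ : Fin N => 1))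
      ({x : Fin N → ℝ | ∀ i, 0 < x i} ∩ {x | Function.Injective x}) x :=
    ((continuous_schur μ).div_const _).continuousWithinAt
  refine tendsto_nhds_unique_of_eventuallyEq h1 h2 ?_
  filter_upwards [self_mem_nhdsWithin] with y hy using posKernel_eq_of_injective hμ hy.1 hy.2

theorem tendsto_posKernel {N : ℕ} [NeZero N] {μ : YoungDiagram} (hμ : μ.rowLen N = 0)
    (x : Fin N → ℝ) :
    Tendsto (posKernel μ) (𝓝[{y : Fin N → ℝ | ∀ i, 0 < y i}] x)
      (𝓝 (schur μ x / schur μ (fun _ : Fin N => 1))) := by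
  have h2 : Tendsto (fun x => schur μ x / schur μ (fun _ : Fin N => 1))
      (𝓝[{y : Fin N → ℝ | ∀ i, 0 < y i}] x) (𝓝 (schur μ x / schur μ (fun _ : Fin N => 1))) :=
    ((continuous_schur μ).div_const _).continuousWithinAt
  refine h2.congr' ?_
  filter_upwards [self_mem_nhdsWithin] with y hy using (posKernel_eq hμ hy).symm

theorem kernel_eq {N : ℕ} [NeZero N] {μ : YoungDiagram} (hμ : μ.rowLen N = 0)
    {x : Fin N → ℝ} (hx : ∀ i, 0 ≤ x i) :
    kernel μ x = schur μ x / schur μ (fun _ : Fin N => 1) := by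
  rw [kernel]
  split_ifs with h
  · exact posKernel_eq hμ h
  · have hne : (𝓝[{y : Fin N → ℝ | ∀ i, 0 < y i}] x).NeBot := by
      refine mem_closure_iff_nhdsWithin_neBot.1 (mem_closure_of_tendsto
        (f := fun (t : ℝ) i => x i + t) (b := 𝓝[>] 0) ?_ ?_)
      · have hc : Continuous fun (t : ℝ) (i : Fin N) => x i + t := by fun_prop
        have := hc.tendsto 0
        simp only [add_zero] at this
        exact this.mono_left nhdsWithin_le_nhds
      · filter_upwards [self_mem_nhdsWithin] with t ht i using add_pos_of_nonneg_of_pos (hx i) ht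
    exact (tendsto_posKernel hμ x).limUnder_eq

theorem exists_kernel_congr {N : ℕ} (μ : YoungDiagram) :
    ∃ ν : YoungDiagram, ν.rowLen N = 0 ∧ (posKernel μ : (Fin N → ℝ) → ℝ) = posKernel ν ∧
      (kernel μ : (Fin N → ℝ) → ℝ) = kernel ν := by
  obtain ⟨ν, hν, h⟩ := exists_shiftedParts_eq (strictAnti_shiftedParts (N := N) μ)
  have h1 := posKernel_congr h.symm
  exact ⟨ν, hν, h1, by funext x; simp only [kernel, h1]⟩

theorem tendsto_posKernel_kernel {N : ℕ} [NeZero N] (μ : YoungDiagram) {x : Fin N → ℝ}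
    (hx : ∀ i, 0 ≤ x i) :
    Tendsto (posKernel μ) (𝓝[{y : Fin N → ℝ | ∀ i, 0 < y i}] x) (𝓝 (kernel μ x)) := by
  obtain ⟨ν, hν, h1, h2⟩ := exists_kernel_congr (N := N) μ
  rw [h1, h2, kernel_eq hν hx]
  exact tendsto_posKernel hν x

/-! ### Measures with the same exponential moments -/

theorem ext_of_lintegral_exp {E : Type*} [NormedAddCommGroup E] [NormedSpace ℝ E]
    [FiniteDimensional ℝ E] [MeasurableSpace E] [BorelSpace E] {μ ν : Measure E}
    (hfin : ∀ L : StrongDual ℝ E, ∫⁻ v, ENNReal.ofReal (Real.exp (L v)) ∂μ ≠ ⊤)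
    (h : ∀ L : StrongDual ℝ E, ∫⁻ v, ENNReal.ofReal (Real.exp (L v)) ∂μ =
      ∫⁻ v, ENNReal.ofReal (Real.exp (L v)) ∂ν) : μ = ν := by
  have hm : ∀ L : StrongDual ℝ E, Measurable fun v => Real.exp (L v) := fun L =>
    (Real.continuous_exp.comp L.continuous).measurable
  have hμ1 : μ Set.univ = ∫⁻ v, ENNReal.ofReal (Real.exp ((0 : StrongDual ℝ E) v)) ∂μ := by simp
  have hν1 : ν Set.univ = ∫⁻ v, ENNReal.ofReal (Real.exp ((0 : StrongDual ℝ E) v)) ∂ν := by simp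
  have hμν : μ Set.univ = ν Set.univ := by rw [hμ1, hν1, h]
  have : IsFiniteMeasure μ := ⟨by rw [hμ1]; exact (hfin 0).lt_top⟩
  have : IsFiniteMeasure ν := ⟨by rw [← hμν]; exact measure_lt_top μ _⟩
  have hcomp : CompleteSpace E := FiniteDimensional.complete ℝ E
  have hsec : SecondCountableTopology E :=
    have : ProperSpace E := FiniteDimensional.proper_real E
    inferInstance
  refine Measure.ext_of_charFunDual (funext fun L => ?_)
  have hint : ∀ t : ℝ, Integrable (fun v => Real.exp (t * L v)) μ := by
    intro t
    refine ⟨(hm (t • L)).aestronglyMeasurable, ?_⟩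
    rw [hasFiniteIntegral_iff_ofReal (Eventually.of_forall fun v => (Real.exp_pos _).le)]
    exact (hfin (t • L)).lt_top
  have hmgf : ProbabilityTheory.mgf L μ = ProbabilityTheory.mgf L ν := by
    funext t
    change ∫ v, Real.exp ((t • L) v) ∂μ = ∫ v, Real.exp ((t • L) v) ∂ν
    rw [integral_eq_lintegral_of_nonneg_ae
      (Eventually.of_forall fun v => (Real.exp_pos _).le) (hm (t • L)).aestronglyMeasurable,
      integral_eq_lintegral_of_nonneg_ae (Eventually.of_forall fun v => (Real.exp_pos _).le)
      (hm (t • L)).aestronglyMeasurable]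
    exact congrArg ENNReal.toReal (h (t • L))
  have h0 : μ = 0 ↔ ν = 0 := by
    rw [← Measure.measure_univ_eq_zero, hμν, Measure.measure_univ_eq_zero]
  have huniv : ProbabilityTheory.integrableExpSet L μ = Set.univ :=
    Set.eq_univ_of_forall fun t => hint t
  have h1 := ProbabilityTheory.eqOn_complexMGF_of_mgf' hmgf h0 (x := Complex.I) (by
    rw [huniv, interior_univ]; trivial)
  rw [charFunDual_apply, charFunDual_apply]
  simpa only [ProbabilityTheory.complexMGF, mul_comm Complex.I] using h1

theorem lintegral_exp_of_eventually {α : Type*} [MeasurableSpace α] {μ : Measure α} {f g : α → ℝ}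
    (hf : Measurable f) (hg : Measurable g) {G : ℝ → ℝ} (hG : ContinuousAt G 0)
    (h : ∀ᶠ t in 𝓝[≠] (0 : ℝ),
      ∫⁻ a, ENNReal.ofReal (Real.exp (f a + t * g a)) ∂μ = ENNReal.ofReal (G t)) :
    ∫⁻ a, ENNReal.ofReal (Real.exp (f a)) ∂μ = ENNReal.ofReal (G 0) := by
  obtain ⟨r, hr, hball⟩ := Metric.mem_nhdsWithin_iff.1 h
  have hr2 : 0 < r / 2 := by positivity
  have hmem : ∀ t : ℝ, t ≠ 0 → |t| < r →
      ∫⁻ a, ENNReal.ofReal (Real.exp (f a + t * g a)) ∂μ = ENNReal.ofReal (G t) :=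
    fun t ht htr => hball ⟨by simpa using htr, ht⟩
  have hlim := tendsto_lintegral_filter_of_dominated_convergence (μ := μ) (l := 𝓝[≠] (0 : ℝ))
    (F := fun t a => ENNReal.ofReal (Real.exp (f a + t * g a)))
    (f := fun a => ENNReal.ofReal (Real.exp (f a)))
    (fun a => ENNReal.ofReal (Real.exp (f a + r / 2 * g a)) +
      ENNReal.ofReal (Real.exp (f a + -(r / 2) * g a))) ?_ ?_ ?_ ?_
  · refine tendsto_nhds_unique hlim (Tendsto.congr' (h.mono fun t ht => ht.symm) ?_)
    exact (ENNReal.continuous_ofReal.tendsto _).comp (hG.tendsto.mono_left nhdsWithin_le_nhds)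
  · exact Eventually.of_forall fun t => (hf.add (hg.const_mul t)).exp.ennreal_ofReal
  · have h1 : ∀ᶠ t : ℝ in 𝓝[≠] 0, |t| ≤ r / 2 := by
      refine mem_nhdsWithin_of_mem_nhds ?_
      filter_upwards [Metric.closedBall_mem_nhds (0 : ℝ) hr2] with t ht
      simpa using ht
    filter_upwards [h1] with t ht
    refine Eventually.of_forall fun a => ?_
    rw [← ENNReal.ofReal_add (Real.exp_pos _).le (Real.exp_pos _).le]
    refine ENNReal.ofReal_le_ofReal ?_
    have h2 := abs_le.1 ht
    rcases le_total 0 (g a) with h3 | h3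
    · have := Real.exp_le_exp.2 (show f a + t * g a ≤ f a + r / 2 * g a by nlinarith)
      linarith [Real.exp_pos (f a + -(r / 2) * g a)]
    · have := Real.exp_le_exp.2 (show f a + t * g a ≤ f a + -(r / 2) * g a by nlinarith)
      linarith [Real.exp_pos (f a + r / 2 * g a)]
  · have hm : Measurable fun a => ENNReal.ofReal (Real.exp (f a + r / 2 * g a)) :=
      (hf.add (hg.const_mul _)).exp.ennreal_ofReal
    rw [lintegral_add_left hm,
      hmem _ hr2.ne' (by rw [abs_of_pos hr2]; linarith),
      hmem _ (neg_ne_zero.2 hr2.ne') (by rw [abs_neg, abs_of_pos hr2]; linarith)]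
    exact ENNReal.add_ne_top.2 ⟨ENNReal.ofReal_ne_top, ENNReal.ofReal_ne_top⟩
  · refine Eventually.of_forall fun a => ?_
    have hc : Continuous fun t : ℝ => ENNReal.ofReal (Real.exp (f a + t * g a)) :=
      ENNReal.continuous_ofReal.comp (by fun_prop)
    have := hc.tendsto 0
    simp only [zero_mul, add_zero] at this
    exact this.mono_left nhdsWithin_le_nhds

/-! ### Coordinates on Hermitian matrices -/

/-- The real coordinates of a Hermitian matrix. -/
def coords {N : ℕ} (M : HermitianMatrix N) (i j : Fin N) : ℝ :=
  if i < j then (M.1 i j).re else if j < i then (M.1 j i).im else (M.1 i i).re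

theorem hermitianOfCoords_coords {N : ℕ} (M : HermitianMatrix N) :
    hermitianOfCoords (coords M) = M := by
  refine Subtype.ext (Matrix.ext fun i j => ?_)
  have hM : ∀ i j, star (M.1 j i) = M.1 i j := fun i j => M.2.apply i j
  rcases lt_trichotomy i j with h | rfl | h
  · simp [coords, hermitianOfCoords, h, h.not_gt]
  · have := hM i i
    rw [Complex.star_def, Complex.conj_eq_iff_re] at this
    simpa [coords, hermitianOfCoords] using this
  · have := hM i j
    rw [← this]
    simp [coords, hermitianOfCoords, h, h.not_gt, Complex.ext_iff]

theorem continuous_coords {N : ℕ} :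
    Continuous (coords : HermitianMatrix N → Fin N → Fin N → ℝ) := by
  have h : ∀ i j : Fin N, Continuous fun M : HermitianMatrix N => M.1 i j := fun i j =>
    (continuous_apply j).comp ((continuous_apply i).comp continuous_subtype_val)
  refine continuous_pi fun i => continuous_pi fun j => ?_
  unfold coords
  split_ifs
  · exact Complex.continuous_re.comp (h i j)
  · exact Complex.continuous_im.comp (h j i)
  · exact Complex.continuous_re.comp (h i i)

/-- The bilinear form `tr (S R)` in coordinates. -/
def coordForm {N : ℕ} (S R : Fin N → Fin N → ℝ) : ℝ :=
  ∑ i, ∑ j, (if i = j then 1 else 2) * (S i j * R i j)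

theorem trace_hermitianOfCoords_mul {N : ℕ} (S R : Fin N → Fin N → ℝ) :
    ((hermitianOfCoords S).1 * (hermitianOfCoords R).1).trace.re = coordForm S R := by
  have h1 : ∀ i j, ((hermitianOfCoords S).1 i j * (hermitianOfCoords R).1 j i).re =
      (if i = j then 1 / 2 else 1) * (S i j * R i j) +
        (if j = i then 1 / 2 else 1) * (S j i * R j i) := by
    intro i j
    rcases lt_trichotomy i j with h | rfl | h
    · simp [hermitianOfCoords, h, h.not_gt, h.ne, h.ne']
    · simp [hermitianOfCoords]; ring
    · simp [hermitianOfCoords, h, h.not_gt, h.ne, h.ne']; ring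
  simp only [Matrix.trace, Matrix.diag_apply, Matrix.mul_apply, Complex.re_sum, h1,
    Finset.sum_add_distrib]
  rw [Finset.sum_comm (f := fun i j => (if j = i then (1 / 2 : ℝ) else 1) * (S j i * R j i)),
    ← two_mul, coordForm, Finset.mul_sum]
  refine Finset.sum_congr rfl fun i _ => ?_
  rw [Finset.mul_sum]
  refine Finset.sum_congr rfl fun j _ => ?_
  split_ifs <;> ring

theorem lintegral_hermitianLebesgue {N : ℕ} {F : HermitianMatrix N → ENNReal} (hF : Measurable F) :
    ∫⁻ M, F M ∂hermitianLebesgue N = ∫⁻ R, F (hermitianOfCoords R) :=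
  lintegral_map hF continuous_hermitianOfCoords.measurable

theorem continuous_trace_mul {N : ℕ} (X : Matrix (Fin N) (Fin N) ℂ) :
    Continuous fun M : HermitianMatrix N => (M.1 * X).trace.re :=
  Complex.continuous_re.comp (Continuous.matrix_trace
    (continuous_subtype_val.matrix_mul continuous_const))

theorem continuous_trace_sq {N : ℕ} :
    Continuous fun M : HermitianMatrix N => (M.1 * M.1).trace.re :=
  Complex.continuous_re.comp (Continuous.matrix_trace
    (continuous_subtype_val.matrix_mul continuous_subtype_val))

theorem coordForm_sub {N : ℕ} (R S : Fin N → Fin N → ℝ) :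
    coordForm (R - S) (R - S) = coordForm R R - 2 * coordForm R S + coordForm S S := by
  simp only [coordForm, Finset.mul_sum, ← Finset.sum_sub_distrib, ← Finset.sum_add_distrib,
    Pi.sub_apply]
  exact Finset.sum_congr rfl fun i _ => Finset.sum_congr rfl fun j _ => by ring

theorem sum_sq_le_coordForm {N : ℕ} (R : Fin N → Fin N → ℝ) :
    ∑ i, ∑ j, R i j ^ 2 ≤ coordForm R R := by
  refine Finset.sum_le_sum fun i _ => Finset.sum_le_sum fun j _ => ?_
  split_ifs <;> nlinarith [sq_nonneg (R i j)]

/-- The mass of the Gaussian measure on Hermitian matrices. -/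
def gaussMass (N : ℕ) : ENNReal :=
  ∫⁻ M, ENNReal.ofReal (Real.exp (-((M.1 * M.1).trace.re / 2))) ∂hermitianLebesgue N

theorem gaussMass_eq (N : ℕ) : gaussMass N = ∫⁻ R : Fin N → Fin N → ℝ,
    ENNReal.ofReal (Real.exp (-(coordForm R R / 2))) := by
  have hm : Measurable fun M : HermitianMatrix N =>
      ENNReal.ofReal (Real.exp (-((M.1 * M.1).trace.re / 2))) :=
    (continuous_trace_sq.div_const 2).neg.rexp.measurable.ennreal_ofReal
  rw [gaussMass, lintegral_hermitianLebesgue hm]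
  simp only [trace_hermitianOfCoords_mul]

theorem lintegral_exp_trace_sub {N : ℕ} (X : HermitianMatrix N) :
    ∫⁻ M, ENNReal.ofReal (Real.exp ((M.1 * X.1).trace.re - (M.1 * M.1).trace.re / 2))
        ∂hermitianLebesgue N =
      ENNReal.ofReal (Real.exp ((X.1 * X.1).trace.re / 2)) * gaussMass N := by
  have hm : Measurable fun M : HermitianMatrix N =>
      ENNReal.ofReal (Real.exp ((M.1 * X.1).trace.re - (M.1 * M.1).trace.re / 2)) :=
    ((continuous_trace_mul X.1).sub
      (continuous_trace_sq.div_const 2)).rexp.measurable.ennreal_ofReal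
  rw [gaussMass_eq, lintegral_hermitianLebesgue hm]
  rw [← hermitianOfCoords_coords X]
  generalize coords X = S
  simp only [trace_hermitianOfCoords_mul]
  rw [← lintegral_const_mul' _ _ ENNReal.ofReal_ne_top, ← lintegral_sub_right_eq_self
    (fun R : Fin N → Fin N → ℝ => ENNReal.ofReal (Real.exp (coordForm S S / 2)) *
      ENNReal.ofReal (Real.exp (-(coordForm R R / 2)))) S]
  refine lintegral_congr fun R => ?_
  rw [← ENNReal.ofReal_mul (Real.exp_pos _).le, ← Real.exp_add, coordForm_sub]
  congr 2
  ring

theorem gaussMass_ne_zero (N : ℕ) : gaussMass N ≠ 0 := by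
  rw [gaussMass_eq]
  have hm : Measurable fun R : Fin N → Fin N → ℝ =>
      ENNReal.ofReal (Real.exp (-(coordForm R R / 2))) := by
    refine (Real.measurable_exp.comp (Continuous.measurable ?_)).ennreal_ofReal
    unfold coordForm
    fun_prop
  intro h
  have h1 : ∀ᵐ R : Fin N → Fin N → ℝ, False :=
    ((lintegral_eq_zero_iff hm).1 h).mono fun R hR =>
      (Real.exp_pos _).not_ge (ENNReal.ofReal_eq_zero.1 hR)
  have h2 : (volume : Measure (Fin N → Fin N → ℝ)).IsOpenPosMeasure :=
    inferInstanceAs (Measure.pi fun _ => volume).IsOpenPosMeasure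
  simp only [ae_iff, not_false_eq_true] at h1
  exact (isOpen_univ.measure_pos volume Set.univ_nonempty).ne' h1

theorem gaussMass_ne_top (N : ℕ) : gaussMass N ≠ ⊤ := by
  rw [gaussMass_eq]
  have h1 : Integrable fun r : ℝ => Real.exp (-(1 / 2) * r ^ 2) :=
    integrable_exp_neg_mul_sq (by norm_num)
  have h2 : Integrable fun x : Fin N → ℝ => ∏ j, Real.exp (-(1 / 2) * x j ^ 2) :=
    Integrable.fintype_prod (f := fun _ r => Real.exp (-(1 / 2) * r ^ 2)) fun _ => h1
  have h3 : Integrable (fun R : Fin N → Fin N → ℝ =>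
      ∏ i, ∏ j, Real.exp (-(1 / 2) * R i j ^ 2)) (Measure.pi fun _ => volume) :=
    Integrable.fintype_prod (E := Fin N → ℝ)
      (f := fun _ (x : Fin N → ℝ) => ∏ j, Real.exp (-(1 / 2) * x j ^ 2)) fun _ => h2
  have h4 : ∀ R : Fin N → Fin N → ℝ, Real.exp (-(coordForm R R / 2)) ≤
      ∏ i, ∏ j, Real.exp (-(1 / 2) * R i j ^ 2) := fun R => by
    simp only [← Real.exp_sum]
    refine Real.exp_le_exp.2 ?_
    have := sum_sq_le_coordForm R
    simp only [← Finset.mul_sum]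
    linarith
  exact ((lintegral_mono fun R => ENNReal.ofReal_le_ofReal (h4 R)).trans_lt
    h3.lintegral_lt_top).ne

/-! ### Gaussian averages of determinants -/

theorem det_of_eq_sum_perm {N : ℕ} (M : Matrix (Fin N) (Fin N) ℝ) :
    M.det = ∑ σ : Equiv.Perm (Fin N), ((Equiv.Perm.sign σ : ℤ) : ℝ) * ∏ i, M i (σ i) := by
  rw [← Matrix.det_transpose, Matrix.det_apply']
  rfl

/-- Andréief's identity. -/
theorem integral_det_mul_det {N : ℕ} {f g : Fin N → ℝ → ℝ}
    (hint : ∀ i j, Integrable fun x => f i x * g j x) :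
    Integrable (fun x : Fin N → ℝ => (Matrix.of fun i j => f j (x i)).det *
        (Matrix.of fun i j => g j (x i)).det) ∧
      ∫ x : Fin N → ℝ, (Matrix.of fun i j => f j (x i)).det *
        (Matrix.of fun i j => g j (x i)).det =
      N.factorial * (Matrix.of fun i j => ∫ x, f i x * g j x).det := by
  set ε : Equiv.Perm (Fin N) → ℝ := fun σ => ((Equiv.Perm.sign σ : ℤ) : ℝ) with hε
  have hε2 : ∀ σ, ε σ * ε σ = 1 := fun σ => by
    rw [hε]
    simp only
    rw [← Int.cast_mul, ← Units.val_mul, Int.units_mul_self]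
    simp
  have hexp : (fun x : Fin N → ℝ => (Matrix.of fun i j => f j (x i)).det *
      (Matrix.of fun i j => g j (x i)).det) = fun x => ∑ σ, ∑ τ, ε σ * ε τ *
        ∏ i, (f (σ i) (x i) * g (τ i) (x i)) := by
    funext x
    rw [det_of_eq_sum_perm, det_of_eq_sum_perm, Finset.sum_mul_sum]
    refine Finset.sum_congr rfl fun σ _ => Finset.sum_congr rfl fun τ _ => ?_
    rw [Finset.prod_mul_distrib]
    simp only [Matrix.of_apply, hε]
    ring
  have hI : ∀ σ τ : Equiv.Perm (Fin N), Integrable fun x : Fin N → ℝ => ε σ * ε τ *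
      ∏ i, (f (σ i) (x i) * g (τ i) (x i)) := fun σ τ =>
    (Integrable.fintype_prod (f := fun i x => f (σ i) x * g (τ i) x)
      fun i => hint (σ i) (τ i)).const_mul _
  rw [hexp]
  refine ⟨integrable_finsetSum _ fun σ _ => integrable_finsetSum _ fun τ _ => hI σ τ, ?_⟩
  rw [integral_finsetSum _ fun σ _ => integrable_finsetSum _ fun τ _ => hI σ τ]
  have hσ : ∀ σ : Equiv.Perm (Fin N), ∫ x : Fin N → ℝ, ∑ τ, ε σ * ε τ *
      ∏ i, (f (σ i) (x i) * g (τ i) (x i)) = (Matrix.of fun i j => ∫ x, f i x * g j x).det := by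
    intro σ
    rw [integral_finsetSum _ fun τ _ => hI σ τ]
    have h1 : ∀ τ : Equiv.Perm (Fin N), ∫ x : Fin N → ℝ, ε σ * ε τ *
        ∏ i, (f (σ i) (x i) * g (τ i) (x i)) = ε σ * (ε τ * ∏ i,
          ((Matrix.of fun i j => ∫ x, f i x * g j x).submatrix σ id) i (τ i)) := by
      intro τ
      rw [integral_const_mul, integral_fintype_prod_volume_eq_prod
        (fun i x => f (σ i) x * g (τ i) x), mul_assoc]
      rfl
    simp only [h1]
    rw [← Finset.mul_sum, ← det_of_eq_sum_perm, Matrix.det_permute, ← mul_assoc]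
    change ε σ * ε σ * _ = _
    rw [hε2, one_mul]
  simp only [hσ, Finset.sum_const, Finset.card_univ, Fintype.card_perm, Fintype.card_fin,
    nsmul_eq_mul]

/-- The moments of the Gaussian weight `exp (-u² / 2)`. -/
def gaussMoment (n : ℕ) : ℝ := ∫ u : ℝ, u ^ n * Real.exp (-(1 / 2) * u ^ 2)

theorem integrable_gaussMoment (n : ℕ) :
    Integrable fun u : ℝ => u ^ n * Real.exp (-(1 / 2) * u ^ 2) := by
  have := integrable_rpow_mul_exp_neg_mul_sq (b := 1 / 2) (by norm_num) (s := n)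
    (by have : (0 : ℝ) ≤ n := Nat.cast_nonneg n
        linarith)
  simpa only [Real.rpow_natCast] using this

theorem gaussMoment_zero_pos : 0 < gaussMoment 0 := by
  simp only [gaussMoment, pow_zero, one_mul]
  rw [integral_gaussian]
  positivity

theorem gauss_shift (k : ℕ) (y : ℝ) :
    Integrable (fun x : ℝ => x ^ k * Real.exp (-(1 / 2) * x ^ 2) * Real.exp (x * y)) ∧
      ∫ x : ℝ, x ^ k * Real.exp (-(1 / 2) * x ^ 2) * Real.exp (x * y) =
        Real.exp (y ^ 2 / 2) *
          ∑ m ∈ Finset.range (k + 1), y ^ m * (gaussMoment (k - m) * k.choose m) := by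
  have h1 : ∀ u : ℝ, (u + y) ^ k * Real.exp (-(1 / 2) * (u + y) ^ 2) * Real.exp ((u + y) * y) =
      Real.exp (y ^ 2 / 2) * ∑ m ∈ Finset.range (k + 1),
        (y ^ m * k.choose m) * (u ^ (k - m) * Real.exp (-(1 / 2) * u ^ 2)) := by
    intro u
    have h2 : Real.exp (-(1 / 2) * (u + y) ^ 2) * Real.exp ((u + y) * y) =
        Real.exp (y ^ 2 / 2) * Real.exp (-(1 / 2) * u ^ 2) := by
      rw [← Real.exp_add, ← Real.exp_add]
      congr 1
      ring
    rw [mul_assoc, h2, add_comm u y, add_pow, mul_left_comm, Finset.sum_mul]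
    congr 1
    exact Finset.sum_congr rfl fun m _ => by ring
  have hI : ∀ m ∈ Finset.range (k + 1), Integrable fun u : ℝ =>
      (y ^ m * k.choose m) * (u ^ (k - m) * Real.exp (-(1 / 2) * u ^ 2)) :=
    fun m _ => (integrable_gaussMoment (k - m)).const_mul _
  constructor
  · have h3 := ((integrable_finsetSum _ hI).const_mul (Real.exp (y ^ 2 / 2))).comp_sub_right y
    refine h3.congr (Eventually.of_forall fun x => ?_)
    have := h1 (x - y)
    rw [sub_add_cancel] at this
    exact this.symm
  · rw [← integral_add_right_eq_self _ y]
    simp only [h1]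
    rw [integral_const_mul, integral_finsetSum _ hI]
    congr 1
    refine Finset.sum_congr rfl fun m _ => ?_
    rw [integral_const_mul, gaussMoment]
    ring

/-- The monic polynomial `∫ (u + y)^k exp (-u² / 2) du / ∫ exp (-u² / 2) du` in `y`. -/
def gaussPoly (k : ℕ) : Polynomial ℝ :=
  Polynomial.X ^ k + ∑ i : Fin k,
    Polynomial.C ((gaussMoment 0)⁻¹ * (gaussMoment (k - i) * k.choose i)) * Polynomial.X ^ (i : ℕ)

theorem monic_gaussPoly (k : ℕ) : (gaussPoly k).Monic :=
  Polynomial.monic_X_pow_add (Polynomial.degree_sum_fin_lt _)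

theorem natDegree_gaussPoly (k : ℕ) : (gaussPoly k).natDegree = k :=
  Polynomial.natDegree_eq_of_degree_eq_some (by
    rw [gaussPoly, Polynomial.degree_add_eq_left_of_degree_lt] <;>
    rw [Polynomial.degree_X_pow]
    exact Polynomial.degree_sum_fin_lt _)

theorem gaussMoment_mul_eval_gaussPoly (k : ℕ) (y : ℝ) :
    gaussMoment 0 * (gaussPoly k).eval y =
      ∑ m ∈ Finset.range (k + 1), y ^ m * (gaussMoment (k - m) * k.choose m) := by
  have h0 := gaussMoment_zero_pos.ne'
  rw [Finset.sum_range_succ, ← Fin.sum_univ_eq_sum_range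
    (fun m => y ^ m * (gaussMoment (k - m) * k.choose m)), gaussPoly]
  simp only [Polynomial.eval_add, Polynomial.eval_pow, Polynomial.eval_X,
    Polynomial.eval_finsetSum, Polynomial.eval_mul, Polynomial.eval_C, mul_add, Finset.mul_sum,
    Nat.sub_self, Nat.choose_self, Nat.cast_one, mul_one]
  rw [add_comm, mul_comm (gaussMoment 0)]
  congr 1
  refine Finset.sum_congr rfl fun i _ => ?_
  field_simp

theorem det_gauss_moments {N : ℕ} (y : Fin N → ℝ) :
    (Matrix.of fun i j : Fin N => ∫ x : ℝ, x ^ (i : ℕ) * Real.exp (-(1 / 2) * x ^ 2) *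
      Real.exp (x * y j)).det =
      gaussMoment 0 ^ N * Real.exp ((∑ i, y i ^ 2) / 2) * (Matrix.vandermonde y).det := by
  rw [Matrix.det_eval_matrixOfPolynomials_eq_det_vandermonde y (fun i => gaussPoly i)
    (fun i => natDegree_gaussPoly i) (fun i => monic_gaussPoly i), ← Matrix.det_transpose]
  have h1 : gaussMoment 0 ^ N * Real.exp ((∑ i, y i ^ 2) / 2) =
      ∏ i : Fin N, (gaussMoment 0 * Real.exp (y i ^ 2 / 2)) := by
    rw [Finset.prod_mul_distrib, Finset.prod_const, Finset.card_univ, Fintype.card_fin,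
      ← Real.exp_sum, Finset.sum_div]
  rw [h1, ← Matrix.det_mul_column]
  congr 1
  ext j i
  simp only [Matrix.transpose_apply, Matrix.of_apply]
  rw [(gauss_shift i (y j)).2, ← gaussMoment_mul_eval_gaussPoly]
  ring

theorem vandermonde_sq {N : ℕ} (x : Fin N → ℝ) :
    vandermonde x ^ 2 = (Matrix.vandermonde x).det ^ 2 := by
  rw [← sq_abs (Matrix.vandermonde x).det, Matrix.det_vandermonde, Finset.abs_prod, vandermonde]
  congr 1
  refine Finset.prod_congr rfl fun i _ => ?_
  rw [Finset.abs_prod]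
  exact Finset.prod_congr rfl fun j _ => abs_sub_comm _ _

theorem unitaryIntegral_nonneg {N : ℕ} (x y : Fin N → ℝ) : 0 ≤ unitaryIntegral x y :=
  integral_nonneg fun _ => (Real.exp_pos _).le

/-- The unnormalised density of the eigenvalues of a Gaussian Hermitian matrix. -/
def eigenDensity {N : ℕ} (x : Fin N → ℝ) : ℝ :=
  vandermonde x ^ 2 * Real.exp (-((∑ i, x i ^ 2) / 2))

theorem lintegral_eigenDensity_mul_unitaryIntegral {N : ℕ} {y : Fin N → ℝ}
    (hy : Function.Injective y) :
    ∫⁻ x : Fin N → ℝ, ENNReal.ofReal (eigenDensity x * unitaryIntegral x y) =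
      ENNReal.ofReal (weylConst N * N.factorial * gaussMoment 0 ^ N *
        Real.exp ((∑ i, y i ^ 2) / 2)) := by
  have hV : (Matrix.vandermonde y).det ≠ 0 := Matrix.det_vandermonde_ne_zero_iff.2 hy
  have key := integral_det_mul_det (f := fun (k : Fin N) x => x ^ (k : ℕ) *
    Real.exp (-(1 / 2) * x ^ 2)) (g := fun (j : Fin N) x => Real.exp (x * y j))
    fun i j => (gauss_shift i (y j)).1
  have hdet : ∀ x : Fin N → ℝ, (Matrix.of fun i j : Fin N => x i ^ (j : ℕ) *
      Real.exp (-(1 / 2) * x i ^ 2)).det =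
      (Matrix.vandermonde x).det * Real.exp (-((∑ i, x i ^ 2) / 2)) := by
    intro x
    rw [mul_comm, Finset.sum_div, ← Finset.sum_neg_distrib, Real.exp_sum,
      ← Matrix.det_mul_column]
    congr 1
    ext i j
    simp only [Matrix.of_apply, Matrix.vandermonde_apply]
    rw [mul_comm]
    congr 2
    ring
  have hfun : ∀ x : Fin N → ℝ, eigenDensity x * unitaryIntegral x y =
      weylConst N * (Matrix.vandermonde y).det⁻¹ *
        ((Matrix.of fun i j : Fin N => x i ^ (j : ℕ) * Real.exp (-(1 / 2) * x i ^ 2)).det *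
          (Matrix.of fun i j => Real.exp (x i * y j)).det) := by
    intro x
    have h := unitaryIntegral_mul x y
    rw [hdet, eigenDensity, vandermonde_sq]
    field_simp
    linear_combination (Matrix.vandermonde x).det * h
  simp only [hdet] at key
  simp only [det_gauss_moments] at key
  rw [← ofReal_integral_eq_lintegral_ofReal]
  · simp only [hfun, hdet]
    rw [integral_const_mul, key.2]
    congr 1
    field_simp
  · simp only [hfun, hdet]
    exact key.1.const_mul _
  · exact Eventually.of_forall fun x => mul_nonneg (mul_nonneg (sq_nonneg _) (Real.exp_pos _).le)
      (unitaryIntegral_nonneg x y)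

/-! ### The Weyl integration formula -/

theorem continuous_eigenDensity {N : ℕ} : Continuous (eigenDensity : (Fin N → ℝ) → ℝ) := by
  unfold eigenDensity vandermonde
  fun_prop

/-- The law of `U diag(x) U*` where `U` is Haar distributed and `x` has density `eigenDensity`. -/
def spectralGauss (N : ℕ) : Measure (HermitianMatrix N) :=
  Measure.map (fun p : (Fin N → ℝ) × Matrix.unitaryGroup (Fin N) ℂ => conjDiag p.2 p.1)
    ((volume.withDensity fun x => ENNReal.ofReal (eigenDensity x)).prod (unitaryHaar N))

theorem lintegral_spectralGauss {N : ℕ} {F : HermitianMatrix N → ENNReal} (hF : Measurable F) :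
    ∫⁻ M, F M ∂spectralGauss N =
      ∫⁻ x : Fin N → ℝ, ENNReal.ofReal (eigenDensity x) *
        ∫⁻ U, F (conjDiag U x) ∂unitaryHaar N := by
  have hm : Measurable fun p : (Fin N → ℝ) × Matrix.unitaryGroup (Fin N) ℂ =>
      F (conjDiag p.2 p.1) := hF.comp (continuous_conjDiag_uncurry (N := N)).measurable
  have hd : Measurable fun x : Fin N → ℝ => ENNReal.ofReal (eigenDensity x) :=
    continuous_eigenDensity.measurable.ennreal_ofReal
  rw [spectralGauss, lintegral_map hF continuous_conjDiag_uncurry.measurable,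
    lintegral_prod _ hm.aemeasurable, lintegral_withDensity_eq_lintegral_mul _ hd
      (Measurable.lintegral_prod_right' hm)]
  rfl

theorem lintegral_exp_trace_conjDiag {N : ℕ} (V : Matrix.unitaryGroup (Fin N) ℂ)
    (x y : Fin N → ℝ) :
    ∫⁻ U, ENNReal.ofReal (Real.exp ((conjDiag U x).1 * (conjDiag V y).1).trace.re)
      ∂unitaryHaar N = ENNReal.ofReal (unitaryIntegral x y) := by
  have hc : Continuous fun U : Matrix.unitaryGroup (Fin N) ℂ =>
      Real.exp ((conjDiag U x).1 * dg y).trace.re :=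
    Real.continuous_exp.comp ((continuous_trace_mul (dg y)).comp (continuous_conjDiag x))
  rw [unitaryIntegral, ofReal_integral_eq_lintegral_ofReal (integrable_unitaryHaar hc)
    (Eventually.of_forall fun _ => (Real.exp_pos _).le), ← lintegral_mul_left_eq_self
      (fun U => ENNReal.ofReal (Real.exp ((conjDiag U x).1 * dg y).trace.re)) V⁻¹]
  refine lintegral_congr fun U => ?_
  congr 3
  change ((U.1 * dg x * star U.1) * (V.1 * dg y * star V.1)).trace =
    (((star V.1 * U.1) * dg x * star (star V.1 * U.1)) * dg y).trace
  rw [star_mul, star_star]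
  have h := Matrix.trace_mul_comm (U.1 * dg x * star U.1 * V.1 * dg y) (star V.1)
  simp only [← mul_assoc] at h ⊢
  rw [h]

theorem lintegral_exp_trace_spectralGauss_of_injective {N : ℕ}
    (V : Matrix.unitaryGroup (Fin N) ℂ) {y : Fin N → ℝ} (hy : Function.Injective y) :
    ∫⁻ M, ENNReal.ofReal (Real.exp (M.1 * (conjDiag V y).1).trace.re) ∂spectralGauss N =
      ENNReal.ofReal (weylConst N * N.factorial * gaussMoment 0 ^ N *
        Real.exp ((∑ i, y i ^ 2) / 2)) := by
  have hm : Measurable fun M : HermitianMatrix N =>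
      ENNReal.ofReal (Real.exp (M.1 * (conjDiag V y).1).trace.re) :=
    (continuous_trace_mul _).rexp.measurable.ennreal_ofReal
  rw [lintegral_spectralGauss hm, ← lintegral_eigenDensity_mul_unitaryIntegral hy]
  refine lintegral_congr fun x => ?_
  rw [lintegral_exp_trace_conjDiag, ENNReal.ofReal_mul]
  exact mul_nonneg (sq_nonneg _) (Real.exp_pos _).le

theorem conjDiag_add_smul {N : ℕ} (V : Matrix.unitaryGroup (Fin N) ℂ) (y z : Fin N → ℝ) (t : ℝ) :
    (conjDiag V fun i => y i + t * z i).1 = (conjDiag V y).1 + (t : ℂ) • (conjDiag V z).1 := by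
  have h : dg (fun i => y i + t * z i) = dg y + (t : ℂ) • dg z := by
    rw [← dg_smul]
    simp [dg, Matrix.diagonal_add]
  simp only [conjDiag, h, mul_add, add_mul, Matrix.mul_smul, Matrix.smul_mul]

theorem lintegral_exp_trace_spectralGauss {N : ℕ} (X : HermitianMatrix N) :
    ∫⁻ M, ENNReal.ofReal (Real.exp (M.1 * X.1).trace.re) ∂spectralGauss N =
      ENNReal.ofReal (weylConst N * N.factorial * gaussMoment 0 ^ N *
        Real.exp ((X.1 * X.1).trace.re / 2)) := by
  obtain ⟨V, hV⟩ := exists_conjDiag_eq X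
  rw [← sum_sq_eigenvalues]
  set y := X.2.eigenvalues with hy
  have h := lintegral_exp_of_eventually (μ := spectralGauss N)
    (f := fun M => (M.1 * X.1).trace.re)
    (g := fun M => (M.1 * (conjDiag V fun i => ((i : ℕ) : ℝ)).1).trace.re)
    (G := fun t => weylConst N * N.factorial * gaussMoment 0 ^ N *
        Real.exp ((∑ i : Fin N, (y i + t * ((i : ℕ) : ℝ)) ^ 2) / 2))
    (continuous_trace_mul _).measurable (continuous_trace_mul _).measurable
    (Continuous.continuousAt (by fun_prop)) ?_
  · simpa using h
  · filter_upwards [eventually_injective_add y] with t ht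
    rw [← lintegral_exp_trace_spectralGauss_of_injective V ht]
    refine lintegral_congr fun M => ?_
    rw [conjDiag_add_smul, hV, mul_add, Matrix.trace_add, Matrix.mul_smul, Matrix.trace_smul,
      Complex.add_re, smul_eq_mul, Complex.re_ofReal_mul]

theorem exists_coordForm_eq {N : ℕ} (L : StrongDual ℝ (Fin N → Fin N → ℝ)) :
    ∃ S : Fin N → Fin N → ℝ, ∀ R, L R = coordForm R S := by
  refine ⟨fun i j => (if i = j then 1 else 1 / 2) * L (Pi.single i (Pi.single j 1)), fun R => ?_⟩
  have hR : R = ∑ i, ∑ j, R i j • (Pi.single i (Pi.single j (1 : ℝ)) : Fin N → Fin N → ℝ) := by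
    funext a b
    simp only [Finset.sum_apply, Pi.smul_apply, smul_eq_mul]
    rw [Finset.sum_eq_single a, Finset.sum_eq_single b]
    · simp
    · intro j _ hj; simp [hj.symm]
    · simp
    · intro i _ hi; simp [hi.symm]
    · simp
  conv_lhs => rw [hR]
  simp only [map_sum, map_smul, smul_eq_mul, coordForm]
  refine Finset.sum_congr rfl fun i _ => Finset.sum_congr rfl fun j _ => ?_
  split_ifs <;> ring

theorem ext_of_lintegral_exp_trace {N : ℕ} {μ ν : Measure (HermitianMatrix N)}
    (hfin : ∀ X : HermitianMatrix N,
      ∫⁻ M, ENNReal.ofReal (Real.exp (M.1 * X.1).trace.re) ∂μ ≠ ⊤)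
    (h : ∀ X : HermitianMatrix N, ∫⁻ M, ENNReal.ofReal (Real.exp (M.1 * X.1).trace.re) ∂μ =
      ∫⁻ M, ENNReal.ofReal (Real.exp (M.1 * X.1).trace.re) ∂ν) : μ = ν := by
  have hL : ∀ L : StrongDual ℝ (Fin N → Fin N → ℝ), ∃ X : HermitianMatrix N,
      ∀ ρ : Measure (HermitianMatrix N),
      ∫⁻ R, ENNReal.ofReal (Real.exp (L R)) ∂(ρ.map coords) =
        ∫⁻ M, ENNReal.ofReal (Real.exp (M.1 * X.1).trace.re) ∂ρ := by
    intro L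
    obtain ⟨S, hS⟩ := exists_coordForm_eq L
    refine ⟨hermitianOfCoords S, fun ρ => ?_⟩
    rw [lintegral_map (L.continuous.rexp.measurable.ennreal_ofReal) continuous_coords.measurable]
    refine lintegral_congr fun M => ?_
    rw [hS, ← trace_hermitianOfCoords_mul, hermitianOfCoords_coords]
  have h1 : μ.map coords = ν.map coords := by
    refine ext_of_lintegral_exp (fun L => ?_) fun L => ?_
    · obtain ⟨X, hX⟩ := hL L
      rw [hX]
      exact hfin X
    · obtain ⟨X, hX⟩ := hL L
      rw [hX, hX, h]
  have h2 : ∀ ρ : Measure (HermitianMatrix N), (ρ.map coords).map hermitianOfCoords = ρ := by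
    intro ρ
    rw [Measure.map_map continuous_hermitianOfCoords.measurable continuous_coords.measurable]
    have : (hermitianOfCoords ∘ coords : HermitianMatrix N → HermitianMatrix N) = id :=
      funext hermitianOfCoords_coords
    rw [this, Measure.map_id]
  rw [← h2 μ, h1, h2]

/-- The Weyl integration formula for Hermitian matrices. -/
theorem exists_lintegral_hermitianLebesgue_eq (N : ℕ) :
    ∃ C : ℝ, 0 < C ∧ ∀ F : HermitianMatrix N → ENNReal, Measurable F →
      ∫⁻ M, F M ∂hermitianLebesgue N = ENNReal.ofReal C *
        ∫⁻ x : Fin N → ℝ, ENNReal.ofReal (vandermonde x ^ 2) *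
          ∫⁻ U, F (conjDiag U x) ∂unitaryHaar N := by
  set K := weylConst N * N.factorial * gaussMoment 0 ^ N with hK
  have hK0 : 0 < K := by
    have h1 := weylConst_pos N
    have h2 := gaussMoment_zero_pos
    have h3 : (0 : ℝ) < N.factorial := by exact_mod_cast N.factorial_pos
    positivity
  have hg0 : 0 < (gaussMass N).toReal :=
    ENNReal.toReal_pos (gaussMass_ne_zero N) (gaussMass_ne_top N)
  have hd : Measurable fun M : HermitianMatrix N =>
      ENNReal.ofReal (Real.exp (-((M.1 * M.1).trace.re / 2))) :=
    (continuous_trace_sq.div_const 2).neg.rexp.measurable.ennreal_ofReal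
  have hd' : Measurable fun M : HermitianMatrix N =>
      ENNReal.ofReal (Real.exp ((M.1 * M.1).trace.re / 2)) :=
    (continuous_trace_sq.div_const 2).rexp.measurable.ennreal_ofReal
  set ν := (hermitianLebesgue N).withDensity fun M =>
      ENNReal.ofReal (Real.exp (-((M.1 * M.1).trace.re / 2))) with hν
  have hνX : ∀ X : HermitianMatrix N,
      ∫⁻ M, ENNReal.ofReal (Real.exp (M.1 * X.1).trace.re) ∂ν =
        ENNReal.ofReal ((gaussMass N).toReal * Real.exp ((X.1 * X.1).trace.re / 2)) := by
    intro X
    rw [hν, lintegral_withDensity_eq_lintegral_mul _ hd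
      (continuous_trace_mul X.1).rexp.measurable.ennreal_ofReal, mul_comm (gaussMass N).toReal,
      ENNReal.ofReal_mul (Real.exp_pos _).le, ENNReal.ofReal_toReal (gaussMass_ne_top N),
      ← lintegral_exp_trace_sub]
    refine lintegral_congr fun M => ?_
    rw [Pi.mul_apply, ← ENNReal.ofReal_mul (Real.exp_pos _).le, ← Real.exp_add]
    congr 2
    ring
  have hmeas : ENNReal.ofReal ((gaussMass N).toReal / K) • spectralGauss N = ν := by
    refine ext_of_lintegral_exp_trace (fun X => ?_) fun X => ?_
    · rw [lintegral_smul_measure, lintegral_exp_trace_spectralGauss]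
      exact ENNReal.mul_ne_top ENNReal.ofReal_ne_top ENNReal.ofReal_ne_top
    · rw [lintegral_smul_measure, lintegral_exp_trace_spectralGauss, hνX, smul_eq_mul,
        ← ENNReal.ofReal_mul (div_pos hg0 hK0).le, ← hK]
      congr 1
      field_simp
  refine ⟨(gaussMass N).toReal / K, div_pos hg0 hK0, fun F hF => ?_⟩
  have hdF : Measurable fun M : HermitianMatrix N =>
      ENNReal.ofReal (Real.exp ((M.1 * M.1).trace.re / 2)) * F M := hd'.mul hF
  have h1 : ∫⁻ M, F M ∂hermitianLebesgue N =
      ∫⁻ M, ENNReal.ofReal (Real.exp ((M.1 * M.1).trace.re / 2)) * F M ∂ν := by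
    rw [hν, lintegral_withDensity_eq_lintegral_mul _ hd hdF]
    refine lintegral_congr fun M => ?_
    rw [Pi.mul_apply, ← mul_assoc, ← ENNReal.ofReal_mul (Real.exp_pos _).le, ← Real.exp_add,
      neg_add_cancel, Real.exp_zero, ENNReal.ofReal_one, one_mul]
  rw [h1, ← hmeas, lintegral_smul_measure, lintegral_spectralGauss hdF, smul_eq_mul]
  congr 1
  refine lintegral_congr fun x => ?_
  simp only [trace_conjDiag_mul, Complex.ofReal_re]
  rw [lintegral_const_mul' _ _ ENNReal.ofReal_ne_top, ← mul_assoc, eigenDensity,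
    ← ENNReal.ofReal_mul (mul_nonneg (sq_nonneg _) (Real.exp_pos _).le), mul_assoc (_ ^ 2),
    ← Real.exp_add, neg_add_cancel, Real.exp_zero, mul_one]

/-! ### The logarithm series -/

section Log

variable {n : Type*} [Fintype n] [DecidableEq n]

theorem conj_diagonal_pow {P Q : Matrix n n ℂ} {d e : n → ℂ} (hQP : Q * P = Matrix.diagonal e)
    (k : ℕ) : (P * Matrix.diagonal d * Q) ^ (k + 1) =
      P * Matrix.diagonal (fun p => d p ^ (k + 1) * e p ^ k) * Q := by
  induction k with
  | zero => simp
  | succ k ih =>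
    have h : P * Matrix.diagonal (fun p => d p ^ (k + 1) * e p ^ k) * Q *
        (P * Matrix.diagonal d * Q) = P * (Matrix.diagonal (fun p => d p ^ (k + 1) * e p ^ k) *
          (Q * P) * Matrix.diagonal d) * Q := by
      simp only [mul_assoc]
    rw [pow_succ, ih, h, hQP, Matrix.diagonal_mul_diagonal, Matrix.diagonal_mul_diagonal]
    congr 3
    funext p
    ring

theorem hasSum_logTerm {T P Q : Matrix n n ℂ} {d e : n → ℝ} (hd : ∀ p, 0 ≤ d p)
    (he : ∀ p, 0 ≤ e p) (hde : ∀ p, d p * e p < 1)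
    (hQP : Q * P = Matrix.diagonal fun p => (e p : ℂ))
    (hT : 1 - T = P * Matrix.diagonal (fun p => (d p : ℂ)) * Q) :
    HasSum (logTerm T) (P * Matrix.diagonal (fun p =>
      ((-∑' k : ℕ, d p ^ (k + 1) * e p ^ k / (k + 1) : ℝ) : ℂ)) * Q) := by
  have hs : ∀ p, Summable fun k : ℕ => d p ^ (k + 1) * e p ^ k / (k + 1) := by
    intro p
    refine Summable.of_nonneg_of_le (fun k => div_nonneg (mul_nonneg (pow_nonneg (hd p) _)
      (pow_nonneg (he p) _)) (by positivity)) (fun k => ?_)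
      ((summable_geometric_of_lt_one (mul_nonneg (hd p) (he p)) (hde p)).mul_left (d p))
    have h1 : d p ^ (k + 1) * e p ^ k = d p * (d p * e p) ^ k := by ring
    rw [h1]
    exact div_le_self (mul_nonneg (hd p) (pow_nonneg (mul_nonneg (hd p) (he p)) k))
      (le_add_of_nonneg_left (Nat.cast_nonneg k))
  have h2 : HasSum (fun k : ℕ => Matrix.diagonal fun p =>
      ((-(d p ^ (k + 1) * e p ^ k / (k + 1)) : ℝ) : ℂ)) (Matrix.diagonal fun p =>
        ((-∑' k : ℕ, d p ^ (k + 1) * e p ^ k / (k + 1) : ℝ) : ℂ)) := by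
    refine HasSum.matrix_diagonal (Pi.hasSum.2 fun p => ?_)
    exact Complex.hasSum_ofReal.2 (hs p).hasSum.neg
  have h3 := (h2.mul_left P).mul_right Q
  have h4 : logTerm T = fun k : ℕ => P * (Matrix.diagonal fun p =>
      ((-(d p ^ (k + 1) * e p ^ k / (k + 1)) : ℝ) : ℂ)) * Q := by
    funext k
    rw [logTerm, hT, conj_diagonal_pow hQP, ← Matrix.smul_mul, ← Matrix.mul_smul,
      ← Matrix.neg_mul, ← Matrix.mul_neg, ← Matrix.diagonal_smul, Matrix.diagonal_neg]
    congr 3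
    funext p
    simp only [Pi.smul_apply, smul_eq_mul]
    push_cast
    rw [div_eq_inv_mul]
  rw [h4]
  exact h3

theorem trace_matrixLog {T P Q : Matrix n n ℂ} {d e : n → ℝ} (hd : ∀ p, 0 ≤ d p)
    (he : ∀ p, 0 ≤ e p) (hde : ∀ p, d p * e p < 1)
    (hQP : Q * P = Matrix.diagonal fun p => (e p : ℂ))
    (hT : 1 - T = P * Matrix.diagonal (fun p => (d p : ℂ)) * Q) :
    (matrixLog T).trace = ((∑ p, Real.log (1 - d p * e p) : ℝ) : ℂ) := by
  rw [matrixLog, (hasSum_logTerm hd he hde hQP hT).tsum_eq, mul_assoc, Matrix.trace_mul_comm,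
    mul_assoc, hQP, Matrix.diagonal_mul_diagonal, Matrix.trace_diagonal, Complex.ofReal_sum]
  refine Finset.sum_congr rfl fun p _ => ?_
  rw [← Complex.ofReal_mul, neg_mul, ← tsum_mul_right]
  have h1 := Real.hasSum_pow_div_log_of_abs_lt_one (x := d p * e p)
    (by rw [abs_of_nonneg (mul_nonneg (hd p) (he p))]; exact hde p)
  have h2 : (fun k : ℕ => d p ^ (k + 1) * e p ^ k / (k + 1) * e p) =
      fun k : ℕ => (d p * e p) ^ (k + 1) / ((k : ℝ) + 1) := by
    funext k
    ring
  rw [h2, h1.tsum_eq, neg_neg]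

end Log

theorem dg_kronecker {N : ℕ} (x y : Fin N → ℝ) :
    dg x ⊗ₖ dg y = Matrix.diagonal fun p : Fin N × Fin N => ((x p.1 * y p.2 : ℝ) : ℂ) := by
  rw [dg, dg, Matrix.diagonal_kronecker_diagonal]
  congr 1
  funext p
  push_cast
  rfl

theorem dg_one {N : ℕ} : (dg fun _ : Fin N => (1 : ℝ)) = 1 := by simp [dg]

/-- The factorisation of the interaction matrix through the compression
`diag(√a) V* Φ(M) V diag(√a)`. -/
theorem exists_interaction_factor {N : ℕ} (V V' W : Matrix.unitaryGroup (Fin N) ℂ)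
    {a b y : Fin N → ℝ} (ha : ∀ i, 0 ≤ a i) (C : Matrix (Fin N) (Fin N) ℂ)
    (hy : dg (fun i => Real.sqrt (a i)) * (star V.1 * C * V.1) * dg (fun i => Real.sqrt (a i)) =
      (conjDiag W y).1) :
    ∃ P Q : Matrix (Fin N × Fin N) (Fin N × Fin N) ℂ,
      Q * P = Matrix.diagonal (fun p => ((y p.2 : ℝ) : ℂ)) ∧
      (conjDiag V' b).1 ⊗ₖ (C * (conjDiag V a).1) =
        P * Matrix.diagonal (fun p : Fin N × Fin N => ((b p.1 : ℝ) : ℂ)) * Q := by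
  set G := dg fun i => Real.sqrt (a i) with hG
  have hGG : G * G = dg a := by
    rw [hG, dg_mul]
    congr 1
    funext i
    exact Real.mul_self_sqrt (ha i)
  refine ⟨V'.1 ⊗ₖ (C * V.1 * G * W.1), star V'.1 ⊗ₖ (star W.1 * G * star V.1), ?_, ?_⟩
  · rw [← Matrix.mul_kronecker_mul, unitary_star_mul, ← dg_one]
    have h1 : star W.1 * G * star V.1 * (C * V.1 * G * W.1) = dg y := by
      have h2 : star W.1 * G * star V.1 * (C * V.1 * G * W.1) =
          star W.1 * (G * (star V.1 * C * V.1) * G) * W.1 := by simp only [mul_assoc]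
      rw [h2, hy, conjDiag]
      simp only [mul_assoc, unitary_star_mul, mul_one]
      rw [← mul_assoc, unitary_star_mul, one_mul]
    rw [h1, dg_kronecker]
    simp only [one_mul]
  · have h1 : Matrix.diagonal (fun p : Fin N × Fin N => ((b p.1 : ℝ) : ℂ)) =
        dg b ⊗ₖ dg fun _ => 1 := by
      rw [dg_kronecker]
      simp only [mul_one]
    rw [h1, ← Matrix.mul_kronecker_mul, ← Matrix.mul_kronecker_mul, dg_one, mul_one, conjDiag,
      conjDiag]
    congr 1
    have h3 : C * V.1 * G * W.1 * (star W.1 * G * star V.1) =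
        C * V.1 * G * (W.1 * star W.1) * G * star V.1 := by simp only [mul_assoc]
    rw [h3, unitary_mul_star, mul_one, mul_assoc (C * V.1), hGG]
    simp only [mul_assoc]

/-! ### Bounds on eigenvalues and continuity -/

theorem eigenvalues_le_norm {N : ℕ} {A : Matrix (Fin N) (Fin N) ℂ} (hA : A.IsHermitian)
    (i : Fin N) : hA.eigenvalues i ≤ ‖Matrix.toEuclideanCLM (𝕜 := ℂ) A‖ := by
  set v := hA.eigenvectorBasis i with hv
  have hv1 : ‖v‖ = 1 := hA.eigenvectorBasis.orthonormal.1 i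
  have h1 : Matrix.toEuclideanCLM (𝕜 := ℂ) A v = (hA.eigenvalues i : ℂ) • v := by
    have h2 := hA.mulVec_eigenvectorBasis i
    refine WithLp.ofLp_injective 2 ?_
    rw [Matrix.ofLp_toEuclideanCLM]
    exact h2
  have h2 := (Matrix.toEuclideanCLM (𝕜 := ℂ) A).le_opNorm v
  rw [h1, norm_smul, hv1, mul_one, mul_one, Complex.norm_real, Real.norm_eq_abs] at h2
  exact (le_abs_self _).trans h2

theorem continuous_cfc_hermitian {N : ℕ} {φ : ℝ → ℝ} (hφ : Continuous φ) :
    Continuous fun M : HermitianMatrix N => M.2.cfc φ := by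
  refine continuous_of_comp_conjDiag ?_
  have h : Continuous fun p : (Fin N → ℝ) × Matrix.unitaryGroup (Fin N) ℂ =>
      ((fun i => φ (p.1 i), p.2) : (Fin N → ℝ) × Matrix.unitaryGroup (Fin N) ℂ) := by fun_prop
  have hF : Continuous fun p : (Fin N → ℝ) × Matrix.unitaryGroup (Fin N) ℂ =>
      (conjDiag p.2 p.1).1 := continuous_subtype_val.comp continuous_conjDiag_uncurry
  have h1 : (fun p : (Fin N → ℝ) × Matrix.unitaryGroup (Fin N) ℂ => (conjDiag p.2 p.1).2.cfc φ) =
      fun p => (conjDiag p.2 fun i => φ (p.1 i)).1 := funext fun p => cfc_conjDiag _ _ _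
  rw [h1]
  have hG := hF.comp h
  exact hG

theorem isHermitian_cfc {N : ℕ} (M : HermitianMatrix N) (φ : ℝ → ℝ) : (M.2.cfc φ).IsHermitian := by
  obtain ⟨U, h⟩ := exists_conjDiag_eq M
  rw [← h, cfc_conjDiag]
  exact (conjDiag U _).2

theorem continuous_empirical {N : ℕ} [NeZero N] :
    Continuous (empirical : (Fin N → ℝ) → ProbabilityMeasure ℝ) := by
  refine continuous_iff_continuousAt.2 fun x => ?_
  rw [ContinuousAt, ProbabilityMeasure.tendsto_iff_forall_integral_tendsto]
  intro f
  have h : ∀ x : Fin N → ℝ, ∫ t, f t ∂(empirical x : Measure ℝ) = (N : ℝ)⁻¹ * ∑ i, f (x i) := by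
    intro x
    change ∫ t, f t ∂((N : ENNReal)⁻¹ • ∑ i, Measure.dirac (x i)) = _
    rw [integral_smul_measure, integral_finsetSum_measure fun i _ => f.integrable _]
    simp
  simp only [h]
  have hc : Continuous fun x : Fin N → ℝ => (N : ℝ)⁻¹ * ∑ i, f (x i) := by fun_prop
  exact hc.tendsto x

theorem isSymm_empirical {N : ℕ} [NeZero N] :
    IsSymm (empirical : (Fin N → ℝ) → ProbabilityMeasure ℝ) := by
  intro x σ
  refine Subtype.ext ?_
  change (N : ENNReal)⁻¹ • ∑ i, Measure.dirac (x (σ i)) = (N : ENNReal)⁻¹ • ∑ i, Measure.dirac (x i)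
  rw [Equiv.sum_comp σ fun i => Measure.dirac (x i)]

theorem continuous_spectralMeasure {N : ℕ} [NeZero N] :
    Continuous (spectralMeasure : HermitianMatrix N → ProbabilityMeasure ℝ) :=
  continuous_symm_eigenvalues continuous_empirical isSymm_empirical

theorem spectralMeasure_conjDiag {N : ℕ} [NeZero N] (U : Matrix.unitaryGroup (Fin N) ℂ)
    (x : Fin N → ℝ) : spectralMeasure (conjDiag U x) = empirical x :=
  isSymm_empirical.eigenvalues_conjDiag U x

theorem measurableSet_preimage_of_borel {α β : Type*} [TopologicalSpace α] [MeasurableSpace α]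
    [BorelSpace α] [TopologicalSpace β] {f : α → β} (hf : Continuous f) {X : Set β}
    (hX : MeasurableSet[borel β] X) : MeasurableSet {a | f a ∈ X} :=
  @Continuous.measurable α β _ _ _ _ (borel β) (@BorelSpace.mk β _ (borel β) rfl) f hf X hX

/-! ### The weight as a function of the eigenvalues of a compression -/

/-- The compression `diag(√a) V* φ(M) V diag(√a)`. -/
def interact {N : ℕ} (a : Fin N → ℝ) (V : Matrix.unitaryGroup (Fin N) ℂ) (φ : ℝ → ℝ)
    (M : HermitianMatrix N) : HermitianMatrix N :=
  ⟨dg (fun i => Real.sqrt (a i)) * (star V.1 * M.2.cfc φ * star (star V.1)) *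
      star (dg fun i => Real.sqrt (a i)),
    isHermitian_conj (isHermitian_conj (isHermitian_cfc M φ) _) _⟩

theorem interact_val {N : ℕ} (a : Fin N → ℝ) (V : Matrix.unitaryGroup (Fin N) ℂ) (φ : ℝ → ℝ)
    (M : HermitianMatrix N) : (interact a V φ M).1 =
      dg (fun i => Real.sqrt (a i)) * (star V.1 * M.2.cfc φ * V.1) *
        dg (fun i => Real.sqrt (a i)) := by
  have hGs : star (dg fun i => Real.sqrt (a i)) = dg fun i => Real.sqrt (a i) := isHermitian_dg _
  calc (interact a V φ M).1 = dg (fun i => Real.sqrt (a i)) *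
      (star V.1 * M.2.cfc φ * star (star V.1)) * star (dg fun i => Real.sqrt (a i)) := rfl
    _ = _ := by rw [star_star, hGs]

theorem interact_conjDiag {N : ℕ} (a : Fin N → ℝ) (V U : Matrix.unitaryGroup (Fin N) ℂ)
    (φ : ℝ → ℝ) (x : Fin N → ℝ) :
    interact a V φ (conjDiag U x) = compress a (V⁻¹ * U) fun i => φ (x i) := by
  refine Subtype.ext ?_
  have h : star V.1 * (conjDiag U x).2.cfc φ * star (star V.1) =
      (conjDiag (V⁻¹ * U) fun i => φ (x i)).1 := by
    rw [cfc_conjDiag]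
    change star V.1 * (U.1 * dg (fun i => φ (x i)) * star U.1) * star (star V.1) =
      (star V.1 * U.1) * dg (fun i => φ (x i)) * star (star V.1 * U.1)
    rw [star_mul]
    simp only [mul_assoc]
  change _ * (star V.1 * (conjDiag U x).2.cfc φ * star (star V.1)) * _ = _
  rw [h]
  rfl

theorem continuous_interact {N : ℕ} (a : Fin N → ℝ) (V : Matrix.unitaryGroup (Fin N) ℂ)
    {φ : ℝ → ℝ} (hφ : Continuous φ) : Continuous (interact a V φ) := by
  have h := continuous_cfc_hermitian (N := N) hφ
  exact Continuous.subtype_mk ((continuous_const.matrix_mul ((continuous_const.matrix_mul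
    h).matrix_mul continuous_const)).matrix_mul continuous_const) _

theorem eigenvalues_interact_mem {N : ℕ} {a : Fin N → ℝ} (ha : ∀ i, 0 ≤ a i) (ha1 : ∀ i, a i ≤ 1)
    (V : Matrix.unitaryGroup (Fin N) ℂ) {φ : ℝ → ℝ} {c : ℝ} (hφ : ∀ t, 0 ≤ φ t)
    (hφc : ∀ t, φ t ≤ c) (M : HermitianMatrix N) (i : Fin N) :
    (interact a V φ M).2.eigenvalues i ∈ Set.Icc 0 c := by
  obtain ⟨U, h⟩ := exists_conjDiag_eq M
  rw [← h, interact_conjDiag]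
  refine ⟨eigenvalues_compress_nonneg a (fun i => hφ _) _ i, ?_⟩
  have := eigenvalues_compress_le ha ha1 ((hφ 0).trans (hφc 0))
    (fun i => hφc (M.2.eigenvalues i)) (V⁻¹ * U) i
  rwa [one_mul] at this

/-- The weight, as a real valued function. -/
def realWeight {N : ℕ} (a b : Fin N → ℝ) (V : Matrix.unitaryGroup (Fin N) ℂ) (φ : ℝ → ℝ)
    (M : HermitianMatrix N) : ℝ :=
  Real.exp (-((N : ℝ) / 2) * (M.1 * M.1).trace.re) *
    ∏ i, ∏ j, (1 - (interact a V φ M).2.eigenvalues i * b j)⁻¹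

theorem summable_logTerm_and_weight_eq {N : ℕ} {a b : Fin N → ℝ} (ha : ∀ i, 0 ≤ a i)
    (ha1 : ∀ i, a i ≤ 1) (hb : ∀ i, 0 ≤ b i) (hb1 : ∀ i, b i ≤ 1)
    (V V' : Matrix.unitaryGroup (Fin N) ℂ) {φ : ℝ → ℝ} {c : ℝ} (hφ : ∀ t, 0 ≤ φ t)
    (hφc : ∀ t, φ t ≤ c) (hc : c < 1) (M : HermitianMatrix N) :
    Summable (logTerm (interactionMatrix (conjDiag V a).1 (conjDiag V' b).1 φ M)) ∧
      weight (conjDiag V a).1 (conjDiag V' b).1 φ M = realWeight a b V φ M := by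
  have hy := eigenvalues_interact_mem ha ha1 V hφ hφc M
  obtain ⟨W, hW⟩ := exists_conjDiag_eq (interact a V φ M)
  have hW' := (interact_val a V φ M).symm.trans (congrArg Subtype.val hW.symm)
  obtain ⟨P, Q, hQP, hK⟩ := exists_interaction_factor V V' W (b := b) ha (M.2.cfc φ)
    (y := (interact a V φ M).2.eigenvalues) hW'
  have hT : 1 - interactionMatrix (conjDiag V a).1 (conjDiag V' b).1 φ M =
      P * Matrix.diagonal (fun p : Fin N × Fin N => ((b p.1 : ℝ) : ℂ)) * Q := by
    rw [interactionMatrix, Matrix.one_kronecker_one, sub_sub_cancel, hK]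
  have hlt : ∀ p : Fin N × Fin N, b p.1 * (interact a V φ M).2.eigenvalues p.2 < 1 := fun p =>
    (mul_le_of_le_one_left (hy p.2).1 (hb1 p.1)).trans_lt ((hy p.2).2.trans_lt hc)
  have hs := hasSum_logTerm (d := fun p : Fin N × Fin N => b p.1)
    (e := fun p => (interact a V φ M).2.eigenvalues p.2) (fun p => hb p.1) (fun p => (hy p.2).1)
    hlt hQP hT
  have ht := trace_matrixLog (d := fun p : Fin N × Fin N => b p.1)
    (e := fun p => (interact a V φ M).2.eigenvalues p.2) (fun p => hb p.1) (fun p => (hy p.2).1)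
    hlt hQP hT
  refine ⟨hs.summable, ?_⟩
  have htr : (M.1 * M.1).trace = (((M.1 * M.1).trace.re : ℝ) : ℂ) := by
    obtain ⟨U, h⟩ := exists_conjDiag_eq M
    rw [← h, trace_conjDiag_mul, Complex.ofReal_re]
  have hexp : Real.exp (-∑ p : Fin N × Fin N,
      Real.log (1 - b p.1 * (interact a V φ M).2.eigenvalues p.2)) =
      ∏ i, ∏ j, (1 - (interact a V φ M).2.eigenvalues i * b j)⁻¹ := by
    rw [← Finset.sum_neg_distrib, Real.exp_sum, Finset.prod_comm, ← Finset.univ_product_univ,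
      Finset.prod_product]
    refine Finset.prod_congr rfl fun i _ => Finset.prod_congr rfl fun j _ => ?_
    rw [Real.exp_neg, Real.exp_log (sub_pos.2 (hlt (i, j))), mul_comm]
  rw [weight, ht, htr, realWeight, ← hexp, ← Real.exp_add, Complex.ofReal_exp]
  congr 1
  push_cast
  ring

theorem measurable_realWeight {N : ℕ} (a b : Fin N → ℝ) (V : Matrix.unitaryGroup (Fin N) ℂ)
    {φ : ℝ → ℝ} (hφ : Continuous φ) : Measurable (realWeight a b V φ) := by
  have h1 : Continuous fun y : Fin N → ℝ => ∏ i, ∏ j, (1 - y i * b j) := by fun_prop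
  have h2 : IsSymm fun y : Fin N → ℝ => ∏ i, ∏ j, (1 - y i * b j) := fun y σ =>
    Equiv.prod_comp σ fun i => ∏ j, (1 - y i * b j)
  have h3 := (continuous_symm_eigenvalues h1 h2).comp (continuous_interact a V hφ)
  have h4 : Measurable fun M : HermitianMatrix N =>
      (∏ i, ∏ j, (1 - (interact a V φ M).2.eigenvalues i * b j))⁻¹ := h3.measurable.inv
  have h5 : Measurable fun M : HermitianMatrix N =>
      Real.exp (-((N : ℝ) / 2) * (M.1 * M.1).trace.re) :=
    (continuous_const.mul continuous_trace_sq).rexp.measurable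
  unfold realWeight
  simp only [← Finset.prod_inv_distrib] at h4
  exact h5.mul h4

theorem realWeight_nonneg {N : ℕ} {a b : Fin N → ℝ} (ha : ∀ i, 0 ≤ a i)
    (ha1 : ∀ i, a i ≤ 1) (hb1 : ∀ i, b i ≤ 1)
    (V : Matrix.unitaryGroup (Fin N) ℂ) {φ : ℝ → ℝ} {c : ℝ} (hφ : ∀ t, 0 ≤ φ t)
    (hφc : ∀ t, φ t ≤ c) (hc : c < 1) (M : HermitianMatrix N) :
    0 ≤ realWeight a b V φ M := by
  have hy := eigenvalues_interact_mem ha ha1 V hφ hφc M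
  refine mul_nonneg (Real.exp_pos _).le (Finset.prod_nonneg fun i _ => Finset.prod_nonneg
    fun j _ => inv_nonneg.2 (sub_nonneg.2 ?_))
  exact (mul_le_of_le_one_right (hy i).1 (hb1 j)).trans ((hy i).2.trans hc.le)

theorem realWeight_le {N : ℕ} [NeZero N] {a b : Fin N → ℝ} (ha : ∀ i, 0 ≤ a i)
    (ha1 : ∀ i, a i ≤ 1) (hb1 : ∀ i, b i ≤ 1)
    (V : Matrix.unitaryGroup (Fin N) ℂ) {φ : ℝ → ℝ} {c : ℝ} (hφ : ∀ t, 0 ≤ φ t)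
    (hφc : ∀ t, φ t ≤ c) (hc : c < 1) (M : HermitianMatrix N) :
    realWeight a b V φ M ≤ (∏ _i : Fin N, ∏ _j : Fin N, (1 - c)⁻¹) *
      Real.exp (-((M.1 * M.1).trace.re / 2)) := by
  have hy := eigenvalues_interact_mem ha ha1 V hφ hφc M
  have hle : ∀ i j, (interact a V φ M).2.eigenvalues i * b j ≤ c := fun i j =>
    (mul_le_of_le_one_right (hy i).1 (hb1 j)).trans (hy i).2
  have hpos : ∀ i j, 0 ≤ (1 - (interact a V φ M).2.eigenvalues i * b j)⁻¹ := fun i j =>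
    inv_nonneg.2 (sub_nonneg.2 ((hle i j).trans hc.le))
  rw [realWeight, mul_comm]
  refine mul_le_mul ?_ ?_ (Real.exp_pos _).le (Finset.prod_nonneg fun i _ => Finset.prod_nonneg
    fun j _ => inv_nonneg.2 (sub_nonneg.2 hc.le))
  · exact Finset.prod_le_prod (fun i _ => Finset.prod_nonneg fun j _ => hpos i j) fun i _ =>
      Finset.prod_le_prod (fun j _ => hpos i j) fun j _ =>
        inv_anti₀ (sub_pos.2 hc) (sub_le_sub_left (hle i j) 1)
  · refine Real.exp_le_exp.2 ?_
    have h0 : 0 ≤ (M.1 * M.1).trace.re := by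
      rw [← sum_sq_eigenvalues]
      exact Finset.sum_nonneg fun i _ => sq_nonneg _
    have hN : (1 : ℝ) ≤ N := by exact_mod_cast NeZero.one_le
    nlinarith

theorem lintegral_realWeight_conjDiag {N : ℕ} [NeZero N] {a b : Fin N → ℝ} (ha : ∀ i, 0 ≤ a i)
    (ha1 : ∀ i, a i ≤ 1) (hb : ∀ i, 0 ≤ b i) (hb1 : ∀ i, b i ≤ 1)
    (V : Matrix.unitaryGroup (Fin N) ℂ) {φ : ℝ → ℝ} {c : ℝ} (hφ : ∀ t, 0 ≤ φ t)
    (hφc : ∀ t, φ t ≤ c) (hc : c < 1) (x : Fin N → ℝ) :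
    ∫⁻ U, ENNReal.ofReal (realWeight a b V φ (conjDiag U x)) ∂unitaryHaar N =
      ENNReal.ofReal (Real.exp (-((N : ℝ) / 2) * ∑ i, x i ^ 2)) *
        ∑' μ : YoungDiagram, ENNReal.ofReal
          (schur μ a * schur μ b * kernel μ fun i => φ (x i)) := by
  have hφx : ∀ i, 0 ≤ φ (x i) := fun i => hφ _
  have hcount : Countable YoungDiagram :=
    Function.Injective.countable (f := YoungDiagram.cells) fun μ ν h => YoungDiagram.ext h
  set e := Real.exp (-((N : ℝ) / 2) * ∑ i, x i ^ 2) with he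
  have hm : ∀ μ : YoungDiagram, Measurable fun U : Matrix.unitaryGroup (Fin N) ℂ =>
      ENNReal.ofReal (schur μ b * schur μ (compress a U fun i => φ (x i)).2.eigenvalues) :=
    fun μ => (ENNReal.continuous_ofReal.comp (continuous_const.mul
      (continuous_schur_compress μ a _))).measurable
  have h1 : ∀ U : Matrix.unitaryGroup (Fin N) ℂ,
      ENNReal.ofReal (realWeight a b V φ (conjDiag U x)) = ENNReal.ofReal e * ∑' μ : YoungDiagram,
        ENNReal.ofReal (schur μ b *
          schur μ (compress a (V⁻¹ * U) fun i => φ (x i)).2.eigenvalues) := by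
    intro U
    have hy := eigenvalues_compress_nonneg a hφx (V⁻¹ * U)
    have hy1 := fun i => eigenvalues_compress_le ha ha1 ((hφ 0).trans (hφc 0))
      (fun i => hφc (x i)) (V⁻¹ * U) i
    have hs := hasSum_cauchy hy hb fun i j =>
      (mul_le_of_le_one_right (hy i) (hb1 j)).trans_lt ((hy1 i).trans_lt (by rwa [one_mul]))
    have hev := congrArg (fun M : HermitianMatrix N => ∏ i, ∏ j, (1 - M.2.eigenvalues i * b j)⁻¹)
      (interact_conjDiag a V U φ x)
    rw [realWeight, trace_conjDiag_mul, Complex.ofReal_re, ENNReal.ofReal_mul (Real.exp_pos _).le,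
      hev, ← hs.tsum_eq, ENNReal.ofReal_tsum_of_nonneg
        (fun μ => mul_nonneg (schur_nonneg μ hb) (schur_nonneg μ hy)) hs.summable]
  simp only [h1]
  rw [lintegral_mul_left_eq_self (fun U => ENNReal.ofReal e * ∑' μ : YoungDiagram,
    ENNReal.ofReal (schur μ b * schur μ (compress a U fun i => φ (x i)).2.eigenvalues)) V⁻¹,
    lintegral_const_mul _ (Measurable.tsum hm), lintegral_tsum fun μ => (hm μ).aemeasurable]
  congr 1
  refine tsum_congr fun μ => ?_
  rw [← ofReal_mul_sphericalMean μ a (schur_nonneg μ hb) hφx]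
  congr 1
  by_cases hμ : μ.rowLen N = 0
  · have h2 := sphericalMean_mul_schur_one μ ha hφx
    rw [kernel_eq hμ hφx, ← mul_div_assoc, eq_div_iff (schur_one_pos hμ).ne', mul_assoc, h2]
    ring
  · simp only [schur_eq_zero hμ, zero_mul]

/-! ### The shape integrals -/

theorem integrable_eigenDensity (N : ℕ) :
    Integrable (eigenDensity : (Fin N → ℝ) → ℝ) := by
  have h := (integral_det_mul_det (N := N)
    (f := fun j u => Real.exp (-(1 / 2) * u ^ 2) * u ^ (j : ℕ)) (g := fun j u => u ^ (j : ℕ))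
    (fun i j => by
      refine (integrable_gaussMoment (i + j)).congr (Eventually.of_forall fun u => ?_)
      simp only [pow_add]
      ring)).1
  refine h.congr (Eventually.of_forall fun x => ?_)
  have h1 := Matrix.det_mul_column (fun i => Real.exp (-(1 / 2) * x i ^ 2)) (Matrix.vandermonde x)
  simp only [Matrix.vandermonde_apply] at h1
  change Matrix.det _ * (Matrix.vandermonde x).det = _
  rw [h1, eigenDensity, vandermonde_sq, ← Real.exp_sum, ← Finset.mul_sum]
  ring_nf

theorem exists_kernel_comp_eq {N : ℕ} [NeZero N] (μ : YoungDiagram) :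
    ∃ ν : YoungDiagram, 0 < schur ν (fun _ : Fin N => 1) ∧ ∀ x : Fin N → ℝ, (∀ i, 0 ≤ x i) →
      kernel μ x = schur ν x / schur ν (fun _ : Fin N => 1) := by
  obtain ⟨ν, hν, -, h⟩ := exists_kernel_congr (N := N) μ
  exact ⟨ν, schur_one_pos hν, fun x hx => by rw [h, kernel_eq hν hx]⟩

theorem kernel_nonneg {N : ℕ} [NeZero N] (μ : YoungDiagram) {x : Fin N → ℝ}
    (hx : ∀ i, 0 ≤ x i) : 0 ≤ kernel μ x := by
  obtain ⟨ν, hν, h⟩ := exists_kernel_comp_eq (N := N) μ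
  rw [h x hx]
  exact div_nonneg (schur_nonneg ν hx) hν.le

theorem shapeWeight_nonneg {N : ℕ} [NeZero N] (μ : YoungDiagram) {φ : ℝ → ℝ} (hφ : ∀ t, 0 ≤ φ t)
    (x : Fin N → ℝ) : 0 ≤ shapeWeight φ μ x :=
  mul_nonneg (mul_nonneg (kernel_nonneg μ fun i => hφ (x i)) (sq_nonneg _)) (Real.exp_pos _).le

theorem integrable_shapeWeight {N : ℕ} [NeZero N] (μ : YoungDiagram) {φ : ℝ → ℝ} {c : ℝ}
    (hφc : Continuous φ) (hφ : ∀ t, 0 ≤ φ t) (hφ1 : ∀ t, φ t ≤ c) :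
    Integrable (shapeWeight φ μ : (Fin N → ℝ) → ℝ) := by
  obtain ⟨ν, hν, h⟩ := exists_kernel_comp_eq (N := N) μ
  have hk : Continuous fun x : Fin N → ℝ => kernel μ fun i => φ (x i) := by
    have : (fun x : Fin N → ℝ => kernel μ fun i => φ (x i)) =
        fun x => schur ν (fun i => φ (x i)) / schur ν (fun _ : Fin N => 1) :=
      funext fun x => h _ fun i => hφ _
    rw [this]
    exact ((continuous_schur ν).comp
      (continuous_pi fun i => hφc.comp (continuous_apply i))).div_const _
  have hc : Continuous (shapeWeight φ μ : (Fin N → ℝ) → ℝ) := by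
    unfold shapeWeight vandermonde
    fun_prop
  refine ((integrable_eigenDensity N).const_mul (kernel μ fun _ : Fin N => c)).mono'
    hc.aestronglyMeasurable (Eventually.of_forall fun x => ?_)
  have hx : ∀ i, 0 ≤ φ (x i) := fun i => hφ _
  rw [Real.norm_of_nonneg (shapeWeight_nonneg μ hφ x), shapeWeight, eigenDensity, mul_assoc]
  have hN : (1 : ℝ) ≤ N := by exact_mod_cast NeZero.one_le
  have hs : 0 ≤ ∑ i, x i ^ 2 := Finset.sum_nonneg fun i _ => sq_nonneg _
  refine mul_le_mul ?_ (mul_le_mul_of_nonneg_left (Real.exp_le_exp.2 ?_) (sq_nonneg _))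
    (mul_nonneg (sq_nonneg _) (Real.exp_pos _).le)
    (kernel_nonneg μ fun _ => (hφ 0).trans (hφ1 0))
  · rw [h _ hx, h _ fun _ => (hφ 0).trans (hφ1 0)]
    exact div_le_div_of_nonneg_right (schur_mono ν hx fun i => hφ1 _) hν.le
  · nlinarith

theorem schur_mul_shapeIntegral {N : ℕ} [NeZero N] (μ : YoungDiagram) {φ : ℝ → ℝ} {r : ℝ}
    (hr : 0 < r) (hφ : ∀ t, 0 ≤ φ t) (a : Fin N → ℝ) (X : Set (ProbabilityMeasure ℝ)) :
    schur μ a * shapeIntegral N φ μ X =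
      schur μ a * (shapeIntegral N (r⁻¹ • φ) μ X * Real.exp (-(-Real.log r) * μ.card)) := by
  by_cases hμ : μ.rowLen N = 0
  · congr 1
    have he : Real.exp (-(-Real.log r) * μ.card) = r ^ μ.card := by
      rw [neg_neg, mul_comm, Real.exp_nat_mul, Real.exp_log hr]
    rw [he, shapeIntegral, shapeIntegral, ← integral_mul_const]
    congr 1
    funext x
    have h1 : kernel μ (fun i => φ (x i)) = kernel μ (fun i => (r⁻¹ • φ) (x i)) * r ^ μ.card := by
      have h2 : ∀ i, 0 ≤ (r⁻¹ • φ) (x i) := fun i => smul_nonneg (inv_pos.2 hr).le (hφ _)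
      rw [kernel_eq hμ fun i => hφ _, kernel_eq hμ h2,
        div_mul_eq_mul_div, mul_comm _ (r ^ μ.card), ← schur_smul]
      congr 2
      funext i
      simp only [Pi.smul_apply, smul_eq_mul]
      field_simp
    rw [shapeWeight, shapeWeight, h1]
    ring
  · rw [schur_eq_zero hμ, zero_mul, zero_mul]

/-! ### The expansion of the partition function -/

theorem lintegral_realWeight {N : ℕ} [NeZero N] {C : ℝ}
    (hC : ∀ F : HermitianMatrix N → ENNReal, Measurable F →
      ∫⁻ M, F M ∂hermitianLebesgue N = ENNReal.ofReal C *
        ∫⁻ x : Fin N → ℝ, ENNReal.ofReal (vandermonde x ^ 2) *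
          ∫⁻ U, F (conjDiag U x) ∂unitaryHaar N)
    {a b : Fin N → ℝ} (ha : ∀ i, 0 ≤ a i)
    (ha1 : ∀ i, a i ≤ 1) (hb : ∀ i, 0 ≤ b i) (hb1 : ∀ i, b i ≤ 1)
    (V : Matrix.unitaryGroup (Fin N) ℂ) {φ : ℝ → ℝ} {c : ℝ} (hφ0 : Continuous φ)
    (hφ : ∀ t, 0 ≤ φ t) (hφc : ∀ t, φ t ≤ c) (hc : c < 1) {X : Set (ProbabilityMeasure ℝ)}
    (hX : MeasurableSet[borel (ProbabilityMeasure ℝ)] X) :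
    ∫⁻ M in {M : HermitianMatrix N | spectralMeasure M ∈ X},
        ENNReal.ofReal (realWeight a b V φ M) ∂hermitianLebesgue N =
      ENNReal.ofReal C * ∑' μ : YoungDiagram,
        ENNReal.ofReal (schur μ a * schur μ b * shapeIntegral N φ μ X) := by
  have hcount : Countable YoungDiagram :=
    Function.Injective.countable (f := YoungDiagram.cells) fun μ ν h => YoungDiagram.ext h
  have hS : MeasurableSet {M : HermitianMatrix N | spectralMeasure M ∈ X} :=
    measurableSet_preimage_of_borel continuous_spectralMeasure hX
  have hS' : MeasurableSet {x : Fin N → ℝ | empirical x ∈ X} :=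
    measurableSet_preimage_of_borel continuous_empirical hX
  have hm : Measurable fun M => ENNReal.ofReal (realWeight a b V φ M) :=
    (measurable_realWeight a b V hφ0).ennreal_ofReal
  have hab : ∀ μ : YoungDiagram, 0 ≤ schur μ a * schur μ b := fun μ =>
    mul_nonneg (schur_nonneg μ ha) (schur_nonneg μ hb)
  rw [← lintegral_indicator hS, hC _ (hm.indicator hS)]
  congr 1
  have h1 : ∀ x : Fin N → ℝ, ENNReal.ofReal (vandermonde x ^ 2) * (∫⁻ U,
      {M : HermitianMatrix N | spectralMeasure M ∈ X}.indicator
        (fun M => ENNReal.ofReal (realWeight a b V φ M)) (conjDiag U x) ∂unitaryHaar N) =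
      {x : Fin N → ℝ | empirical x ∈ X}.indicator (fun x => ∑' μ : YoungDiagram,
        ENNReal.ofReal (schur μ a * schur μ b) * ENNReal.ofReal (shapeWeight φ μ x)) x := by
    intro x
    have h2 : ∀ U, {M : HermitianMatrix N | spectralMeasure M ∈ X}.indicator
        (fun M => ENNReal.ofReal (realWeight a b V φ M)) (conjDiag U x) =
        {x : Fin N → ℝ | empirical x ∈ X}.indicator
          (fun x => ENNReal.ofReal (realWeight a b V φ (conjDiag U x))) x := by
      intro U
      refine Set.indicator_eq_indicator (Iff.of_eq ?_) rfl
      exact congrArg (· ∈ X) (spectralMeasure_conjDiag U x)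
    simp only [h2]
    by_cases hx : x ∈ {x : Fin N → ℝ | empirical x ∈ X}
    · simp only [Set.indicator_of_mem hx]
      rw [lintegral_realWeight_conjDiag ha ha1 hb hb1 V hφ hφc hc, ← ENNReal.tsum_mul_left,
        ← ENNReal.tsum_mul_left]
      refine tsum_congr fun μ => ?_
      rw [← ENNReal.ofReal_mul (Real.exp_pos _).le, ← ENNReal.ofReal_mul (sq_nonneg _),
        ← ENNReal.ofReal_mul (hab μ), shapeWeight]
      congr 1
      ring
    · simp only [Set.indicator_of_notMem hx, lintegral_zero, mul_zero]
  simp only [h1]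
  have hw : ∀ μ : YoungDiagram, Integrable (shapeWeight φ μ : (Fin N → ℝ) → ℝ) := fun μ =>
    integrable_shapeWeight μ hφ0 hφ hφc
  rw [lintegral_indicator hS', lintegral_tsum fun μ =>
    ((hw μ).restrict.aemeasurable.ennreal_ofReal.const_mul _)]
  refine tsum_congr fun μ => ?_
  rw [lintegral_const_mul'' _ (hw μ).restrict.aemeasurable.ennreal_ofReal,
    ENNReal.ofReal_mul (hab μ), shapeIntegral, ofReal_integral_eq_lintegral_ofReal (hw μ).restrict
      (Eventually.of_forall (shapeWeight_nonneg μ hφ))]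

theorem integrable_realWeight {N : ℕ} [NeZero N] {a b : Fin N → ℝ} (ha : ∀ i, 0 ≤ a i)
    (ha1 : ∀ i, a i ≤ 1) (hb1 : ∀ i, b i ≤ 1)
    (V : Matrix.unitaryGroup (Fin N) ℂ) {φ : ℝ → ℝ} {c : ℝ} (hφ0 : Continuous φ)
    (hφ : ∀ t, 0 ≤ φ t) (hφc : ∀ t, φ t ≤ c) (hc : c < 1) :
    Integrable (realWeight a b V φ) (hermitianLebesgue N) := by
  have hg : Integrable (fun M : HermitianMatrix N => Real.exp (-((M.1 * M.1).trace.re / 2)))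
      (hermitianLebesgue N) := by
    refine (lintegral_ofReal_ne_top_iff_integrable
      (continuous_trace_sq.div_const 2).neg.rexp.measurable.aestronglyMeasurable
      (Eventually.of_forall fun M => (Real.exp_pos _).le)).1 (gaussMass_ne_top N)
  refine (hg.const_mul (∏ _i : Fin N, ∏ _j : Fin N, (1 - c)⁻¹)).mono'
    (measurable_realWeight a b V hφ0).aestronglyMeasurable (Eventually.of_forall fun M => ?_)
  rw [Real.norm_of_nonneg (realWeight_nonneg ha ha1 hb1 V hφ hφc hc M)]
  exact realWeight_le ha ha1 hb1 V hφ hφc hc M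

theorem summable_and_integral_realWeight {N : ℕ} [NeZero N] {C : ℝ} (hC0 : 0 < C)
    (hC : ∀ F : HermitianMatrix N → ENNReal, Measurable F →
      ∫⁻ M, F M ∂hermitianLebesgue N = ENNReal.ofReal C *
        ∫⁻ x : Fin N → ℝ, ENNReal.ofReal (vandermonde x ^ 2) *
          ∫⁻ U, F (conjDiag U x) ∂unitaryHaar N)
    {a b : Fin N → ℝ} (ha : ∀ i, 0 ≤ a i)
    (ha1 : ∀ i, a i ≤ 1) (hb : ∀ i, 0 ≤ b i) (hb1 : ∀ i, b i ≤ 1)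
    (V : Matrix.unitaryGroup (Fin N) ℂ) {φ : ℝ → ℝ} {c : ℝ} (hφ0 : Continuous φ)
    (hφ : ∀ t, 0 ≤ φ t) (hφc : ∀ t, φ t ≤ c) (hc : c < 1) {X : Set (ProbabilityMeasure ℝ)}
    (hX : MeasurableSet[borel (ProbabilityMeasure ℝ)] X) :
    (Summable fun μ : YoungDiagram => schur μ a * schur μ b * shapeIntegral N φ μ X) ∧
      ∫ M in {M : HermitianMatrix N | spectralMeasure M ∈ X},
        realWeight a b V φ M ∂hermitianLebesgue N =
      C * ∑' μ : YoungDiagram, schur μ a * schur μ b * shapeIntegral N φ μ X := by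
  have hint := (integrable_realWeight ha ha1 hb1 V hφ0 hφ hφc hc).restrict
    (s := {M : HermitianMatrix N | spectralMeasure M ∈ X})
  have hnn : 0 ≤ᵐ[(hermitianLebesgue N).restrict {M | spectralMeasure M ∈ X}]
      realWeight a b V φ := Eventually.of_forall (realWeight_nonneg ha ha1 hb1 V hφ hφc hc)
  have h := lintegral_realWeight hC ha ha1 hb hb1 V hφ0 hφ hφc hc hX
  have hpos : ∀ μ : YoungDiagram, 0 ≤ schur μ a * schur μ b * shapeIntegral N φ μ X := fun μ =>
    mul_nonneg (mul_nonneg (schur_nonneg μ ha) (schur_nonneg μ hb))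
      (integral_nonneg (shapeWeight_nonneg μ hφ))
  have hfin : ∑' μ : YoungDiagram,
      ENNReal.ofReal (schur μ a * schur μ b * shapeIntegral N φ μ X) ≠ ⊤ := by
    intro htop
    rw [htop, ENNReal.mul_top (ENNReal.ofReal_pos.2 hC0).ne'] at h
    exact (lintegral_ofReal_ne_top_iff_integrable hint.aestronglyMeasurable hnn).2 hint h
  have hs : Summable fun μ : YoungDiagram => schur μ a * schur μ b * shapeIntegral N φ μ X := by
    have := ENNReal.summable_toReal hfin
    simpa only [ENNReal.toReal_ofReal (hpos _)] using this
  refine ⟨hs, ?_⟩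
  rw [integral_eq_lintegral_of_nonneg_ae hnn hint.aestronglyMeasurable, h,
    ← ENNReal.ofReal_tsum_of_nonneg hpos hs, ← ENNReal.ofReal_mul hC0.le,
    ENNReal.toReal_ofReal (mul_nonneg hC0.le (tsum_nonneg hpos))]

end CharacterExpansion

end
open CharacterExpansion in
theorem mainTheorem3 :
    ∃ c : ℕ → ℝ, ∀ (N : ℕ) [NeZero N],
      0 < c N ∧
      -- the kernel is the continuous extension of `I_N(log x, l/N) Δ(log x) / Δ(x)` to `x ≥ 0`
      (∀ (μ : YoungDiagram) (x : Fin N → ℝ), (∀ i, 0 ≤ x i) →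
        Tendsto (posKernel μ) (𝓝[{y : Fin N → ℝ | ∀ i, 0 < y i}] x) (𝓝 (kernel μ x))) ∧
      ∀ (A B : Matrix (Fin N) (Fin N) ℂ) (hA : A.PosSemidef) (hB : B.PosSemidef)
        (_ : ‖Matrix.toEuclideanCLM (𝕜 := ℂ) A‖ ≤ 1) (_ : ‖Matrix.toEuclideanCLM (𝕜 := ℂ) B‖ ≤ 1)
        (Φ : ℝ →ᵇ ℝ) (_ : ∀ t, 0 ≤ Φ t) (_ : ‖Φ‖ < 1)
        (X : Set (ProbabilityMeasure ℝ)) (_ : MeasurableSet[borel (ProbabilityMeasure ℝ)] X),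
        -- the partition function is well defined
        (∀ M : HermitianMatrix N, Summable (logTerm (interactionMatrix A B Φ M))) ∧
        IntegrableOn (weight A B Φ) {M : HermitianMatrix N | spectralMeasure M ∈ X}
          (hermitianLebesgue N) ∧
        -- first expansion
        (∀ μ : YoungDiagram,
          IntegrableOn (shapeWeight Φ μ) {x : Fin N → ℝ | empirical x ∈ X}) ∧
        Summable (fun μ : YoungDiagram =>
          schurMatrix μ hA.isHermitian * schurMatrix μ hB.isHermitian * shapeIntegral N Φ μ X) ∧
        partitionFunction A B Φ X =
          ((c N * ∑' μ : YoungDiagram,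
            schurMatrix μ hA.isHermitian * schurMatrix μ hB.isHermitian *
              shapeIntegral N Φ μ X : ℝ) : ℂ) ∧
        -- second expansion, with `Ψ = Φ / ‖Φ‖` and `ρ_Φ = - log ‖Φ‖`
        (Φ ≠ 0 →
          (∀ μ : YoungDiagram,
            IntegrableOn (shapeWeight (‖Φ‖⁻¹ • Φ) μ) {x : Fin N → ℝ | empirical x ∈ X}) ∧
          Summable (fun μ : YoungDiagram =>
            schurMatrix μ hA.isHermitian * schurMatrix μ hB.isHermitian *
              shapeIntegral N (‖Φ‖⁻¹ • Φ) μ X * Real.exp (-(-Real.log ‖Φ‖) * μ.card)) ∧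
          partitionFunction A B Φ X =
            ((c N * ∑' μ : YoungDiagram,
              schurMatrix μ hA.isHermitian * schurMatrix μ hB.isHermitian *
                shapeIntegral N (‖Φ‖⁻¹ • Φ) μ X *
                  Real.exp (-(-Real.log ‖Φ‖) * μ.card) : ℝ) : ℂ)) := by
  choose c hc0 hc using exists_lintegral_hermitianLebesgue_eq
  refine ⟨c, fun N _ => ⟨hc0 N, fun μ x hx => tendsto_posKernel_kernel μ hx, ?_⟩⟩
  intro A B hA hB hA1 hB1 Φ hΦ hΦ1 X hX
  obtain ⟨V, hV⟩ := exists_conjDiag_eq ⟨A, hA.isHermitian⟩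
  obtain ⟨V', hV'⟩ := exists_conjDiag_eq ⟨B, hB.isHermitian⟩
  replace hV := congrArg Subtype.val hV
  replace hV' := congrArg Subtype.val hV'
  have ha : ∀ i, 0 ≤ hA.isHermitian.eigenvalues i := hA.eigenvalues_nonneg
  have hb : ∀ i, 0 ≤ hB.isHermitian.eigenvalues i := hB.eigenvalues_nonneg
  have ha1 : ∀ i, hA.isHermitian.eigenvalues i ≤ 1 := fun i =>
    (eigenvalues_le_norm hA.isHermitian i).trans hA1
  have hb1 : ∀ i, hB.isHermitian.eigenvalues i ≤ 1 := fun i =>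
    (eigenvalues_le_norm hB.isHermitian i).trans hB1
  have hΦc : ∀ t, Φ t ≤ ‖Φ‖ := fun t => (le_abs_self _).trans (Φ.norm_coe_le_norm t)
  have hw : ∀ M : HermitianMatrix N, Summable (logTerm (interactionMatrix A B Φ M)) ∧
      weight A B Φ M =
        realWeight hA.isHermitian.eigenvalues hB.isHermitian.eigenvalues V Φ M := by
    intro M
    have h := summable_logTerm_and_weight_eq ha ha1 hb hb1 V V' hΦ hΦc hΦ1 M
    simp only [hV, hV'] at h
    exact h
  have hwf : weight A B Φ = fun M =>
      (realWeight hA.isHermitian.eigenvalues hB.isHermitian.eigenvalues V Φ M : ℂ) :=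
    funext fun M => (hw M).2
  obtain ⟨hs, hI⟩ := summable_and_integral_realWeight (hc0 N) (hc N) ha ha1 hb hb1 V
    Φ.continuous hΦ hΦc hΦ1 hX
  have hZ : partitionFunction A B Φ X = ((c N * ∑' μ : YoungDiagram,
      schurMatrix μ hA.isHermitian * schurMatrix μ hB.isHermitian *
        shapeIntegral N Φ μ X : ℝ) : ℂ) := by
    rw [partitionFunction, hwf]
    exact integral_complex_ofReal.trans (congrArg Complex.ofReal hI)
  refine ⟨fun M => (hw M).1, ?_, fun μ =>
    (integrable_shapeWeight μ Φ.continuous hΦ hΦc).integrableOn, hs, hZ, fun hΦ0 => ?_⟩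
  · rw [hwf]
    exact (integrable_realWeight ha ha1 hb1 V Φ.continuous hΦ hΦc hΦ1).ofReal.integrableOn
  · have hr : 0 < ‖Φ‖ := norm_pos_iff.2 hΦ0
    have hterm : (fun μ : YoungDiagram =>
        schurMatrix μ hA.isHermitian * schurMatrix μ hB.isHermitian *
          shapeIntegral N (‖Φ‖⁻¹ • Φ) μ X * Real.exp (-(-Real.log ‖Φ‖) * μ.card)) =
        fun μ => schurMatrix μ hA.isHermitian * schurMatrix μ hB.isHermitian *
          shapeIntegral N Φ μ X := by
      funext μ
      have h := schur_mul_shapeIntegral μ hr hΦ hA.isHermitian.eigenvalues X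
      unfold schurMatrix
      linear_combination -schur μ hB.isHermitian.eigenvalues * h
    refine ⟨fun μ => ?_, ?_, ?_⟩
    · exact (integrable_shapeWeight μ (c := 1) (Φ.continuous.const_smul ‖Φ‖⁻¹)
        (fun t => smul_nonneg (inv_pos.2 hr).le (hΦ t)) fun t => by
          rw [Pi.smul_apply, smul_eq_mul, inv_mul_le_iff₀ hr, mul_one]
          exact hΦc t).integrableOn
    · rw [hterm]
      exact hs
    · rw [hterm]
      exact hZ
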